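/- Let $0<a<\pi$ and $1\ne\alpha>0$. Put $\rho(x)=1$ for $0\le x\le a$, $\rho(x)=\alpha$ for $a<x\le\pi$, $\mu(x)=\int_0^x\rho(s)\,ds$, $\lambda_n^0=\frac{n\pi}{\mu(\pi)}$ $(n\in\mathbb Z)$, $e(s,\lambda)=\begin{pmatrix}\sin\lambda s\\-\cos\lambda s\end{pmatrix}$ and $\varphi_0(x,\lambda)=e(\mu(x),\lambda)$; a tilde denotes transposition. Let $J=\mathbb Z\cup\{-0\}$, where $-0$ is one additional label. Let $\{\lambda_j,\alpha_j\}_{j\in J}$ be given, where the $\lambda_j$ are pairwise distinct real numbers, the $\alpha_j$ are positive numbers, and $$\lambda_n=\lambda_n^0+\epsilon_n,\qquad \alpha_n=\mu(\pi)+\tau_n\quad(n\in\mathbb Z),\qquad \{\epsilon_n\},\{\tau_n\}\in\ell_2 .$$ Let $$F_0(x,t)=\frac{1}{\alpha_{-0}}e(x,\lambda_{-0})\tilde\varphi_0(t,\lambda_{-0})+\sum_{n=-\infty}^{\infty}\Big[\frac1{\alpha_n}e(x,\lambda_n)\tilde\varphi_0(t,\lambda_n)-\frac1{\mu(\pi)}e(x,\lambda_n^0)\tilde\varphi_0(t,\lambda_n^0)\Big]$$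 (a measurable function; the symmetric partial sums converge in $L_2(0,\pi)$ with respect to $t$ for each $x\in[0,\mu(\pi)]$) and $F(x,t)=F_0(\mu(x),t)$. For each $x\in(0,\pi]$ let $A(x,\cdot)\in L_2(0,\mu(x))$ be the $2\times2$ matrix solution of $$A(x,\mu(t))+F(x,t)+\int_0^{\mu(x)}A(x,\xi)F_0(\xi,t)\,d\xi=0\qquad\text{for a.e. }t\in(0,x).$$ Let $\varphi(x,\lambda)=\begin{pmatrix}\varphi_1\\\varphi_2\end{pmatrix}=\varphi_0(x,\lambda)+\int_0^{\mu(x)}A(x,t)e(t,\lambda)\,dt$, $$\Delta(\lambda)=\mu(\pi)(\lambda_{-0}-\lambda)(\lambda_0-\lambda)\prod_{n=1}^\infty\frac{(\lambda_n-\lambda)(\lambda_{-n}-\lambda)}{\lambda_n^0\lambda_{-n}^0},\qquad \beta_j=\frac{\dot\Delta(\lambda_j)}{\alpha_j}\quad(j\in J).$$ Then $\beta_j\neq0$ for all $j\in J$, the functions $\tilde\varphi(x,\lambda_j)\varphi(x,\lambda_k)\rho(x)$ are integrable on $(0,\pi)$, and there are real numbers $h_1,h_2,H$ such that $$(\lambda_j+h_1)\varphi_1(\pi,\lambda_j)+h_2\varphi_2(\pi,\lambda_j)=0\qquad\text{for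 all }j\in J,$$ where $h_2>0$, and $h_1,h_2$ are determined by the data through $$\beta_j\varphi_1(\pi,\lambda_j)=h_2,\qquad \beta_j\varphi_2(\pi,\lambda_j)=-(\lambda_j+h_1)\qquad\text{for all }j\in J,$$ while $H$ is the constant for which $$\int_0^\pi\tilde\varphi(x,\lambda_j)\varphi(x,\lambda_j)\rho(x)\,dx=\alpha_j-\frac{H}{\beta_j^2},\qquad \int_0^\pi\tilde\varphi(x,\lambda_j)\varphi(x,\lambda_k)\rho(x)\,dx=-\frac{H}{\beta_j\beta_k}\quad(j\ne k).$$ Moreover $h_2=H$. -/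

import Mathlib

open MeasureTheory Filter Topology Set

noncomputable section

namespace DiracInverse

/-- The weight `ρ`: it is `1` on `[0, a]` and `α` on `(a, π]`. -/
def rho (a α x : ℝ) : ℝ := if x ≤ a then 1 else α

/-- The function `μ(x) = ∫₀ˣ ρ`: it is `x` on `[0, a]` and `α x - α a + a` on `(a, π]`. -/
def mu (a α x : ℝ) : ℝ := if x ≤ a then x else α * x - α * a + a

/-- The column `(sin λs, -cos λs)`. -/
def trig (l s : ℝ) : Fin 2 → ℝ := ![Real.sin (l * s), -Real.cos (l * s)]

/-- `φ₀(x, λ) = (sin λμ(x), -cos λμ(x))`. -/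
def phi0 (a α x l : ℝ) : Fin 2 → ℝ := trig l (mu a α x)

/-- `λ_n⁰ = nπ / μ(π)`. -/
def lam0 (a α : ℝ) (n : ℤ) : ℝ := n * Real.pi / mu a α Real.pi

/-- Labels `-0, 0, ±1, ±2, …`: the label `n ∈ ℤ` is `some n`, the additional label `-0` is `none`.
(The function `λ sin λμ(π)` has a double zero at `0`, so two numbers of the spectrum
belong to the zero `0` and one to each other `λ_n⁰`.) -/
abbrev Label := Option ℤ

/-- Spectral data of the required form: distinct real numbers `λ_j`, positive numbers `α_j`,
with `λ_n = λ_n⁰ + ε_n`, `α_n = μ(π) + τ_n`, `(ε_n), (τ_n) ∈ ℓ₂`. -/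
structure IsData (a α : ℝ) (lam al : Label → ℝ) : Prop where
  injective : Function.Injective lam
  pos : ∀ j, 0 < al j
  lam_asymp : Summable fun n : ℤ => (lam (some n) - lam0 a α n) ^ 2
  al_asymp : Summable fun n : ℤ => (al (some n) - mu a α Real.pi) ^ 2

/-- Symmetric partial sums of the series for `F₀(x, t)`. -/
def kernelPartial (a α : ℝ) (lam al : Label → ℝ) (N : ℕ) (x t : ℝ) :
    Matrix (Fin 2) (Fin 2) ℝ :=
  (al none)⁻¹ • Matrix.vecMulVec (trig (lam none) x) (phi0 a α t (lam none)) +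
    ∑ n ∈ Finset.Icc (-(N : ℤ)) (N : ℤ),
      ((al (some n))⁻¹ • Matrix.vecMulVec (trig (lam (some n)) x) (phi0 a α t (lam (some n))) -
        (mu a α Real.pi)⁻¹ •
          Matrix.vecMulVec (trig (lam0 a α n) x) (phi0 a α t (lam0 a α n)))

/-- `F₀` is the sum of its series: `F₀` is measurable on `(0, μ(π)) × (0, π)`, and for every
`x ∈ [0, μ(π)]` the partial sums converge to `F₀(x, ·)` in `L₂(0, π)`, entry by entry. -/
structure IsKernel (a α : ℝ) (lam al : Label → ℝ)
    (F0 : ℝ → ℝ → Matrix (Fin 2) (Fin 2) ℝ) : Prop where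
  aestronglyMeasurable : ∀ i j, AEStronglyMeasurable (fun p : ℝ × ℝ => F0 p.1 p.2 i j)
    (volume.restrict (Ioo 0 (mu a α Real.pi) ×ˢ Ioo 0 Real.pi))
  memLp : ∀ x ∈ Icc 0 (mu a α Real.pi), ∀ i j,
    MemLp (fun t => F0 x t i j) 2 (volume.restrict (Ioo 0 Real.pi))
  tendsto : ∀ x ∈ Icc 0 (mu a α Real.pi), ∀ i j,
    Tendsto (fun N : ℕ => eLpNorm (fun t => kernelPartial a α lam al N x t i j - F0 x t i j) 2
      (volume.restrict (Ioo 0 Real.pi))) atTop (𝓝 0)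

/-- `F(x, t) = F₀(μ(x), t)`. -/
def bigF (a α : ℝ) (F0 : ℝ → ℝ → Matrix (Fin 2) (Fin 2) ℝ) (x t : ℝ) :
    Matrix (Fin 2) (Fin 2) ℝ := F0 (mu a α x) t

/-- For each `x ∈ (0, π]`, `A(x, ·) ∈ L₂(0, μ(x))` solves the main equation
`A(x, μ(t)) + F(x, t) + ∫₀^{μ(x)} A(x, ξ) F₀(ξ, t) dξ = 0` for almost every `t ∈ (0, x)`. -/
def SolvesMainEquation (a α : ℝ) (F0 A : ℝ → ℝ → Matrix (Fin 2) (Fin 2) ℝ) : Prop :=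
  ∀ x ∈ Ioc 0 Real.pi,
    (∀ i j, MemLp (fun t => A x t i j) 2 (volume.restrict (Ioo 0 (mu a α x)))) ∧
    ∀ᵐ t ∂(volume.restrict (Ioo 0 x)), ∀ i j,
      A x (mu a α t) i j + bigF a α F0 x t i j +
        ∫ ξ in (0 : ℝ)..(mu a α x), (A x ξ * F0 ξ t) i j = 0

/-- `φ(x, λ) = φ₀(x, λ) + ∫₀^{μ(x)} A(x, t) (sin λt, -cos λt) dt`, at real `λ`. -/
def phi (a α : ℝ) (A : ℝ → ℝ → Matrix (Fin 2) (Fin 2) ℝ) (x l : ℝ) : Fin 2 → ℝ :=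
  fun i => phi0 a α x l i + ∫ t in (0 : ℝ)..(mu a α x), (A x t).mulVec (trig l t) i

/-- The function with zeros `λ_j` (`j = -0, 0, ±1, …`),
`Δ(λ) = μ(π) (λ_{-0} - λ)(λ_0 - λ) ∏_{n ≥ 1} (λ_n - λ)(λ_{-n} - λ) / (λ_n⁰ λ_{-n}⁰)`,
at real `λ`. -/
def charDelta (a α : ℝ) (lam : Label → ℝ) (l : ℝ) : ℝ :=
  mu a α Real.pi * ((lam none - l) * (lam (some 0) - l)) *
    ∏' k : ℕ, ((lam (some ((k : ℤ) + 1)) - l) * (lam (some (-((k : ℤ) + 1))) - l)) /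
      (lam0 a α ((k : ℤ) + 1) * lam0 a α (-((k : ℤ) + 1)))

/-- `β_j = Δ'(λ_j) / α_j`. -/
def beta (a α : ℝ) (lam al : Label → ℝ) (j : Label) : ℝ :=
  deriv (charDelta a α lam) (lam j) / al j

/-- The integrand `φ̃(x, λ) φ(x, λ') ρ(x)`. -/
def gramIntegrand (a α : ℝ) (A : ℝ → ℝ → Matrix (Fin 2) (Fin 2) ℝ) (l l' x : ℝ) : ℝ :=
  (phi a α A x l ⬝ᵥ phi a α A x l') * rho a α x

end DiracInverse

end

open DiracInverse

/-!
Write `T = μ(π)` and substitute `s = μ(x)`, which carries `ρ(x) dx` to `ds`; pairs of functions on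
`(0, T)` are written as complex functions, and `e(s, λ) = -i exp(iλs)`. Everything takes place in
the real Hilbert space `L₂((0, T); ℂ)`, and entire functions enter only as transforms
`κ sin λT + ⟨f, e(·, λ)⟩`, restricted to real `λ`.

*Zeros.* A transform vanishing at `μ` is `λ - μ` times another transform (`exists_division`, a
primitive and Fubini), hence a zero can be moved without changing `κ`, and finitely many can be
exchanged (`exists_exchange`). If all but finitely many `λₙ` are kept and the others replaced by
`nπ/T`, the vectors `e(·, λₙ)` are a small perturbation of an orthogonal basis; exchanging zeros
then shows that `e(·, λₙ)`, `n ∈ ℤ`, is complete (`eq_zero_of_inner_eq_zero`) and that there is a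
transform `Φ` with `κ = 1` and the zeros `λₙ` (`exists_generating`). Comparison with Euler's product
for the sine gives `Δ(λ) = (λ - λ_{-0}) Φ(λ)` (`charDelta_eq`), so `Δ'(λ_j)` is a nonzero number
expressed through the vectors dual to the `e(·, λₙ)`.

*The frame operator.* `S f = ∑_j α_j⁻¹ ⟨f, e(·, λ_j)⟩ e(·, λ_j)` is bounded, symmetric and coercive,
and the label `-0` makes the system `e(·, λ_j)` redundant by one vector. The one linear relation is
`∑_j e(·, λ_j) / Δ'(λ_j) = 0`, so the Gram matrix `⟨S⁻¹ e(·, λ_j), e(·, λ_k)⟩` is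
`α_j δ_{jk} - H / (β_j β_k)` with a constant `H > 0` (`inner_frameInv`, `excess_pos`).

*The Gram matrix of `φ`.* `S` is the identity plus the integral operator with kernel `F₀`
(`frameOp_eq_add_kernelOp`), so the main equation at `x` says that `A(x, ·)` inverts the compression
of `S` to functions living on `(0, s)`, `s = μ(x)`. If `u_s` is the preimage of `e(·, λ_j)` under
that compression, the derivative of `⟨u_s, e(·, λ_k)⟩` in `s` is the product of the functions `φ`
belonging to `λ_j` and `λ_k`. Integration from `0` to `T` shows that the Gram matrix of the `φ` is
that of the vectors `S⁻¹ e(·, λ_j)` (`integral_inner_sol`).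

*The right end.* For `x = π` the main equation reads `S b = -F₀(T, ·)` for both rows `b` of `A`.
Tested with the dual vectors it says that `β_j φ_1(π, λ_j)` does not depend on `j` and that
`β_j φ_2(π, λ_j) + λ_j` does not either (`endpoint_relation`); the linear relation between the
`e(·, λ_j)`, applied to the first row, identifies the first constant as `H` (`endpoint_first`).
-/

open scoped InnerProductSpace ComplexConjugate

noncomputable section

namespace DiracInverse

/-! ### The space `L₂((0, T); ℂ)` and the vectors `e(·, λ)` -/

/-- Square integrable vector functions on `(0, T)`, the pair `(f₁, f₂)` being written as the
complex function `f₁ + i f₂`. Only the real inner product `∫ f₁ g₁ + f₂ g₂` is used. -/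
abbrev Space (T : ℝ) : Type := Lp ℂ 2 (volume.restrict (Ioo 0 T))

/-- The column `(sin λs, -cos λs)` as a complex number. -/
def wave (l s : ℝ) : ℂ := ⟨Real.sin (l * s), -Real.cos (l * s)⟩

lemma wave_eq (l s : ℝ) : wave l s = -Complex.I * Complex.exp ((l * s : ℝ) * Complex.I) := by
  rw [Complex.exp_mul_I, ← Complex.ofReal_cos, ← Complex.ofReal_sin]
  apply Complex.ext <;> simp [wave, -Complex.ofReal_mul, -Complex.ofReal_cos, -Complex.ofReal_sin]

lemma norm_wave (l s : ℝ) : ‖wave l s‖ = 1 := by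
  rw [wave_eq, norm_mul, Complex.norm_exp_ofReal_mul_I]; simp

lemma continuous_wave_right (l : ℝ) : Continuous (wave l) := by
  have : wave l = fun s => -Complex.I * Complex.exp ((l * s : ℝ) * Complex.I) :=
    funext (wave_eq l)
  rw [this]; fun_prop

lemma norm_wave_sub_le (l m s : ℝ) : ‖wave l s - wave m s‖ ≤ |l - m| * |s| := by
  have h : wave l s - wave m s = -Complex.I * Complex.exp ((m * s : ℝ) * Complex.I) *
      (Complex.exp (Complex.I * ((l - m) * s : ℝ)) - 1) := by
    rw [wave_eq, wave_eq, mul_sub, mul_assoc, mul_assoc (-Complex.I), ← Complex.exp_add]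
    push_cast; ring_nf
  rw [h, norm_mul, norm_mul, Complex.norm_exp_ofReal_mul_I]
  have := Real.norm_exp_I_mul_ofReal_sub_one_le (x := (l - m) * s)
  simpa [abs_mul] using this

section
variable {T : ℝ}

lemma memLp_of_norm_le {r : ℝ → ℂ} {S : ℝ}
    (hr : AEStronglyMeasurable r (volume.restrict (Ioo 0 S))) (C : ℝ)
    (hC : ∀ x ∈ Ioo 0 S, ‖r x‖ ≤ C) : MemLp r 2 (volume.restrict (Ioo 0 S)) :=
  MemLp.of_bound hr C ((ae_restrict_iff' measurableSet_Ioo).2 (ae_of_all _ hC))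

lemma memLp_of_continuous {r : ℝ → ℂ} (hr : Continuous r) (S : ℝ) :
    MemLp r 2 (volume.restrict (Ioo 0 S)) := by
  obtain ⟨C, hC⟩ := (isCompact_Icc (a := 0) (b := S)).exists_bound_of_continuousOn hr.continuousOn
  exact memLp_of_norm_le hr.aestronglyMeasurable C fun x hx => hC x (Ioo_subset_Icc_self hx)

lemma inner_toLp {f g : ℝ → ℂ} (hf : MemLp f 2 (volume.restrict (Ioo 0 T)))
    (hg : MemLp g 2 (volume.restrict (Ioo 0 T))) :
    ⟪hf.toLp f, hg.toLp g⟫_ℝ = ∫ x in Ioo 0 T, ⟪f x, g x⟫_ℝ := by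
  rw [L2.inner_def]
  apply integral_congr_ae
  filter_upwards [hf.coeFn_toLp, hg.coeFn_toLp] with x h1 h2
  rw [h1, h2]

lemma inner_toLp_right (f : Space T) {g : ℝ → ℂ}
    (hg : MemLp g 2 (volume.restrict (Ioo 0 T))) :
    ⟪f, hg.toLp g⟫_ℝ = ∫ x in Ioo 0 T, ⟪f x, g x⟫_ℝ := by
  rw [L2.inner_def]
  apply integral_congr_ae
  filter_upwards [hg.coeFn_toLp] with x h2
  rw [h2]

lemma norm_toLp_le {f : ℝ → ℂ} (hT : 0 ≤ T) (hf : MemLp f 2 (volume.restrict (Ioo 0 T)))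
    {C : ℝ} (hC0 : 0 ≤ C) (hC : ∀ x ∈ Ioo 0 T, ‖f x‖ ≤ C) : ‖hf.toLp f‖ ≤ Real.sqrt T * C := by
  have h := Lp.norm_le_of_ae_bound (f := hf.toLp f) hC0 (by
    filter_upwards [hf.coeFn_toLp, ae_restrict_mem measurableSet_Ioo] with x h1 h2
    rw [h1]; exact hC x h2)
  refine h.trans (le_of_eq ?_)
  congr 1
  rw [measureUnivNNReal, Measure.restrict_apply_univ, Real.volume_Ioo, sub_zero,
    ENNReal.coe_toNNReal_eq_toReal, ENNReal.toReal_ofReal hT, Real.sqrt_eq_rpow]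
  norm_num

lemma memLp_wave (l S : ℝ) : MemLp (wave l) 2 (volume.restrict (Ioo 0 S)) :=
  memLp_of_norm_le (continuous_wave_right l).aestronglyMeasurable 1
    fun x _ => (norm_wave l x).le

variable (T) in
/-- The vector `e(·, λ)` of `L₂((0, T); ℂ)`. -/
def waveLp (l : ℝ) : Space T := (memLp_wave l T).toLp (wave l)

lemma coeFn_smul_waveLp (c l : ℝ) :
    (c • waveLp T l : Space T) =ᵐ[volume.restrict (Ioo 0 T)] fun x => c • wave l x := by
  filter_upwards [Lp.coeFn_smul c (waveLp T l), (memLp_wave l T).coeFn_toLp] with x h1 h2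
  rw [h1, Pi.smul_apply, waveLp, h2]

lemma norm_waveLp_le (hT : 0 ≤ T) (l : ℝ) : ‖waveLp T l‖ ≤ Real.sqrt T := by
  have := norm_toLp_le hT (memLp_wave l T) zero_le_one fun x _ => (norm_wave l x).le
  rwa [mul_one] at this

lemma norm_waveLp_sub_le (hT : 0 ≤ T) (l m : ℝ) :
    ‖waveLp T l - waveLp T m‖ ≤ Real.sqrt T * T * |l - m| := by
  rw [waveLp, waveLp, ← MemLp.toLp_sub]
  refine (norm_toLp_le hT _ (C := |l - m| * T) (by positivity) fun x hx => ?_).trans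
    (le_of_eq (by ring))
  refine (norm_wave_sub_le l m x).trans ?_
  rw [abs_of_pos hx.1]
  exact mul_le_mul_of_nonneg_left hx.2.le (abs_nonneg _)

lemma inner_wave (l m s : ℝ) : ⟪wave l s, wave m s⟫_ℝ = Real.cos ((l - m) * s) := by
  rw [Complex.inner, sub_mul, Real.cos_sub]
  simp [wave]; ring

lemma inner_waveLp_self (hT : 0 ≤ T) (l : ℝ) : ⟪waveLp T l, waveLp T l⟫_ℝ = T := by
  rw [waveLp, inner_toLp]
  simp [norm_wave, hT]

lemma inner_waveLp (hT : 0 ≤ T) {l m : ℝ} (h : l ≠ m) :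
    ⟪waveLp T l, waveLp T m⟫_ℝ = Real.sin ((l - m) * T) / (l - m) := by
  rw [waveLp, waveLp, inner_toLp, ← integral_Ioc_eq_integral_Ioo,
    ← intervalIntegral.integral_of_le hT]
  simp only [inner_wave]
  rw [intervalIntegral.integral_comp_mul_left _ (sub_ne_zero.2 h)]
  simp [div_eq_inv_mul]

lemma continuous_waveLp (hT : 0 ≤ T) : Continuous (waveLp T) := by
  have : LipschitzWith (Real.toNNReal (Real.sqrt T * T)) (waveLp T) :=
    LipschitzWith.of_dist_le_mul fun l m => by
      rw [dist_eq_norm, Real.dist_eq, Real.coe_toNNReal _ (by positivity)]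
      exact norm_waveLp_sub_le hT l m
  exact this.continuous

/-- The points `nπ/T`. -/
def node (T : ℝ) (n : ℤ) : ℝ := n * Real.pi / T

lemma sin_node (hT : 0 < T) (n : ℤ) : Real.sin (node T n * T) = 0 := by
  rw [node, div_mul_cancel₀ _ hT.ne']; exact Real.sin_int_mul_pi n

lemma cos_node (hT : 0 < T) (n : ℤ) : Real.cos (node T n * T) = (-1) ^ n := by
  rw [node, div_mul_cancel₀ _ hT.ne']; exact Real.cos_int_mul_pi n

lemma node_injective (hT : 0 < T) : Function.Injective (node T) := by
  intro m n h
  have h' : (m : ℝ) * Real.pi = n * Real.pi := by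
    simpa [node, div_left_inj' hT.ne'] using h
  exact_mod_cast mul_right_cancel₀ Real.pi_ne_zero h'

lemma exists_node_of_sin_eq_zero (hT : 0 < T) {l : ℝ} (h : Real.sin (l * T) = 0) :
    ∃ n, l = node T n := by
  obtain ⟨n, hn⟩ := Real.sin_eq_zero_iff.1 h
  exact ⟨n, by rw [node, hn, mul_div_cancel_right₀ _ hT.ne']⟩

lemma inner_waveLp_node (hT : 0 < T) {l : ℝ} {n : ℤ} (h : l ≠ node T n) :
    ⟪waveLp T l, waveLp T (node T n)⟫_ℝ = (-1) ^ n * Real.sin (l * T) / (l - node T n) := by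
  rw [inner_waveLp hT.le h, sub_mul, Real.sin_sub, sin_node hT, cos_node hT]
  ring

lemma integrable_Lp (f : Space T) : Integrable f (volume.restrict (Ioo 0 T)) :=
  (Lp.memLp f).integrable one_le_two

lemma integrable_conj_mul_exp (f : Space T) (l : ℝ) :
    Integrable (fun x => conj (f x) * Complex.exp ((l * x : ℝ) * Complex.I))
      (volume.restrict (Ioo 0 T)) := by
  have h1 : Integrable (fun x => conj (f x)) (volume.restrict (Ioo 0 T)) :=
    (integrable_Lp f).congr' (g := fun x => conj (f x))
      (Complex.continuous_conj.comp_aestronglyMeasurable (integrable_Lp f).1)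
      (ae_of_all _ fun x => by simp)
  refine h1.mul_bdd (c := 1) (by fun_prop) (ae_of_all _ fun x => ?_)
  rw [Complex.norm_exp_ofReal_mul_I]

lemma inner_waveLp_right (f : Space T) (l : ℝ) :
    ⟪f, waveLp T l⟫_ℝ =
      (∫ x in Ioo 0 T, conj (f x) * Complex.exp ((l * x : ℝ) * Complex.I)).im := by
  have hint := integrable_conj_mul_exp f l
  rw [waveLp, inner_toLp_right]
  have : ∀ z : ℂ, z.im = Complex.imCLM z := fun _ => rfl
  rw [this, ← ContinuousLinearMap.integral_comp_comm _ hint]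
  refine integral_congr_ae (ae_of_all _ fun x => ?_)
  simp only [Complex.inner, wave_eq, Complex.imCLM_apply]
  rw [show -Complex.I * Complex.exp ((l * x : ℝ) * Complex.I) * conj (f x) =
    -Complex.I * (conj (f x) * Complex.exp ((l * x : ℝ) * Complex.I)) by ring]
  simp only [Complex.mul_re, Complex.neg_re, Complex.neg_im, Complex.I_re, Complex.I_im]
  ring

end

/-! ### Completeness and division of zeros -/

section
variable {T : ℝ}

/-- Integration by parts against the primitive of an integrable function. -/
lemma integral_mul_primitive {F : ℝ → ℂ} (hF : Integrable F)
    {E E' : ℝ → ℂ} (hE : ∀ x, HasDerivAt E (E' x) x) (hE' : Continuous E') :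
    ∫ s in Ioo 0 T, E' s * ∫ t in s..T, F t = ∫ t in Ioo 0 T, F t * (E t - E 0) := by
  have hint : Integrable (fun p : ℝ × ℝ => {p : ℝ × ℝ | p.1 < p.2}.indicator
      (fun p => E' p.1 * F p.2) p)
      ((volume.restrict (Ioo 0 T)).prod (volume.restrict (Ioo 0 T))) := by
    refine Integrable.indicator ?_ (measurableSet_lt measurable_fst measurable_snd)
    exact ((memLp_of_continuous hE' T).integrable one_le_two).mul_prod hF.integrableOn
  have hswap := integral_integral_swap (f := fun s t => {p : ℝ × ℝ | p.1 < p.2}.indicator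
      (fun p => E' p.1 * F p.2) (s, t)) hint
  have h1 : ∀ s ∈ Ioo 0 T, E' s * ∫ t in s..T, F t =
      ∫ t in Ioo 0 T, {p : ℝ × ℝ | p.1 < p.2}.indicator (fun p => E' p.1 * F p.2) (s, t) := by
    intro s hs
    have : (fun t => {p : ℝ × ℝ | p.1 < p.2}.indicator (fun p => E' p.1 * F p.2) (s, t)) =
        (Ioi s).indicator fun t => E' s * F t := by
      funext t; simp [indicator]
    rw [this, setIntegral_indicator measurableSet_Ioi, integral_const_mul,
      intervalIntegral.integral_of_le hs.2.le, integral_Ioc_eq_integral_Ioo]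
    congr 3
    ext x; simp only [mem_inter_iff, mem_Ioo, mem_Ioi]
    exact ⟨fun h => ⟨⟨hs.1.trans h.1, h.2⟩, h.1⟩, fun h => ⟨h.2, h.1.2⟩⟩
  have h2 : ∀ t ∈ Ioo 0 T, F t * (E t - E 0) =
      ∫ s in Ioo 0 T, {p : ℝ × ℝ | p.1 < p.2}.indicator (fun p => E' p.1 * F p.2) (s, t) := by
    intro t ht
    have : (fun s => {p : ℝ × ℝ | p.1 < p.2}.indicator (fun p => E' p.1 * F p.2) (s, t)) =
        (Iio t).indicator fun s => E' s * F t := by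
      funext t; simp [indicator]
    have h3 : Ioo 0 T ∩ Iio t = Ioo 0 t := by
      ext x; simp only [mem_inter_iff, mem_Ioo, mem_Iio]
      exact ⟨fun h => ⟨h.1.1, h.2⟩, fun h => ⟨⟨h.1, h.2.trans ht.2⟩, h.2⟩⟩
    rw [this, setIntegral_indicator measurableSet_Iio, integral_mul_const, h3,
      ← integral_Ioc_eq_integral_Ioo, ← intervalIntegral.integral_of_le ht.1.le,
      intervalIntegral.integral_eq_sub_of_hasDerivAt (fun x _ => hE x)
        (hE'.intervalIntegrable _ _), mul_comm]
  rw [setIntegral_congr_fun measurableSet_Ioo h1, hswap,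
    ← setIntegral_congr_fun measurableSet_Ioo h2]

/-- If `κ sin λT + ⟨f, e(·, λ)⟩` vanishes at `λ = μ`, then its quotient by `λ - μ` is again the
transform of a vector. This replaces the Paley–Wiener theorem. -/
lemma exists_division (hT : 0 < T) (κ : ℝ) (f : Space T) (μ : ℝ)
    (h0 : κ * Real.sin (μ * T) + ⟪f, waveLp T μ⟫_ℝ = 0) :
    ∃ h : Space T, ∀ l, (l - μ) * ⟪h, waveLp T l⟫_ℝ =
      κ * Real.sin (l * T) + ⟪f, waveLp T l⟫_ℝ := by
  set F0 : ℝ → ℂ := fun t => conj (f t) * Complex.exp ((μ * t : ℝ) * Complex.I) with hF0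
  have hF0int : IntegrableOn F0 (Ioo 0 T) := integrable_conj_mul_exp f μ
  set F : ℝ → ℂ := (Ioo 0 T).indicator F0 with hF
  have hFint : Integrable F := hF0int.integrable_indicator measurableSet_Ioo
  -- the quotient is the transform of `r`; the constant `K` accounts for the sine term
  set K : ℂ := κ * Complex.exp ((μ * T : ℝ) * Complex.I) with hK
  set p : ℝ → ℂ := fun s => ∫ t in s..T, F t with hp
  have hpc : Continuous p := by
    have : p = fun s => -∫ t in T..s, F t := by
      funext s; exact intervalIntegral.integral_symm _ _
    rw [this]
    exact (intervalIntegral.continuous_primitive (fun a b => hFint.intervalIntegrable) T).neg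
  set r : ℝ → ℂ := fun s =>
    conj (Complex.I * Complex.exp (-((μ * s : ℝ) * Complex.I)) * (p s + K)) with hr
  have hrc : Continuous r := by fun_prop
  refine ⟨(memLp_of_continuous hrc T).toLp r, fun l => ?_⟩
  set E : ℝ → ℂ := fun s => Complex.exp (((l - μ : ℝ) * Complex.I) * s) with hE
  have hder : ∀ x, HasDerivAt E (((l - μ : ℝ) * Complex.I) * E x) x := by
    intro x
    have h := ((Complex.ofRealCLM.hasDerivAt (x := x)).const_mul
      ((l - μ : ℝ) * Complex.I : ℂ)).cexp
    simpa [hE, mul_comm] using h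
  have hmain := integral_mul_primitive (T := T) hFint hder (by fun_prop)
  have hE0 : E 0 = 1 := by simp [hE]
  -- the transform of the quotient
  have h1 : ⟪(memLp_of_continuous hrc T).toLp r, waveLp T l⟫_ℝ =
      (∫ s in Ioo 0 T, Complex.I * E s * (p s + K)).im := by
    rw [inner_waveLp_right]
    congr 1
    apply integral_congr_ae
    filter_upwards [(memLp_of_continuous hrc T).coeFn_toLp] with x hx
    rw [hx, hr, Complex.conj_conj, hE]
    simp only
    rw [show Complex.exp (((l - μ : ℝ) * Complex.I) * x) =
      Complex.exp (-((μ * x : ℝ) * Complex.I)) * Complex.exp ((l * x : ℝ) * Complex.I) by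
        rw [← Complex.exp_add]; push_cast; ring_nf]
    ring
  have hEp : IntegrableOn (fun s => ((l - μ : ℝ) * Complex.I * E s) * p s) (Ioo 0 T) :=
    (memLp_of_continuous (by fun_prop) T).integrable one_le_two
  have hEK : IntegrableOn (fun s => ((l - μ : ℝ) * Complex.I * E s) * K) (Ioo 0 T) :=
    (memLp_of_continuous (by fun_prop) T).integrable one_le_two
  have h2 : ((l - μ : ℝ) : ℂ) * ∫ s in Ioo 0 T, Complex.I * E s * (p s + K) =
      (∫ t in Ioo 0 T, F0 t * E t) - (∫ t in Ioo 0 T, F0 t) + (E T - 1) * K := by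
    rw [← integral_const_mul]
    have : ∀ s, ((l - μ : ℝ) : ℂ) * (Complex.I * E s * (p s + K)) =
        ((l - μ : ℝ) * Complex.I * E s) * p s + ((l - μ : ℝ) * Complex.I * E s) * K := by
      intro s; ring
    simp only [this]
    rw [integral_add hEp hEK, hmain, integral_mul_const, ← integral_Ioc_eq_integral_Ioo (y := T),
      ← integral_Ioc_eq_integral_Ioo (y := T),
      ← intervalIntegral.integral_of_le hT.le (f := fun s => (l - μ : ℝ) * Complex.I * E s),
      intervalIntegral.integral_eq_sub_of_hasDerivAt (fun x _ => hder x)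
        (Continuous.intervalIntegrable (by fun_prop) _ _), hE0, integral_Ioc_eq_integral_Ioo]
    congr 1
    rw [← integral_sub]
    · refine setIntegral_congr_fun measurableSet_Ioo fun t ht => ?_
      simp only [hF, indicator_of_mem ht]; ring
    · refine hF0int.mul_bdd (c := 1) (by fun_prop) (ae_of_all _ fun x => ?_)
      rw [hE]; simp only
      rw [show ((l - μ : ℝ) * Complex.I : ℂ) * x = ((l - μ) * x : ℝ) * Complex.I by
        push_cast; ring, Complex.norm_exp_ofReal_mul_I]
    · exact hF0int
  have h3 : (∫ t in Ioo 0 T, F0 t * E t).im = ⟪f, waveLp T l⟫_ℝ := by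
    rw [inner_waveLp_right]
    congr 2; funext t
    rw [hF0, hE]; simp only
    rw [mul_assoc, ← Complex.exp_add]; push_cast; ring_nf
  have h4 : (∫ t in Ioo 0 T, F0 t).im = ⟪f, waveLp T μ⟫_ℝ := by
    rw [inner_waveLp_right]
  have h5 : (E T * K).im = κ * Real.sin (l * T) := by
    rw [hE, hK]; simp only
    rw [show Complex.exp ((l - μ : ℝ) * Complex.I * T) *
      (κ * Complex.exp ((μ * T : ℝ) * Complex.I)) = κ * Complex.exp ((l * T : ℝ) * Complex.I) by
        rw [mul_left_comm, ← Complex.exp_add]; push_cast; ring_nf,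
      Complex.im_ofReal_mul, Complex.exp_ofReal_mul_I_im]
  have h6 : K.im = κ * Real.sin (μ * T) := by
    rw [hK, Complex.im_ofReal_mul, Complex.exp_ofReal_mul_I_im]
  rw [h1, ← Complex.im_ofReal_mul, h2, sub_mul, one_mul]
  simp only [Complex.add_im, Complex.sub_im, h3, h4, h5, h6]
  linarith

/-- The vectors `e(·, nπ/T)`, `n ∈ ℤ`, are complete. -/
lemma eq_zero_of_inner_node (hT : 0 < T) (f : Space T)
    (h : ∀ n, ⟪f, waveLp T (node T n)⟫_ℝ = 0) : f = 0 := by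
  -- the extension `G` of `conj f` to `(-T, T)` with `G (-x) = -conj (G x)`; its Fourier
  -- coefficients are multiples of the given inner products
  set g : ℝ → ℂ := (Ioo 0 T).indicator (fun x => conj (f x)) with hg
  have hgL : MemLp g 2 volume := by
    rw [hg, memLp_indicator_iff_restrict measurableSet_Ioo]
    exact (Lp.memLp f).star
  have hgc : MemLp (fun x => conj (g (-x))) 2 volume :=
    (hgL.comp_measurePreserving (Measure.measurePreserving_neg volume)).star
  set G : ℝ → ℂ := fun x => g x - conj (g (-x)) with hG
  have hGL : MemLp G 2 volume := hgL.sub hgc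
  have hTT : -T < T := by linarith
  have hcoef : ∀ n, fourierCoeffOn hTT G n = 0 := by
    intro n
    rw [fourierCoeffOn_eq_integral]
    have hfour : ∀ x : ℝ, (fourier (-n) : C(AddCircle (T - -T), ℂ)) (x : AddCircle (T - -T)) =
        Complex.exp ((node T (-n) * x : ℝ) * Complex.I) := by
      intro x
      rw [fourier_coe_apply]
      congr 1
      have : (T : ℂ) ≠ 0 := by exact_mod_cast hT.ne'
      rw [node]; push_cast; field_simp; ring
    simp only [hfour]
    set u : ℝ → ℂ := fun x => Complex.exp ((node T (-n) * x : ℝ) * Complex.I) with hu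
    have hunorm : ∀ x, ‖u x‖ = 1 := fun x => Complex.norm_exp_ofReal_mul_I _
    have hi1 : IntervalIntegrable (fun x => u x * g x) volume (-T) T := by
      refine IntervalIntegrable.continuousOn_mul ?_ (by fun_prop)
      exact (LocallyIntegrable.integrableOn_isCompact (hgL.locallyIntegrable one_le_two)
        isCompact_uIcc).intervalIntegrable
    have hi2 : IntervalIntegrable (fun x => u x * conj (g (-x))) volume (-T) T := by
      refine IntervalIntegrable.continuousOn_mul ?_ (by fun_prop)
      exact (LocallyIntegrable.integrableOn_isCompact (hgc.locallyIntegrable one_le_two)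
        isCompact_uIcc).intervalIntegrable
    have hA : ∫ x in (-T)..T, u x * g x =
        ∫ x in Ioo 0 T, conj (f x) * Complex.exp ((node T (-n) * x : ℝ) * Complex.I) := by
      rw [intervalIntegral.integral_of_le hTT.le, ← integral_indicator measurableSet_Ioc,
        ← integral_indicator measurableSet_Ioo]
      congr 1; funext x
      by_cases hx : x ∈ Ioo 0 T
      · have hx' : x ∈ Ioc (-T) T := ⟨by linarith [hx.1], hx.2.le⟩
        simp only [indicator_of_mem hx, indicator_of_mem hx', hg, hu]; ring
      · simp [hg, indicator_apply, -mem_Ioo, hx]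
    have hB : ∫ x in (-T)..T, u x * conj (g (-x)) = conj (∫ x in (-T)..T, u x * g x) := by
      have := intervalIntegral.integral_comp_neg (a := -T) (b := T)
        (fun x => u (-x) * conj (g x))
      simp only [neg_neg] at this
      rw [this, intervalIntegral.integral_of_le hTT.le, intervalIntegral.integral_of_le hTT.le,
        ← integral_conj]
      congr 1; funext x
      rw [map_mul, hu]
      simp only
      rw [← Complex.exp_conj]
      congr 2
      simp
    have hC : (∫ x in (-T)..T, u x * g x).im = 0 := by
      rw [hA, ← inner_waveLp_right]; exact h (-n)
    have hD : ∫ x in (-T)..T, u x • G x = 0 := by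
      simp only [hG, smul_eq_mul, mul_sub]
      rw [intervalIntegral.integral_sub hi1 hi2, hB, sub_eq_zero]
      exact (Complex.conj_eq_iff_im.2 hC).symm
    rw [hD, smul_zero]
  have hP := hasSum_sq_fourierCoeffOn hTT (f := G) (hGL.restrict _)
  simp only [hcoef, norm_zero, ne_eq, OfNat.ofNat_ne_zero, not_false_eq_true, zero_pow] at hP
  have hz : ∫ x in (-T)..T, ‖G x‖ ^ 2 = 0 := by
    have := hP.unique hasSum_zero
    rw [smul_eq_mul, mul_eq_zero] at this
    exact this.resolve_left (inv_ne_zero (by linarith))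
  rw [intervalIntegral.integral_of_le hTT.le, integral_eq_zero_iff_of_nonneg
    (fun x => by positivity) (hGL.restrict _).norm.integrable_sq] at hz
  rw [Lp.eq_zero_iff_ae_eq_zero]
  have hz' : ∀ᵐ x ∂(volume.restrict (Ioo 0 T)), ‖G x‖ ^ 2 = 0 :=
    ae_restrict_of_ae_restrict_of_subset
      (fun x hx => ⟨by linarith [hx.1], hx.2.le⟩ : Ioo 0 T ⊆ Ioc (-T) T) hz
  filter_upwards [hz', ae_restrict_mem measurableSet_Ioo] with x h1 hx
  have hneg : -x ∉ Ioo 0 T := fun h => by linarith [h.1, hx.1]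
  simpa [hG, hg, indicator_of_mem hx, indicator_of_notMem hneg] using h1

end

/-! ### Exchange of zeros -/

section
variable {T : ℝ}

/-- The function `λ ↦ κ sin λT + ⟨f, e(·, λ)⟩`. -/
def sineFun (T κ : ℝ) (f : Space T) (l : ℝ) : ℝ := κ * Real.sin (l * T) + ⟪f, waveLp T l⟫_ℝ

lemma continuous_sineFun (hT : 0 ≤ T) (κ : ℝ) (f : Space T) : Continuous (sineFun T κ f) := by
  have := continuous_waveLp hT
  unfold sineFun; fun_prop

/-- A zero `μ` of `κ sin λT + ⟨f, e(·, λ)⟩` can be moved to `μ'`: division by `λ - μ` and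
multiplication by `λ - μ'` do not change the coefficient `κ`. -/
lemma exists_move (hT : 0 < T) {κ : ℝ} {f : Space T} {μ : ℝ} (h0 : sineFun T κ f μ = 0) (μ' : ℝ) :
    ∃ g : Space T, ∀ l, (l - μ) * sineFun T κ g l = (l - μ') * sineFun T κ f l := by
  obtain ⟨h, hh⟩ := exists_division hT κ f μ h0
  refine ⟨f + (μ - μ') • h, fun l => ?_⟩
  have := hh l
  simp only [sineFun, inner_add_left, real_inner_smul_left]
  linear_combination (μ - μ') * this

/-- Finitely many zeros of `κ sin λT + ⟨f, e(·, λ)⟩` may be replaced by equally many others. -/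
lemma exists_exchange (hT : 0 < T) {κ : ℝ} (A' : Finset ℝ) (R : Set ℝ) (hA'R : ∀ x ∈ A', x ∉ R)
    (f : Space T) (A : Finset ℝ) (hcard : A.card = A'.card) (hAR : ∀ x ∈ A, x ∉ R)
    (hfA : ∀ x ∈ A, sineFun T κ f x = 0) (hfR : ∀ x ∈ R, sineFun T κ f x = 0) :
    ∃ g : Space T, (∀ x ∈ A', sineFun T κ g x = 0) ∧ (∀ x ∈ R, sineFun T κ g x = 0) ∧
      ∀ l ∉ A', (∏ x ∈ A, (l - x)) * sineFun T κ g l =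
        (∏ x ∈ A', (l - x)) * sineFun T κ f l := by
  induction hn : (A \ A').card generalizing A f with
  | zero =>
    have hsub : A ⊆ A' := by
      rwa [Finset.card_eq_zero, Finset.sdiff_eq_empty_iff_subset] at hn
    obtain rfl := Finset.eq_of_subset_of_card_le hsub hcard.ge
    exact ⟨f, hfA, hfR, fun _ _ => rfl⟩
  | succ n ih =>
    obtain ⟨μ, hμ⟩ : (A \ A').Nonempty := Finset.card_pos.1 (by omega)
    obtain ⟨μ', hμ'⟩ : (A' \ A).Nonempty := by
      rw [← Finset.card_pos, Finset.card_sdiff_comm hcard.symm]; omega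
    rw [Finset.mem_sdiff] at hμ hμ'
    have hne : μ' ≠ μ := fun h => hμ.2 (h ▸ hμ'.1)
    obtain ⟨f₁, hf₁⟩ := exists_move hT (hfA μ hμ.1) μ'
    have hkeep : ∀ x, x ≠ μ → sineFun T κ f x = 0 → sineFun T κ f₁ x = 0 := by
      intro x hx h0
      have := hf₁ x
      rw [h0, mul_zero, mul_eq_zero] at this
      exact this.resolve_left (sub_ne_zero.2 hx)
    have hμ'A : μ' ∉ A.erase μ := fun h => hμ'.2 (Finset.mem_of_mem_erase h)
    obtain ⟨g, hg1, hg2, hg3⟩ := ih f₁ (insert μ' (A.erase μ))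
      (by rw [Finset.card_insert_of_notMem hμ'A, Finset.card_erase_add_one hμ.1, hcard])
      (by
        intro x hx
        rcases Finset.mem_insert.1 hx with rfl | hx
        · exact hA'R _ hμ'.1
        · exact hAR x (Finset.mem_of_mem_erase hx))
      (by
        intro x hx
        rcases Finset.mem_insert.1 hx with rfl | hx
        · have := hf₁ x
          rw [sub_self, zero_mul, mul_eq_zero] at this
          exact this.resolve_left (sub_ne_zero.2 hne)
        · exact hkeep x (Finset.ne_of_mem_erase hx) (hfA x (Finset.mem_of_mem_erase hx)))
      (fun x hx => hkeep x (fun h => hAR μ hμ.1 (h ▸ hx)) (hfR x hx))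
      (by
        have : insert μ' (A.erase μ) \ A' = (A \ A').erase μ := by
          ext x
          simp only [Finset.mem_sdiff, Finset.mem_insert, Finset.mem_erase]
          constructor
          · rintro ⟨rfl | h, h2⟩
            · exact absurd hμ'.1 h2
            · exact ⟨h.1, h.2, h2⟩
          · rintro ⟨h1, h2, h3⟩
            exact ⟨Or.inr ⟨h1, h2⟩, h3⟩
        rw [this, Finset.card_erase_of_mem (Finset.mem_sdiff.2 hμ)]; omega)
    refine ⟨g, hg1, hg2, fun l hl => ?_⟩
    have hlμ' : l - μ' ≠ 0 := sub_ne_zero.2 fun h => hl (h ▸ hμ'.1)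
    have h1 := hg3 l hl
    rw [Finset.prod_insert hμ'A] at h1
    have h2 := hf₁ l
    rw [← Finset.mul_prod_erase A _ hμ.1]
    apply mul_left_cancel₀ hlμ'
    linear_combination (l - μ) * h1 + (∏ x ∈ A', (l - x)) * h2

end

/-! ### Sequences of vectors close to an orthonormal basis -/

section
variable {ι H : Type*} [NormedAddCommGroup H] [InnerProductSpace ℝ H]

lemma memlp_two_iff {y : ι → ℝ} : Memℓp y 2 ↔ Summable fun i => y i ^ 2 := by
  rw [memℓp_gen_iff (by norm_num)]
  simp

lemma lp_norm_sq (y : lp (fun _ : ι => ℝ) 2) : ‖y‖ ^ 2 = ∑' i, y i ^ 2 := by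
  rw [← real_inner_self_eq_norm_sq, lp.inner_eq_tsum]
  simp [pow_two]

/-- The map `f ↦ (⟨vᵢ, f⟩)ᵢ` into `ℓ₂` defined by vectors satisfying Bessel's inequality. -/
def analysis (v : ι → H) (C : ℝ) (hC : ∀ f, ∀ s : Finset ι, ∑ i ∈ s, ⟪v i, f⟫_ℝ ^ 2 ≤ C * ‖f‖ ^ 2) :
    H →L[ℝ] lp (fun _ : ι => ℝ) 2 :=
  LinearMap.mkContinuous
    { toFun := fun f => ⟨fun i => ⟪v i, f⟫_ℝ, memlp_two_iff.2
        (summable_of_sum_le (fun _ => sq_nonneg _) (hC f))⟩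
      map_add' := fun f g => by ext i; exact inner_add_right _ _ _
      map_smul' := fun c f => by ext i; exact real_inner_smul_right _ _ _ }
    (Real.sqrt C) (fun f => by
      rw [← Real.sqrt_sq (norm_nonneg f), ← Real.sqrt_mul' _ (sq_nonneg _)]
      refine Real.le_sqrt_of_sq_le ?_
      rw [lp_norm_sq]
      exact (summable_of_sum_le (fun _ => sq_nonneg _) (hC f)).tsum_le_of_sum_le (hC f))

@[simp] lemma analysis_apply (v : ι → H) (C : ℝ)
    (hC : ∀ f, ∀ s : Finset ι, ∑ i ∈ s, ⟪v i, f⟫_ℝ ^ 2 ≤ C * ‖f‖ ^ 2) (f : H) (i : ι) :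
    analysis v C hC f i = ⟪v i, f⟫_ℝ := rfl

lemma norm_analysis_le (v : ι → H) (C : ℝ)
    (hC : ∀ f, ∀ s : Finset ι, ∑ i ∈ s, ⟪v i, f⟫_ℝ ^ 2 ≤ C * ‖f‖ ^ 2) :
    ‖analysis v C hC‖ ≤ Real.sqrt C :=
  LinearMap.mkContinuous_norm_le _ (Real.sqrt_nonneg _) _

lemma sum_inner_sq_le (v : ι → H) (f : H) (s : Finset ι) :
    ∑ i ∈ s, ⟪v i, f⟫_ℝ ^ 2 ≤ (∑ i ∈ s, ‖v i‖ ^ 2) * ‖f‖ ^ 2 := by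
  rw [Finset.sum_mul]
  refine Finset.sum_le_sum fun i _ => ?_
  rw [← mul_pow, ← sq_abs ⟪v i, f⟫_ℝ]
  exact pow_le_pow_left₀ (abs_nonneg _) (abs_real_inner_le_norm _ _) 2

/-- Vectors `vᵢ` with `∑ ‖vᵢ - bᵢ‖² ≤ θ² < 1` for an orthonormal basis `b` form a Riesz basis:
each moment problem `⟨vᵢ, f⟩ = yᵢ` with `y ∈ ℓ₂` is solvable, and `f` is controlled by `y`. -/
lemma exists_of_close_to_basis [CompleteSpace H] (b : HilbertBasis ι ℝ H) (v : ι → H) {θ : ℝ}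
    (hθ0 : 0 ≤ θ) (hθ : θ < 1) (hv : ∀ s : Finset ι, ∑ i ∈ s, ‖v i - b i‖ ^ 2 ≤ θ ^ 2) :
    (∀ y : lp (fun _ : ι => ℝ) 2, ∃ f : H, ∀ i, ⟪v i, f⟫_ℝ = y i) ∧
    (∀ (f : H) (y : lp (fun _ : ι => ℝ) 2), (∀ i, ⟪v i, f⟫_ℝ = y i) → (1 - θ) * ‖f‖ ≤ ‖y‖) := by
  set D := analysis (fun i => v i - b i) (θ ^ 2) (fun f s =>
    (sum_inner_sq_le _ f s).trans (mul_le_mul_of_nonneg_right (hv s) (sq_nonneg _))) with hD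
  have hDn : ‖D‖ ≤ θ := (norm_analysis_le _ _ _).trans (Real.sqrt_sq hθ0).le
  have hsum : ∀ f : H, ∀ i, ⟪v i, f⟫_ℝ = (b.repr f + D f) i := by
    intro f i
    rw [lp.coeFn_add, Pi.add_apply, hD, analysis_apply, b.repr_apply_apply, ← inner_add_left]
    simp
  constructor
  · intro y
    set K : H →L[ℝ] H := (b.repr.symm : lp (fun _ : ι => ℝ) 2 →L[ℝ] H) ∘L D with hK
    have hKn : ‖-K‖ < 1 := by
      rw [norm_neg]
      refine lt_of_le_of_lt (ContinuousLinearMap.opNorm_le_bound _ hθ0 fun f => ?_) hθ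
      rw [hK]
      simp only [ContinuousLinearMap.comp_apply]
      refine (b.repr.symm.norm_map _).le.trans ((D.le_opNorm f).trans ?_)
      exact mul_le_mul_of_nonneg_right hDn (norm_nonneg _)
    obtain ⟨u, hu⟩ := isUnit_one_sub_of_norm_lt_one hKn
    refine ⟨(↑u⁻¹ : H →L[ℝ] H) (b.repr.symm y), fun i => ?_⟩
    set f := (↑u⁻¹ : H →L[ℝ] H) (b.repr.symm y) with hf
    have h1 : (u : H →L[ℝ] H) f = b.repr.symm y := by
      rw [hf, ← mul_apply_eq_comp, Units.mul_inv]; rfl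
    rw [hu] at h1
    have h2 : f + b.repr.symm (D f) = b.repr.symm y := by
      simpa [hK] using h1
    have h3 := congrArg b.repr h2
    rw [map_add, LinearIsometryEquiv.apply_symm_apply, LinearIsometryEquiv.apply_symm_apply] at h3
    rw [hsum, h3]
  · intro f y hy
    have h : y = b.repr f + D f := by
      ext i; rw [← hy, hsum]
    have h1 : ‖b.repr f‖ ≤ ‖y‖ + ‖D f‖ := by
      have := norm_sub_le y (D f)
      rwa [h, add_sub_cancel_right, ← h] at this
    rw [LinearIsometryEquiv.norm_map] at h1
    have h2 : ‖D f‖ ≤ θ * ‖f‖ :=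
      (D.le_opNorm f).trans (mul_le_mul_of_nonneg_right hDn (norm_nonneg _))
    linarith

end

/-! ### The generating function of the sequence `λₙ` -/

lemma exists_sum_lt_of_disjoint_Icc {u : ℤ → ℝ} (hu : Summable u) {δ : ℝ} (hδ : 0 < δ) :
    ∃ N₀ : ℕ, ∀ N : ℕ, N₀ ≤ N → ∀ s : Finset ℤ, Disjoint s (Finset.Icc (-(N : ℤ)) N) →
      ∑ n ∈ s, u n < δ := by
  obtain ⟨s₀, hs₀⟩ := summable_iff_vanishing_norm.1 hu δ hδ
  refine ⟨s₀.sup Int.natAbs, fun N hN s hs => ?_⟩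
  refine (le_abs_self _).trans_lt (hs₀ s (hs.mono_right fun n hn => ?_))
  have : n.natAbs ≤ N := (Finset.le_sup hn).trans hN
  rw [Finset.mem_Icc]; omega

lemma prod_Icc_neg {M : Type*} [CommMonoid M] (f : ℤ → M) (K : ℕ) :
    ∏ n ∈ Finset.Icc (-(K : ℤ)) K, f n =
      f 0 * ∏ k ∈ Finset.range K, f ((k : ℤ) + 1) * f (-((k : ℤ) + 1)) := by
  induction K with
  | zero => simp
  | succ K ih =>
    have h : Finset.Icc (-((K + 1 : ℕ) : ℤ)) ((K + 1 : ℕ) : ℤ) =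
        insert ((K : ℤ) + 1) (insert (-((K : ℤ) + 1)) (Finset.Icc (-(K : ℤ)) K)) := by
      ext n; simp only [Finset.mem_Icc, Finset.mem_insert]; push_cast; omega
    rw [h, Finset.prod_insert, Finset.prod_insert, ih, Finset.prod_range_succ]
    · ac_rfl
    · simp
    · simp only [Finset.mem_insert, Finset.mem_Icc]; omega

lemma tendsto_Icc_neg : Tendsto (fun N : ℕ => Finset.Icc (-(N : ℤ)) N) atTop atTop := by
  refine tendsto_atTop_finset_of_monotone (fun a b hab => ?_) fun m => ⟨m.natAbs, ?_⟩
  · exact Finset.Icc_subset_Icc (by simpa using hab) (by simpa using hab)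
  · rw [Finset.mem_Icc]; omega

section
variable {T : ℝ}

/-- The orthonormal basis `T^{-1/2} e(·, nπ/T)`. -/
def nodeBasis (hT : 0 < T) : HilbertBasis ℤ ℝ (Space T) :=
  HilbertBasis.mkOfOrthogonalEqBot (v := fun n => (Real.sqrt T)⁻¹ • waveLp T (node T n))
    (by
      have hsq : Real.sqrt T ≠ 0 := (Real.sqrt_pos.2 hT).ne'
      rw [orthonormal_iff_ite]
      intro m n
      rw [real_inner_smul_left, real_inner_smul_right]
      split_ifs with h
      · subst h
        rw [inner_waveLp_self hT.le]
        field_simp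
        exact (Real.sq_sqrt hT.le).symm
      · rw [inner_waveLp_node hT (fun h' => h (node_injective hT h')), sin_node hT]
        simp)
    (by
      rw [Submodule.eq_bot_iff]
      intro f hf
      rw [Submodule.mem_orthogonal'] at hf
      refine eq_zero_of_inner_node hT f fun n => ?_
      have h := hf _ (Submodule.subset_span ⟨n, rfl⟩)
      rw [real_inner_smul_right] at h
      exact (mul_eq_zero.1 h).resolve_left (inv_ne_zero (Real.sqrt_pos.2 hT).ne'))

lemma nodeBasis_apply (hT : 0 < T) (n : ℤ) :
    nodeBasis hT n = (Real.sqrt T)⁻¹ • waveLp T (node T n) := by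
  rw [nodeBasis, HilbertBasis.coe_mkOfOrthogonalEqBot]

lemma hasSum_inner_node (hT : 0 < T) (f g : Space T) :
    HasSum (fun n => T⁻¹ * (⟪waveLp T (node T n), f⟫_ℝ * ⟪waveLp T (node T n), g⟫_ℝ))
      ⟪f, g⟫_ℝ := by
  refine ((nodeBasis hT).hasSum_inner_mul_inner f g).congr_fun fun n => ?_
  rw [nodeBasis_apply, real_inner_smul_left, real_inner_smul_right, real_inner_comm f,
    show T⁻¹ = (Real.sqrt T)⁻¹ * (Real.sqrt T)⁻¹ by
      rw [← mul_inv, Real.mul_self_sqrt hT.le]]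
  ring

/-- The points `nπ/T` for `|n| ≤ N`, continued by the given numbers. -/
def mixedNode (T : ℝ) (lam : ℤ → ℝ) (N : ℕ) (n : ℤ) : ℝ :=
  if n ∈ Finset.Icc (-(N : ℤ)) N then node T n else lam n

variable {lam : ℤ → ℝ}

/-- If sufficiently many of the `λₙ` are replaced by `nπ/T`, the vectors `e(·, λ)` become a small
perturbation of an orthogonal basis. -/
lemma exists_moment_mixedNode (hT : 0 < T)
    (hsum : Summable fun n => (lam n - node T n) ^ 2) :
    ∃ N₀ : ℕ, ∀ N : ℕ, N₀ ≤ N →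
      (∀ y : lp (fun _ : ℤ => ℝ) 2, ∃ f : Space T, ∀ n,
        ⟪f, waveLp T (mixedNode T lam N n)⟫_ℝ = y n) ∧
      (∀ (f : Space T) (y : lp (fun _ : ℤ => ℝ) 2),
        (∀ n, ⟪f, waveLp T (mixedNode T lam N n)⟫_ℝ = y n) →
          ‖f‖ ≤ 2 * (Real.sqrt T)⁻¹ * ‖y‖) := by
  have hsq : 0 < Real.sqrt T := Real.sqrt_pos.2 hT
  obtain ⟨N₀, hN₀⟩ := exists_sum_lt_of_disjoint_Icc hsum
    (δ := (T ^ 2)⁻¹ * (1 / 2) ^ 2) (by positivity)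
  refine ⟨N₀, fun N hN => ?_⟩
  set v : ℤ → Space T := fun n => (Real.sqrt T)⁻¹ • waveLp T (mixedNode T lam N n) with hv
  have hclose : ∀ s : Finset ℤ, ∑ n ∈ s, ‖v n - nodeBasis hT n‖ ^ 2 ≤ (1 / 2) ^ 2 := by
    intro s
    have hterm : ∀ n, ‖v n - nodeBasis hT n‖ ^ 2 ≤
        if n ∈ Finset.Icc (-(N : ℤ)) N then 0 else T ^ 2 * (lam n - node T n) ^ 2 := by
      intro n
      simp only [nodeBasis_apply, hv, mixedNode]
      split_ifs with h
      · simp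
      · rw [← smul_sub, norm_smul, Real.norm_eq_abs, abs_of_pos (inv_pos.2 hsq)]
        have h1 := mul_le_mul_of_nonneg_left (norm_waveLp_sub_le hT.le (lam n) (node T n))
          (inv_pos.2 hsq).le
        rw [mul_assoc, inv_mul_cancel_left₀ hsq.ne'] at h1
        rw [← sq_abs (lam n - node T n), ← mul_pow]
        exact pow_le_pow_left₀ (by positivity) h1 2
    refine (Finset.sum_le_sum fun n _ => hterm n).trans ?_
    rw [Finset.sum_ite, Finset.sum_const_zero, zero_add, ← Finset.mul_sum]
    have := (hN₀ N hN (s.filter fun n => n ∉ Finset.Icc (-(N : ℤ)) N) (by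
      rw [Finset.disjoint_left]
      intro n hn
      exact (Finset.mem_filter.1 hn).2)).le
    calc _ ≤ T ^ 2 * ((T ^ 2)⁻¹ * (1 / 2) ^ 2) := mul_le_mul_of_nonneg_left this (sq_nonneg _)
      _ = _ := by field_simp
  obtain ⟨h1, h2⟩ := exists_of_close_to_basis (nodeBasis hT) v (θ := 1 / 2) (by norm_num)
    (by norm_num) hclose
  have hinner : ∀ (f : Space T) n, ⟪v n, f⟫_ℝ =
      (Real.sqrt T)⁻¹ * ⟪f, waveLp T (mixedNode T lam N n)⟫_ℝ := by
    intro f n; rw [hv]; simp only; rw [real_inner_smul_left, real_inner_comm]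
  constructor
  · intro y
    obtain ⟨f, hf⟩ := h1 ((Real.sqrt T)⁻¹ • y)
    refine ⟨f, fun n => ?_⟩
    have := hf n
    rw [hinner, lp.coeFn_smul, Pi.smul_apply, smul_eq_mul] at this
    exact mul_left_cancel₀ (inv_ne_zero hsq.ne') this
  · intro f y hy
    have := h2 f ((Real.sqrt T)⁻¹ • y) fun n => by
      rw [hinner, hy, lp.coeFn_smul, Pi.smul_apply, smul_eq_mul]
    rw [norm_smul, Real.norm_eq_abs, abs_of_pos (inv_pos.2 hsq)] at this
    linarith

/-- Solvability of the moment problem forces the points of the mixed sequence to be distinct. -/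
lemma disjoint_mixedNode {N : ℕ}
    (h : ∀ y : lp (fun _ : ℤ => ℝ) 2, ∃ f : Space T, ∀ n,
        ⟪f, waveLp T (mixedNode T lam N n)⟫_ℝ = y n)
    {m n : ℤ} (hm : m ∈ Finset.Icc (-(N : ℤ)) N) (hn : n ∉ Finset.Icc (-(N : ℤ)) N) :
    node T m ≠ lam n := by
  intro heq
  obtain ⟨f, hf⟩ := h (lp.single 2 m 1)
  have h1 := hf m
  have h2 := hf n
  have hmn : n ≠ m := fun h => hn (h ▸ hm)
  rw [mixedNode, if_pos hm, lp.single_apply_self] at h1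
  rw [mixedNode, if_neg hn, lp.single_apply_ne _ _ _ hmn, ← heq, h1] at h2
  exact one_ne_zero h2

/-- The vectors `e(·, λₙ)`, `n ∈ ℤ`, are complete: finitely many zeros of a transform vanishing at
all `λₙ` are exchanged for `nπ/T`, and then the transform vanishes. -/
lemma eq_zero_of_inner_eq_zero (hT : 0 < T) (hinj : Function.Injective lam)
    (hsum : Summable fun n => (lam n - node T n) ^ 2) (f : Space T)
    (h : ∀ n, ⟪f, waveLp T (lam n)⟫_ℝ = 0) : f = 0 := by
  obtain ⟨N, hN⟩ := exists_moment_mixedNode hT hsum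
  obtain ⟨h1, h2⟩ := hN N le_rfl
  set I := Finset.Icc (-(N : ℤ)) N with hI
  obtain ⟨g, hg1, hg2, hg3⟩ := exists_exchange hT (κ := 0) (I.image (node T)) (lam '' {n | n ∉ I})
    (by
      intro x hx ⟨n, hn, hnx⟩
      obtain ⟨m, hm, rfl⟩ := Finset.mem_image.1 hx
      exact disjoint_mixedNode h1 hm hn hnx.symm)
    f (I.image lam)
    (by rw [Finset.card_image_of_injective _ hinj,
      Finset.card_image_of_injective _ (node_injective hT)])
    (by
      intro x hx ⟨n, hn, hnx⟩
      obtain ⟨m, hm, rfl⟩ := Finset.mem_image.1 hx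
      exact hn (hinj hnx ▸ hm))
    (by
      intro x hx
      obtain ⟨m, hm, rfl⟩ := Finset.mem_image.1 hx
      simp [sineFun, h m])
    (by
      rintro x ⟨n, hn, rfl⟩
      simp [sineFun, h n])
  have hg : g = 0 := by
    have := h2 g 0 fun n => by
      rw [mixedNode]
      split_ifs with hn
      · simpa [sineFun] using hg1 _ (Finset.mem_image_of_mem _ hn)
      · simpa [sineFun] using hg2 _ ⟨n, hn, rfl⟩
    rw [norm_zero, mul_zero] at this
    exact norm_le_zero_iff.1 this
  have hzero : ∀ l, sineFun T 0 f l = 0 := by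
    have hd : Dense ((I.image (node T) : Set ℝ)ᶜ) := (Finset.finite_toSet _).countable.dense_compl ℝ
    have := Continuous.ext_on hd (continuous_sineFun hT.le 0 f) continuous_const
      (fun l (hl : l ∉ _) => by
        have h3 := hg3 l (by simpa using hl)
        rw [hg] at h3
        simp only [sineFun, zero_mul, inner_zero_left, add_zero, mul_zero] at h3
        have h4 := (mul_eq_zero.1 h3.symm).resolve_left (Finset.prod_ne_zero_iff.2 fun x hx =>
          sub_ne_zero.2 fun h => hl (by rw [h]; exact_mod_cast hx))
        simpa [sineFun] using h4)
    exact congrFun this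
  exact eq_zero_of_inner_node hT f fun n => by simpa [sineFun] using hzero (node T n)

lemma abs_sin_mul_le (hT : 0 < T) (l : ℝ) (n : ℤ) :
    |Real.sin (l * T)| ≤ T * |l - node T n| := by
  have h : Real.sin (l * T) = Real.sin (l * T) - Real.sin (node T n * T) := by
    rw [sin_node hT, sub_zero]
  rw [h]
  refine (Real.abs_sin_sub_sin_le _ _).trans (le_of_eq ?_)
  rw [← sub_mul, abs_mul, abs_of_pos hT, mul_comm]

/-- There is a function `sin λT + ⟨g, e(·, λ)⟩` vanishing at all `λₙ`, and replacing its zeros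
`λₙ`, `|n| ≤ N`, by `nπ/T` turns it into `sin λT` in the limit. -/
lemma exists_generating (hT : 0 < T) (hinj : Function.Injective lam)
    (hsum : Summable fun n => (lam n - node T n) ^ 2) :
    ∃ g : Space T, (∀ n, sineFun T 1 g (lam n) = 0) ∧
      ∀ l, (∀ n, l ≠ lam n) → Tendsto (fun N : ℕ =>
        (∏ n ∈ Finset.Icc (-(N : ℤ)) N, (l - node T n)) /
          (∏ n ∈ Finset.Icc (-(N : ℤ)) N, (l - lam n)) * sineFun T 1 g l)
        atTop (𝓝 (Real.sin (l * T))) := by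
  obtain ⟨N₀, hN₀⟩ := exists_moment_mixedNode hT hsum
  -- the solution `w N` of the moment problem for the mixed sequence, and the exchanged function
  have key : ∀ N : ℕ, N₀ ≤ N → ∃ w g : Space T,
      ‖w‖ ≤ 2 * (Real.sqrt T)⁻¹ * Real.sqrt (∑' n, if n ∈ Finset.Icc (-(N : ℤ)) N then 0 else
        T ^ 2 * (lam n - node T n) ^ 2) ∧
      (∀ n, sineFun T 1 g (lam n) = 0) ∧ ∀ l, (∀ n, l ≠ lam n) →
        (∏ n ∈ Finset.Icc (-(N : ℤ)) N, (l - node T n)) * sineFun T 1 g l =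
          (∏ n ∈ Finset.Icc (-(N : ℤ)) N, (l - lam n)) * sineFun T 1 w l := by
    intro N hN
    obtain ⟨h1, h2⟩ := hN₀ N hN
    set I := Finset.Icc (-(N : ℤ)) N with hI
    set y : ℤ → ℝ := fun n => -Real.sin (mixedNode T lam N n * T) with hy
    have hyle : ∀ n, y n ^ 2 ≤ if n ∈ I then 0 else T ^ 2 * (lam n - node T n) ^ 2 := by
      intro n
      rw [hy]; simp only [mixedNode, ← hI]
      split_ifs with hn
      · rw [sin_node hT]; simp
      · rw [neg_sq, ← sq_abs, ← sq_abs (lam n - _), ← mul_pow]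
        exact pow_le_pow_left₀ (abs_nonneg _) (abs_sin_mul_le hT _ _) 2
    have hmaj : Summable fun n => if n ∈ I then 0 else T ^ 2 * (lam n - node T n) ^ 2 := by
      refine (hsum.mul_left (T ^ 2)).of_nonneg_of_le (fun n => ?_) fun n => ?_
      · split_ifs <;> positivity
      · split_ifs
        · positivity
        · exact le_rfl
    have hysum : Summable fun n => y n ^ 2 := hmaj.of_nonneg_of_le (fun _ => sq_nonneg _) hyle
    set Y : lp (fun _ : ℤ => ℝ) 2 := ⟨y, memlp_two_iff.2 hysum⟩ with hY
    obtain ⟨w, hw⟩ := h1 Y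
    have hwn := h2 w Y hw
    have hw0 : ∀ n, sineFun T 1 w (mixedNode T lam N n) = 0 := by
      intro n
      rw [sineFun, hw]
      simp [hY, hy]
    obtain ⟨g, hg1, hg2, hg3⟩ := exists_exchange hT (κ := 1) (I.image lam) (lam '' {n | n ∉ I})
      (by
        intro x hx ⟨n, hn, hnx⟩
        obtain ⟨m, hm, rfl⟩ := Finset.mem_image.1 hx
        exact hn (hinj hnx ▸ hm))
      w (I.image (node T))
      (by rw [Finset.card_image_of_injective _ hinj,
        Finset.card_image_of_injective _ (node_injective hT)])
      (by
        intro x hx ⟨n, hn, hnx⟩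
        obtain ⟨m, hm, rfl⟩ := Finset.mem_image.1 hx
        exact disjoint_mixedNode h1 hm hn hnx.symm)
      (by
        intro x hx
        obtain ⟨m, hm, rfl⟩ := Finset.mem_image.1 hx
        simpa [mixedNode, ← hI, hm, -Finset.mem_Icc] using hw0 m)
      (by
        rintro x ⟨n, hn : n ∉ I, rfl⟩
        simpa [mixedNode, ← hI, hn, -Finset.mem_Icc] using hw0 n)
    refine ⟨w, g, hwn.trans ?_, fun n => ?_, fun l hl => ?_⟩
    · refine mul_le_mul_of_nonneg_left (Real.le_sqrt_of_sq_le ?_) (by positivity)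
      rw [lp_norm_sq]
      exact hysum.tsum_le_tsum hyle hmaj
    · by_cases hn : n ∈ I
      · exact hg1 _ (Finset.mem_image_of_mem _ hn)
      · exact hg2 _ ⟨n, hn, rfl⟩
    · have := hg3 l (fun h => by
        obtain ⟨m, _, hm⟩ := Finset.mem_image.1 h
        exact hl m hm.symm)
      rwa [Finset.prod_image fun _ _ _ _ h => hinj h,
        Finset.prod_image fun _ _ _ _ h => node_injective hT h] at this
  choose! w G hwn hG0 hGw using key
  refine ⟨G N₀, hG0 N₀ le_rfl, fun l hl => ?_⟩
  -- by completeness the function with the zeros `λₙ` does not depend on `N`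
  have hGeq : ∀ N, N₀ ≤ N → G N = G N₀ := by
    intro N hN
    rw [← sub_eq_zero]
    refine eq_zero_of_inner_eq_zero hT hinj hsum _ fun n => ?_
    have h1 := hG0 N hN n
    have h2 := hG0 N₀ le_rfl n
    rw [sineFun] at h1 h2
    rw [inner_sub_left]; linarith
  have htail : Tendsto (fun N : ℕ => ∑' n, if n ∈ Finset.Icc (-(N : ℤ)) N then 0 else
        T ^ 2 * (lam n - node T n) ^ 2) atTop (𝓝 0) := by
    have := tendsto_tsum_of_dominated_convergence (𝓕 := atTop)
      (f := fun (N : ℕ) (n : ℤ) => if n ∈ Finset.Icc (-(N : ℤ)) N then 0 else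
        T ^ 2 * (lam n - node T n) ^ 2) (g := fun _ => (0 : ℝ)) (hsum.mul_left (T ^ 2))
      (fun n => by
        refine tendsto_const_nhds.congr' ?_
        filter_upwards [eventually_ge_atTop n.natAbs] with N hN
        rw [if_pos]; rw [Finset.mem_Icc]; omega)
      (Eventually.of_forall fun N n => by
        rw [Real.norm_eq_abs, abs_of_nonneg (by split_ifs <;> positivity)]
        split_ifs
        · positivity
        · exact le_rfl)
    simpa using this
  have hw0 : Tendsto w atTop (𝓝 0) := by
    rw [tendsto_zero_iff_norm_tendsto_zero]
    refine tendsto_of_tendsto_of_tendsto_of_le_of_le' tendsto_const_nhds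
      (h := fun N : ℕ => 2 * (Real.sqrt T)⁻¹ * Real.sqrt (∑' n, if n ∈ Finset.Icc (-(N : ℤ)) N
        then 0 else T ^ 2 * (lam n - node T n) ^ 2)) ?_
      (Eventually.of_forall fun N => norm_nonneg _) ?_
    · have := (Real.continuous_sqrt.tendsto 0).comp htail
      rw [Real.sqrt_zero] at this
      simpa using this.const_mul (2 * (Real.sqrt T)⁻¹)
    · filter_upwards [eventually_ge_atTop N₀] with N hN using hwn N hN
  have hlim : Tendsto (fun N => sineFun T 1 (w N) l) atTop (𝓝 (Real.sin (l * T))) := by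
    have : Tendsto (fun N => ⟪w N, waveLp T l⟫_ℝ) atTop (𝓝 ⟪(0 : Space T), waveLp T l⟫_ℝ) :=
      hw0.inner tendsto_const_nhds
    rw [inner_zero_left] at this
    simpa [sineFun] using this.const_add (Real.sin (l * T))
  refine hlim.congr' ?_
  filter_upwards [eventually_ge_atTop N₀] with N hN
  have h1 := hGw N hN l hl
  rw [hGeq N hN] at h1
  have h2 : ∏ n ∈ Finset.Icc (-(N : ℤ)) N, (l - lam n) ≠ 0 :=
    Finset.prod_ne_zero_iff.2 fun n _ => sub_ne_zero.2 (hl n)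
  rw [div_mul_eq_mul_div, h1, mul_div_cancel_left₀ _ h2]

/-- The product formula for the generating function: Euler's product for the sine turns the limit
`hΦ` into a limit of partial products. The points `nπ/T` are excluded, since there `hΦ` reads
`0 → 0`. -/
lemma generating_eq_tprod (hT : 0 < T) (hsum : Summable fun n => (lam n - node T n) ^ 2)
    {Φ l : ℝ} (hl : ∀ n, l ≠ lam n) (hl' : ∀ n, l ≠ node T n)
    (hΦ : Tendsto (fun N : ℕ => (∏ n ∈ Finset.Icc (-(N : ℤ)) N, (l - node T n)) /
          (∏ n ∈ Finset.Icc (-(N : ℤ)) N, (l - lam n)) * Φ) atTop (𝓝 (Real.sin (l * T)))) :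
    T * (l - lam 0) * ∏' k : ℕ, ((lam ((k : ℤ) + 1) - l) * (lam (-((k : ℤ) + 1)) - l)) /
      (node T ((k : ℤ) + 1) * node T (-((k : ℤ) + 1))) = Φ := by
  set q : ℕ → ℝ := fun k => ((lam ((k : ℤ) + 1) - l) * (lam (-((k : ℤ) + 1)) - l)) /
      (node T ((k : ℤ) + 1) * node T (-((k : ℤ) + 1))) with hq
  have hπ := Real.pi_pos
  set c : ℕ → ℝ := fun k => node T ((k : ℤ) + 1) with hc
  have hcval : ∀ k, c k = (k + 1) * (Real.pi / T) := by
    intro k; simp only [hc, node]; push_cast; ring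
  have hcpos : ∀ k, 0 < c k := fun k => by rw [hcval]; positivity
  have hcneg : ∀ k : ℕ, node T (-((k : ℤ) + 1)) = -c k := by
    intro k; simp only [hc, node]; push_cast; ring
  -- absolute convergence of the product
  have hc2 : Summable fun k => (c k ^ 2)⁻¹ := by
    have := ((Real.summable_one_div_nat_pow (p := 2)).2 one_lt_two)
    have := ((summable_nat_add_iff 1).2 this).mul_left ((Real.pi / T) ^ 2)⁻¹
    refine this.congr fun k => ?_
    rw [hcval]; push_cast; field_simp
  have hinj1 : Function.Injective fun k : ℕ => (k : ℤ) + 1 := fun a b h => by simpa using h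
  have hinj2 : Function.Injective fun k : ℕ => -((k : ℤ) + 1) := fun a b h => by simpa using h
  have hs1 : Summable fun k : ℕ => (lam ((k : ℤ) + 1) - c k) ^ 2 := hsum.comp_injective hinj1
  have hs2 : Summable fun k : ℕ => (lam (-((k : ℤ) + 1)) + c k) ^ 2 := by
    refine (hsum.comp_injective hinj2).congr fun k => ?_
    simp only [Function.comp_apply, hcneg, sub_neg_eq_add]
  have hmul : Multipliable q := by
    have hsq : Summable fun k => q k - 1 := by
      refine Summable.of_norm_bounded (g := fun k => (1 + (T / Real.pi) ^ 2) *
        ((lam ((k : ℤ) + 1) - c k) ^ 2 + (lam (-((k : ℤ) + 1)) + c k) ^ 2) +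
          (1 + 2 * l ^ 2) * (c k ^ 2)⁻¹)
        (((hs1.add hs2).mul_left _).add (hc2.mul_left _)) fun k => ?_
      set a := lam ((k : ℤ) + 1) - c k with ha
      set b := lam (-((k : ℤ) + 1)) + c k with hb
      have hck := hcpos k
      have hqk : q k - 1 = -((b - a) * (c k)⁻¹) - (a - l) * (b - l) * (c k ^ 2)⁻¹ := by
        simp only [hq, hcneg, ha, hb]
        rw [show node T ((k : ℤ) + 1) = c k from rfl]
        field_simp
        ring
      have hci : (c k ^ 2)⁻¹ ≤ (T / Real.pi) ^ 2 := by
        rw [← inv_pow]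
        refine pow_le_pow_left₀ (inv_pos.2 hck).le ?_ 2
        rw [← inv_div]
        refine inv_anti₀ (by positivity) ?_
        rw [hcval]
        exact le_mul_of_one_le_left (by positivity) (by linarith [Nat.cast_nonneg (α := ℝ) k])
      have h0 : 0 ≤ (c k ^ 2)⁻¹ := by positivity
      have h1 : |(b - a) * (c k)⁻¹| ≤ a ^ 2 + b ^ 2 + (c k ^ 2)⁻¹ := by
        rw [← inv_pow, abs_le]
        constructor <;> nlinarith [sq_nonneg (b - a - (c k)⁻¹), sq_nonneg (b - a + (c k)⁻¹),
          sq_nonneg (a + b), sq_nonneg (c k)⁻¹]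
      have h2 : |(a - l) * (b - l)| ≤ a ^ 2 + b ^ 2 + 2 * l ^ 2 := by
        rw [abs_le]
        constructor <;> nlinarith [sq_nonneg (a - l - (b - l)), sq_nonneg (a - l + (b - l)),
          sq_nonneg (a + l), sq_nonneg (b + l)]
      have h3 : |(a - l) * (b - l) * (c k ^ 2)⁻¹| ≤
          (T / Real.pi) ^ 2 * (a ^ 2 + b ^ 2) + 2 * l ^ 2 * (c k ^ 2)⁻¹ := by
        rw [abs_mul, abs_of_nonneg h0]
        have h4 := mul_le_mul_of_nonneg_right h2 h0
        have h5 := mul_le_mul_of_nonneg_right hci (add_nonneg (sq_nonneg a) (sq_nonneg b))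
        linarith
      rw [hqk, Real.norm_eq_abs]
      refine (abs_sub _ _).trans ?_
      rw [abs_neg]
      linarith
    have := Real.multipliable_one_add_of_summable hsq
    simpa using this
  have hP := hmul.hasProd.tendsto_prod_nat
  set P := ∏' k, q k with hPdef
  have hl0 : l ≠ 0 := by simpa [node] using hl' 0
  have hsin : Real.sin (l * T) ≠ 0 := fun h => by
    obtain ⟨n, hn⟩ := exists_node_of_sin_eq_zero hT h
    exact hl' n hn
  have hE : Tendsto (fun K : ℕ => T * l * ∏ k ∈ Finset.range K, (1 - l ^ 2 / c k ^ 2)) atTop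
      (𝓝 (Real.sin (l * T))) := by
    have := Real.tendsto_euler_sin_prod (l * T / Real.pi)
    rw [mul_div_cancel₀ _ hπ.ne'] at this
    refine this.congr fun K => ?_
    congr 1
    · ring
    · refine Finset.prod_congr rfl fun k _ => ?_
      rw [hcval]; field_simp
  have hqne : ∀ k, q k ≠ 0 := fun k => by
    rw [hq]; simp only [hcneg]
    exact div_ne_zero (mul_ne_zero (sub_ne_zero.2 (hl _).symm) (sub_ne_zero.2 (hl _).symm))
      (mul_ne_zero (hcpos k).ne' (neg_ne_zero.2 (hcpos k).ne'))
  have hratio : ∀ K : ℕ, (∏ n ∈ Finset.Icc (-(K : ℤ)) K, (l - node T n)) /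
      (∏ n ∈ Finset.Icc (-(K : ℤ)) K, (l - lam n)) * Φ * ∏ k ∈ Finset.range K, q k =
      (T * l * ∏ k ∈ Finset.range K, (1 - l ^ 2 / c k ^ 2)) * (Φ / (T * (l - lam 0))) := by
    intro K
    rw [prod_Icc_neg, prod_Icc_neg]
    have h0 : l - lam 0 ≠ 0 := sub_ne_zero.2 (hl 0)
    have h1 : ∏ k ∈ Finset.range K, (l - lam ((k : ℤ) + 1)) * (l - lam (-((k : ℤ) + 1))) ≠ 0 :=
      Finset.prod_ne_zero_iff.2 fun k _ =>
        mul_ne_zero (sub_ne_zero.2 (hl _)) (sub_ne_zero.2 (hl _))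
    have h2 : (∏ k ∈ Finset.range K, (l - node T ((k : ℤ) + 1)) * (l - node T (-((k : ℤ) + 1)))) *
        ∏ k ∈ Finset.range K, q k =
        (∏ k ∈ Finset.range K, (1 - l ^ 2 / c k ^ 2)) *
        ∏ k ∈ Finset.range K, (l - lam ((k : ℤ) + 1)) * (l - lam (-((k : ℤ) + 1))) := by
      rw [← Finset.prod_mul_distrib, ← Finset.prod_mul_distrib]
      refine Finset.prod_congr rfl fun k _ => ?_
      have := (hcpos k).ne'
      simp only [hq, hcneg]
      rw [show node T ((k : ℤ) + 1) = c k from rfl]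
      field_simp
      ring
    have h3 : l - node T 0 = l := by simp [node]
    rw [h3]
    field_simp
    linear_combination Φ * h2
  have hlim1 := (hΦ.mul hP).congr hratio
  have hlim2 := hE.mul_const (Φ / (T * (l - lam 0)))
  have heq := mul_left_cancel₀ hsin (tendsto_nhds_unique hlim1 hlim2)
  rw [heq, mul_div_cancel₀]
  exact mul_ne_zero hT.ne' (sub_ne_zero.2 (hl 0))

end

/-! ### The frame operator of the spectral data -/

/-- Spectral data on an interval of length `T`. -/
structure SpectralData (T : ℝ) (lam al : Label → ℝ) : Prop where
  length_pos : 0 < T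
  injective : Function.Injective lam
  pos : ∀ j, 0 < al j
  lam_asymp : Summable fun n : ℤ => (lam (some n) - node T n) ^ 2
  al_asymp : Summable fun n : ℤ => (al (some n) - T) ^ 2

namespace SpectralData
variable {T : ℝ} {lam al : Label → ℝ}

lemma injective_some (hd : SpectralData T lam al) :
    Function.Injective fun n : ℤ => lam (some n) :=
  hd.injective.comp (Option.some_injective _)

lemma some_ne_none (hd : SpectralData T lam al) (n : ℤ) : lam (some n) ≠ lam none :=
  fun h => Option.some_ne_none n (hd.injective h)

lemma tendsto_al (hd : SpectralData T lam al) :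
    Tendsto (fun n : ℤ => al (some n)) cofinite (𝓝 T) := by
  have h := (Real.continuous_sqrt.tendsto 0).comp hd.al_asymp.tendsto_cofinite_zero
  simp only [Function.comp_def, Real.sqrt_sq_eq_abs, Real.sqrt_zero] at h
  simpa using ((tendsto_zero_iff_abs_tendsto_zero _).2 h).add_const T

lemma exists_al_le (hd : SpectralData T lam al) : ∃ M, 0 < M ∧ ∀ j, al j ≤ M := by
  obtain ⟨M, hM⟩ := hd.tendsto_al.bddAbove_range_of_cofinite
  refine ⟨max M (al none), lt_max_of_lt_right (hd.pos none), fun j => ?_⟩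
  cases j with
  | none => exact le_max_right _ _
  | some n => exact le_max_of_le_left (hM ⟨n, rfl⟩)

lemma exists_inv_al_le (hd : SpectralData T lam al) : ∃ M, 0 < M ∧ ∀ j, (al j)⁻¹ ≤ M := by
  obtain ⟨M, hM⟩ := (hd.tendsto_al.inv₀ hd.length_pos.ne').bddAbove_range_of_cofinite
  refine ⟨max M (al none)⁻¹, lt_max_of_lt_right (inv_pos.2 (hd.pos none)), fun j => ?_⟩
  cases j with
  | none => exact le_max_right _ _
  | some n => exact le_max_of_le_left (hM ⟨n, rfl⟩)

lemma exists_bessel_int (hd : SpectralData T lam al) : ∃ C, 0 ≤ C ∧ ∀ f : Space T,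
    ∀ s : Finset ℤ, ∑ n ∈ s, ⟪waveLp T (lam (some n)), f⟫_ℝ ^ 2 ≤ C * ‖f‖ ^ 2 := by
  have hT := hd.length_pos
  set B := ∑' n : ℤ, (lam (some n) - node T n) ^ 2 with hB
  have hB0 : 0 ≤ B := tsum_nonneg fun _ => sq_nonneg _
  refine ⟨2 * T + 2 * (T ^ 3 * B), by positivity, fun f s => ?_⟩
  have h1 : ∑ n ∈ s, ⟪waveLp T (node T n), f⟫_ℝ ^ 2 ≤ T * ‖f‖ ^ 2 := by
    have h := hasSum_inner_node hT f f
    have h2 := sum_le_hasSum s (fun n _ => mul_nonneg (inv_pos.2 hT).le (mul_self_nonneg _)) h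
    rw [← Finset.mul_sum, real_inner_self_eq_norm_sq, inv_mul_le_iff₀ hT] at h2
    simpa only [pow_two] using h2
  have h2 : ∑ n ∈ s, ⟪waveLp T (lam (some n)) - waveLp T (node T n), f⟫_ℝ ^ 2 ≤
      T ^ 3 * B * ‖f‖ ^ 2 := by
    refine (sum_inner_sq_le _ f s).trans (mul_le_mul_of_nonneg_right ?_ (sq_nonneg _))
    have h3 : ∀ n ∈ s, ‖waveLp T (lam (some n)) - waveLp T (node T n)‖ ^ 2 ≤
        T ^ 3 * (lam (some n) - node T n) ^ 2 := by
      intro n _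
      refine (pow_le_pow_left₀ (norm_nonneg _) (norm_waveLp_sub_le hT.le _ _) 2).trans
        (le_of_eq ?_)
      rw [mul_pow, mul_pow, Real.sq_sqrt hT.le, sq_abs]; ring
    refine (Finset.sum_le_sum h3).trans ?_
    rw [← Finset.mul_sum]
    exact mul_le_mul_of_nonneg_left (hd.lam_asymp.sum_le_tsum s fun _ _ => sq_nonneg _)
      (by positivity)
  have h3 : ∀ n ∈ s, ⟪waveLp T (lam (some n)), f⟫_ℝ ^ 2 ≤ 2 * ⟪waveLp T (node T n), f⟫_ℝ ^ 2 +
      2 * ⟪waveLp T (lam (some n)) - waveLp T (node T n), f⟫_ℝ ^ 2 := by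
    intro n _
    rw [inner_sub_left]
    nlinarith [sq_nonneg (⟪waveLp T (lam (some n)), f⟫_ℝ - 2 * ⟪waveLp T (node T n), f⟫_ℝ)]
  refine (Finset.sum_le_sum h3).trans ?_
  rw [Finset.sum_add_distrib, ← Finset.mul_sum, ← Finset.mul_sum]
  linarith

lemma exists_bessel (hd : SpectralData T lam al) : ∃ C, ∀ f : Space T, ∀ s : Finset Label,
    ∑ j ∈ s, ⟪(Real.sqrt (al j))⁻¹ • waveLp T (lam j), f⟫_ℝ ^ 2 ≤ C * ‖f‖ ^ 2 := by
  obtain ⟨C, hC0, hC⟩ := hd.exists_bessel_int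
  obtain ⟨M, hM0, hM⟩ := hd.exists_inv_al_le
  refine ⟨M * (‖waveLp T (lam none)‖ ^ 2 + C), fun f s => ?_⟩
  have h1 : ∀ j ∈ s, ⟪(Real.sqrt (al j))⁻¹ • waveLp T (lam j), f⟫_ℝ ^ 2 ≤
      M * ⟪waveLp T (lam j), f⟫_ℝ ^ 2 := by
    intro j _
    rw [real_inner_smul_left, mul_pow, inv_pow, Real.sq_sqrt (hd.pos j).le]
    exact mul_le_mul_of_nonneg_right (hM j) (sq_nonneg _)
  refine (Finset.sum_le_sum h1).trans ?_
  rw [← Finset.mul_sum, mul_assoc]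
  refine mul_le_mul_of_nonneg_left ?_ hM0.le
  have h2 : s ⊆ Finset.insertNone (Finset.eraseNone s) := by
    intro j hj
    cases j <;> simp [hj]
  refine (Finset.sum_le_sum_of_subset_of_nonneg h2 fun _ _ _ => sq_nonneg _).trans ?_
  rw [Finset.sum_insertNone, add_mul]
  refine add_le_add ?_ (hC f _)
  simpa using sum_inner_sq_le (fun _ : Unit => waveLp T (lam none)) f Finset.univ

/-- The map `f ↦ (α_j^{-1/2} ⟨e(·, λ_j), f⟩)_j`. -/
def frameMap (hd : SpectralData T lam al) : Space T →L[ℝ] lp (fun _ : Label => ℝ) 2 :=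
  analysis (fun j => (Real.sqrt (al j))⁻¹ • waveLp T (lam j)) hd.exists_bessel.choose
    hd.exists_bessel.choose_spec

/-- The operator `f ↦ ∑_j α_j⁻¹ ⟨f, e(·, λ_j)⟩ e(·, λ_j)`. -/
def frameOp (hd : SpectralData T lam al) : Space T →L[ℝ] Space T :=
  hd.frameMap.adjoint ∘L hd.frameMap

lemma inner_frameOp (hd : SpectralData T lam al) (f w : Space T) :
    ⟪hd.frameOp f, w⟫_ℝ = ⟪hd.frameMap f, hd.frameMap w⟫_ℝ := by
  rw [frameOp, ContinuousLinearMap.comp_apply, ContinuousLinearMap.adjoint_inner_left]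

lemma inner_frameOp_comm (hd : SpectralData T lam al) (f w : Space T) :
    ⟪hd.frameOp f, w⟫_ℝ = ⟪f, hd.frameOp w⟫_ℝ := by
  rw [real_inner_comm (hd.frameOp w) f, inner_frameOp, inner_frameOp, real_inner_comm]

lemma hasSum_inner_frameOp (hd : SpectralData T lam al) (f w : Space T) :
    HasSum (fun j => (al j)⁻¹ * (⟪waveLp T (lam j), f⟫_ℝ * ⟪waveLp T (lam j), w⟫_ℝ))
      ⟪hd.frameOp f, w⟫_ℝ := by
  rw [inner_frameOp]
  refine (lp.hasSum_inner _ _).congr_fun fun j => ?_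
  simp only [frameMap, analysis_apply, real_inner_smul_left]
  rw [show (al j)⁻¹ = (Real.sqrt (al j))⁻¹ * (Real.sqrt (al j))⁻¹ by
    rw [← mul_inv, Real.mul_self_sqrt (hd.pos j).le]]
  simp only [RCLike.inner_apply, conj_trivial]
  ring

/-! ### The dual system -/

lemma eq_zero_of_inner (hd : SpectralData T lam al) (f : Space T)
    (h : ∀ n : ℤ, ⟪f, waveLp T (lam (some n))⟫_ℝ = 0) : f = 0 :=
  eq_zero_of_inner_eq_zero hd.length_pos hd.injective_some hd.lam_asymp f h

lemma exists_sineFun_ne_zero (hT : 0 < T) (g : Space T) : ∃ l, sineFun T 1 g l ≠ 0 := by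
  by_contra! h
  have hg : g = 0 := eq_zero_of_inner_node hT g fun n => by
    simpa [sineFun, sin_node hT] using h (node T n)
  have := h (Real.pi / 2 / T)
  rw [hg, sineFun, div_mul_cancel₀ _ hT.ne', Real.sin_pi_div_two, inner_zero_left] at this
  norm_num at this

/-- The function `sin λT + ⟨g, e(·, λ)⟩` with the zeros `λₙ`, `n ∈ ℤ`. -/
def generator (hd : SpectralData T lam al) : Space T :=
  (exists_generating hd.length_pos hd.injective_some hd.lam_asymp).choose

/-- The generating function of the sequence `λₙ`, `n ∈ ℤ`. -/
def genFun (hd : SpectralData T lam al) (l : ℝ) : ℝ := sineFun T 1 hd.generator l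

lemma genFun_eq (hd : SpectralData T lam al) (l : ℝ) :
    hd.genFun l = Real.sin (l * T) + ⟪waveLp T l, hd.generator⟫_ℝ := by
  rw [genFun, sineFun, one_mul, real_inner_comm]

lemma genFun_some (hd : SpectralData T lam al) (n : ℤ) : hd.genFun (lam (some n)) = 0 :=
  (exists_generating hd.length_pos hd.injective_some hd.lam_asymp).choose_spec.1 n

lemma tendsto_genFun (hd : SpectralData T lam al) {l : ℝ} (hl : ∀ n : ℤ, l ≠ lam (some n)) :
    Tendsto (fun N : ℕ => (∏ n ∈ Finset.Icc (-(N : ℤ)) N, (l - node T n)) /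
      (∏ n ∈ Finset.Icc (-(N : ℤ)) N, (l - lam (some n))) * hd.genFun l)
        atTop (𝓝 (Real.sin (l * T))) :=
  (exists_generating hd.length_pos hd.injective_some hd.lam_asymp).choose_spec.2 l hl

lemma exists_dual (hd : SpectralData T lam al) (n : ℤ) : ∃ h : Space T, ∀ l,
    (l - lam (some n)) * ⟪waveLp T l, h⟫_ℝ = hd.genFun l := by
  obtain ⟨h, hh⟩ := exists_division hd.length_pos 1 hd.generator _ (hd.genFun_some n)
  exact ⟨h, fun l => by rw [real_inner_comm]; exact hh l⟩

/-- The vector whose transform is the generating function divided by `λ - λₙ`. -/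
def dual (hd : SpectralData T lam al) (n : ℤ) : Space T := (hd.exists_dual n).choose

lemma sub_mul_inner_dual (hd : SpectralData T lam al) (n : ℤ) (l : ℝ) :
    (l - lam (some n)) * ⟪waveLp T l, hd.dual n⟫_ℝ = hd.genFun l :=
  (hd.exists_dual n).choose_spec l

lemma inner_dual_of_ne (hd : SpectralData T lam al) {m n : ℤ} (h : m ≠ n) :
    ⟪waveLp T (lam (some m)), hd.dual n⟫_ℝ = 0 := by
  have := hd.sub_mul_inner_dual n (lam (some m))
  rw [hd.genFun_some, mul_eq_zero] at this
  exact this.resolve_left (sub_ne_zero.2 fun h' => h (hd.injective_some h'))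

lemma inner_dual_ne_zero (hd : SpectralData T lam al) (n : ℤ) :
    ⟪waveLp T (lam (some n)), hd.dual n⟫_ℝ ≠ 0 := by
  intro h0
  have hz : hd.dual n = 0 := hd.eq_zero_of_inner _ fun m => by
    rw [real_inner_comm]
    by_cases hm : m = n
    · rw [hm, h0]
    · exact hd.inner_dual_of_ne hm
  obtain ⟨l, hl⟩ := exists_sineFun_ne_zero hd.length_pos hd.generator
  refine hl ?_
  have := hd.sub_mul_inner_dual n l
  rw [hz, inner_zero_right, mul_zero] at this
  exact this.symm

/-- A further zero of the generating function could be divided out, and completeness would make the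
quotient vanish. -/
lemma genFun_none_ne_zero (hd : SpectralData T lam al) : hd.genFun (lam none) ≠ 0 := by
  intro h0
  obtain ⟨h, hh⟩ := exists_division hd.length_pos 1 hd.generator _ h0
  have hz : h = 0 := hd.eq_zero_of_inner _ fun m => by
    have := hh (lam (some m))
    rw [show 1 * Real.sin (lam (some m) * T) + ⟪hd.generator, waveLp T (lam (some m))⟫_ℝ = 0 from
      hd.genFun_some m, mul_eq_zero] at this
    exact this.resolve_left (sub_ne_zero.2 (hd.some_ne_none m))
  obtain ⟨l, hl⟩ := exists_sineFun_ne_zero hd.length_pos hd.generator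
  refine hl ?_
  have := hh l
  rw [hz, inner_zero_left, mul_zero] at this
  exact this.symm

/-- The derivative at `λ_j` of the function `(λ - λ_{-0}) Φ(λ)`, `Φ` the generating function
of the `λₙ`. -/
def derivCoeff (hd : SpectralData T lam al) : Label → ℝ
  | none => hd.genFun (lam none)
  | some n => (lam (some n) - lam none) * ⟪waveLp T (lam (some n)), hd.dual n⟫_ℝ

lemma derivCoeff_ne_zero (hd : SpectralData T lam al) (j : Label) : hd.derivCoeff j ≠ 0 := by
  cases j with
  | none => exact hd.genFun_none_ne_zero
  | some n => exact mul_ne_zero (sub_ne_zero.2 (hd.some_ne_none n)) (hd.inner_dual_ne_zero n)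

lemma continuous_inner_waveLp (hT : 0 ≤ T) (f : Space T) :
    Continuous fun l => ⟪waveLp T l, f⟫_ℝ :=
  (continuous_waveLp hT).inner continuous_const

lemma hasDerivAt_sub_mul {k : ℝ → ℝ} {x : ℝ} (hk : ContinuousAt k x) :
    HasDerivAt (fun l => (l - x) * k l) (k x) x := by
  rw [hasDerivAt_iff_tendsto_slope]
  refine (hk.tendsto.mono_left nhdsWithin_le_nhds).congr' ?_
  filter_upwards [self_mem_nhdsWithin] with l hl
  have : l - x ≠ 0 := sub_ne_zero.2 hl
  rw [slope_def_field]; field_simp; simp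

lemma hasDerivAt_genFun (hd : SpectralData T lam al) (j : Label) :
    HasDerivAt (fun l => (l - lam none) * hd.genFun l) (hd.derivCoeff j) (lam j) := by
  cases j with
  | none =>
    exact hasDerivAt_sub_mul (continuous_sineFun hd.length_pos.le 1 hd.generator).continuousAt
  | some n =>
    have h := hasDerivAt_sub_mul (x := lam (some n))
      (k := fun l => (l - lam none) * ⟪waveLp T l, hd.dual n⟫_ℝ) (by
        have := continuous_inner_waveLp hd.length_pos.le (hd.dual n)
        exact Continuous.continuousAt (by fun_prop))
    refine h.congr_of_eventuallyEq (Eventually.of_forall fun l => ?_)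
    simp only [← hd.sub_mul_inner_dual n l]; ring

/-- A sequence annihilated, up to a constant `κ`, by the dual vectors is determined by one of its
terms. -/
lemma mul_derivCoeff_of_dual (hd : SpectralData T lam al) {y : Label → ℝ} {κ : ℝ}
    (h : ∀ n : ℤ, y none * ⟪waveLp T (lam none), hd.dual n⟫_ℝ +
      y (some n) * ⟪waveLp T (lam (some n)), hd.dual n⟫_ℝ = -κ) (j : Label) :
    y j * hd.derivCoeff j = y none * hd.derivCoeff none - κ * (lam j - lam none) := by
  cases j with
  | none => simp
  | some n =>
    have h1 := h n
    have h2 := hd.sub_mul_inner_dual n (lam none)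
    simp only [derivCoeff]
    linear_combination (lam (some n) - lam none) * h1 + y none * h2

/-- Against a dual vector only two terms of a sum over the labels survive. -/
lemma hasSum_inner_dual (hd : SpectralData T lam al) (y : Label → ℝ) (n : ℤ) :
    HasSum (fun j => y j * ⟪waveLp T (lam j), hd.dual n⟫_ℝ)
      (y none * ⟪waveLp T (lam none), hd.dual n⟫_ℝ +
        y (some n) * ⟪waveLp T (lam (some n)), hd.dual n⟫_ℝ) := by
  have h : HasSum (fun j => y j * ⟪waveLp T (lam j), hd.dual n⟫_ℝ)
      (∑ j ∈ {none, some n}, y j * ⟪waveLp T (lam j), hd.dual n⟫_ℝ) :=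
    hasSum_sum_of_ne_finset_zero fun j hj => by
      cases j with
      | none => simp at hj
      | some m =>
        rw [hd.inner_dual_of_ne (fun h => hj (by simp [h])), mul_zero]
  rwa [Finset.sum_pair (by simp)] at h

/-- The `e(·, λₙ)`, `n ∈ ℤ`, admit a lower frame bound: the moment problem is solvable for all
right-hand sides, so the bounded inverse theorem applies. -/
lemma exists_lower_bound_int (hd : SpectralData T lam al) : ∃ c, 0 < c ∧ ∀ f : Space T,
    c * ‖f‖ ^ 2 ≤ ∑' n : ℤ, ⟪waveLp T (lam (some n)), f⟫_ℝ ^ 2 := by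
  obtain ⟨C, -, hC⟩ := hd.exists_bessel_int
  set V := analysis (fun n : ℤ => waveLp T (lam (some n))) C hC with hV
  have hker : LinearMap.ker (V : Space T →ₗ[ℝ] lp (fun _ : ℤ => ℝ) 2) = ⊥ := by
    rw [LinearMap.ker_eq_bot']
    intro f hf
    refine hd.eq_zero_of_inner f fun n => ?_
    have : V f n = 0 := by
      rw [show V f = 0 from hf]; rfl
    rwa [hV, analysis_apply, real_inner_comm] at this
  have hrange : LinearMap.range (V : Space T →ₗ[ℝ] lp (fun _ : ℤ => ℝ) 2) = ⊤ := by
    rw [LinearMap.range_eq_top]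
    intro y
    obtain ⟨N, hN⟩ := exists_moment_mixedNode hd.length_pos hd.lam_asymp
    obtain ⟨f₀, hf₀⟩ := (hN N le_rfl).1 y
    refine ⟨f₀ + ∑ m ∈ Finset.Icc (-(N : ℤ)) N, ((y m - ⟪waveLp T (lam (some m)), f₀⟫_ℝ) /
      ⟪waveLp T (lam (some m)), hd.dual m⟫_ℝ) • hd.dual m, ?_⟩
    ext n
    change ⟪waveLp T (lam (some n)), _⟫_ℝ = y n
    rw [inner_add_right, inner_sum]
    simp only [real_inner_smul_right]
    by_cases hn : n ∈ Finset.Icc (-(N : ℤ)) N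
    · rw [Finset.sum_eq_single_of_mem n hn fun m _ hm => by
        rw [hd.inner_dual_of_ne hm.symm, mul_zero], div_mul_cancel₀ _ (hd.inner_dual_ne_zero n)]
      ring
    · rw [Finset.sum_eq_zero fun m hm => by
        rw [hd.inner_dual_of_ne (fun h : n = m => hn (h ▸ hm)), mul_zero], add_zero,
        real_inner_comm]
      have := hf₀ n
      rwa [mixedNode, if_neg hn] at this
  have hanti := (ContinuousLinearEquiv.ofBijective V hker hrange).antilipschitz
  set e := ContinuousLinearEquiv.ofBijective V hker hrange with he
  set K := ‖(e.symm : lp (fun _ : ℤ => ℝ) 2 →L[ℝ] Space T)‖ with hK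
  have hbound : ∀ f, ‖f‖ ≤ K * ‖V f‖ := fun f => by
    have := (e.symm : lp (fun _ : ℤ => ℝ) 2 →L[ℝ] Space T).le_opNorm (e f)
    simpa [he] using this
  refine ⟨((K + 1) ^ 2)⁻¹, by positivity, fun f => ?_⟩
  have h1 : ‖f‖ ≤ (K + 1) * ‖V f‖ :=
    (hbound f).trans (mul_le_mul_of_nonneg_right (by linarith) (norm_nonneg _))
  have h2 : ‖V f‖ ^ 2 = ∑' n : ℤ, ⟪waveLp T (lam (some n)), f⟫_ℝ ^ 2 := lp_norm_sq _
  rw [← h2, inv_mul_le_iff₀ (by positivity), ← mul_pow]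
  exact pow_le_pow_left₀ (norm_nonneg _) h1 2

/-- The frame operator is bounded below, since already the labels in `ℤ` give a Riesz basis. -/
lemma exists_coercive (hd : SpectralData T lam al) : ∃ c, 0 < c ∧ ∀ f : Space T,
    c * ‖f‖ ^ 2 ≤ ⟪hd.frameOp f, f⟫_ℝ := by
  obtain ⟨c, hc, h⟩ := hd.exists_lower_bound_int
  obtain ⟨M, hM, hal⟩ := hd.exists_al_le
  refine ⟨M⁻¹ * c, by positivity, fun f => ?_⟩
  have hs := hd.hasSum_inner_frameOp f f
  have hs' := hs.summable.comp_injective (Option.some_injective ℤ)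
  have h1 : M⁻¹ * ∑' n : ℤ, ⟪waveLp T (lam (some n)), f⟫_ℝ ^ 2 ≤ ⟪hd.frameOp f, f⟫_ℝ := by
    rw [← hs.tsum_eq, ← tsum_mul_left]
    have h2 : ∀ n : ℤ, M⁻¹ * ⟪waveLp T (lam (some n)), f⟫_ℝ ^ 2 ≤ (al (some n))⁻¹ *
        (⟪waveLp T (lam (some n)), f⟫_ℝ * ⟪waveLp T (lam (some n)), f⟫_ℝ) := fun n => by
      rw [← pow_two]
      exact mul_le_mul_of_nonneg_right (inv_anti₀ (hd.pos _) (hal _)) (sq_nonneg _)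
    refine (Summable.tsum_le_tsum h2 (hs'.of_nonneg_of_le (fun n => by positivity) h2) hs').trans ?_
    exact tsum_comp_le_tsum_of_inj hs.summable
      (fun j => mul_nonneg (inv_pos.2 (hd.pos j)).le (mul_self_nonneg _))
      (Option.some_injective ℤ)
  rw [mul_assoc]
  exact (mul_le_mul_of_nonneg_left (h f) (inv_pos.2 hM).le).trans h1

end SpectralData

/-! ### Inverting the frame operator -/

section
variable {H : Type*} [NormedAddCommGroup H] [InnerProductSpace ℝ H] [CompleteSpace H]

/-- The Lax–Milgram theorem on a closed subspace. -/
lemma exists_solution_of_coercive (S : H →L[ℝ] H) {c : ℝ} (hc : 0 < c)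
    (hS : ∀ f, c * ‖f‖ ^ 2 ≤ ⟪S f, f⟫_ℝ) (K : Submodule ℝ H) (hK : IsClosed (K : Set H)) (v : H) :
    ∃ u ∈ K, ∀ w ∈ K, ⟪S u, w⟫_ℝ = ⟪v, w⟫_ℝ := by
  have : CompleteSpace K := hK.completeSpace_coe
  set B : K →L[ℝ] K →L[ℝ] ℝ :=
    ((innerSL ℝ).comp (S.comp K.subtypeL)).flip.comp K.subtypeL |>.flip with hB
  have hBapp : ∀ u w : K, B u w = ⟪S u, w⟫_ℝ := fun u w => rfl
  have hco : IsCoercive B := ⟨c, hc, fun u => by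
    rw [hBapp]; simpa [pow_two, mul_assoc] using hS u⟩
  obtain ⟨u, hu⟩ := hco.continuousLinearEquivOfBilin.surjective (K.orthogonalProjectionOnto v)
  refine ⟨u, u.2, fun w hw => ?_⟩
  have h1 := hco.continuousLinearEquivOfBilin_apply u ⟨w, hw⟩
  rw [hu, hBapp] at h1
  rw [← h1]
  exact K.inner_orthogonalProjectionOnto_eq_of_mem_right ⟨w, hw⟩ v

end

namespace SpectralData
variable {T : ℝ} {lam al : Label → ℝ}

lemma exists_frameOp_eq (hd : SpectralData T lam al) (v : Space T) :
    ∃ u, hd.frameOp u = v := by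
  obtain ⟨c, hc, h⟩ := hd.exists_coercive
  obtain ⟨u, -, hu⟩ := exists_solution_of_coercive hd.frameOp hc h ⊤ isClosed_univ v
  exact ⟨u, ext_inner_right ℝ fun w => hu w trivial⟩

/-- The preimage of `e(·, λ_j)` under the frame operator. -/
def frameInv (hd : SpectralData T lam al) (j : Label) : Space T :=
  (hd.exists_frameOp_eq (waveLp T (lam j))).choose

lemma frameOp_frameInv (hd : SpectralData T lam al) (j : Label) :
    hd.frameOp (hd.frameInv j) = waveLp T (lam j) :=
  (hd.exists_frameOp_eq (waveLp T (lam j))).choose_spec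

lemma inner_frameInv_comm (hd : SpectralData T lam al) (j k : Label) :
    ⟪waveLp T (lam k), hd.frameInv j⟫_ℝ = ⟪waveLp T (lam j), hd.frameInv k⟫_ℝ := by
  rw [← hd.frameOp_frameInv k, inner_frameOp_comm, frameOp_frameInv, real_inner_comm]

open Classical in
/-- The relations between the vectors `e(·, λ_j)` form a line, so the Gram matrix of the dual frame
differs from the diagonal matrix of the `α_j` by a matrix of rank one. -/
lemma exists_inner_frameInv (hd : SpectralData T lam al) : ∃ η : ℝ, η ≠ 0 ∧ ∀ j k,
    ⟪waveLp T (lam k), hd.frameInv j⟫_ℝ = (if k = j then al j else 0) -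
      η * ((al j / hd.derivCoeff j) * (al k / hd.derivCoeff k)) := by
  set γ : Label → ℝ := fun j => ((if none = j then 1 else 0) -
    (al none)⁻¹ * ⟪waveLp T (lam none), hd.frameInv j⟫_ℝ) * hd.derivCoeff none with hγ
  have hrel : ∀ j k, ⟪waveLp T (lam k), hd.frameInv j⟫_ℝ =
      (if k = j then al j else 0) - γ j * (al k / hd.derivCoeff k) := by
    intro j k
    have h := hd.mul_derivCoeff_of_dual (κ := 0) (y := fun k => (if k = j then 1 else 0) -
      (al k)⁻¹ * ⟪waveLp T (lam k), hd.frameInv j⟫_ℝ) (fun n => by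
        have h1 := hd.hasSum_inner_frameOp (hd.frameInv j) (hd.dual n)
        rw [frameOp_frameInv] at h1
        have h2 : HasSum (fun k => (if k = j then (1 : ℝ) else 0) *
            ⟪waveLp T (lam k), hd.dual n⟫_ℝ) ⟪waveLp T (lam j), hd.dual n⟫_ℝ := by
          have := hasSum_ite_eq j ⟪waveLp T (lam j), hd.dual n⟫_ℝ
          refine this.congr_fun fun k => ?_
          split_ifs with hk
          · rw [hk, one_mul]
          · rw [zero_mul]
        have h3 := (h2.sub h1).unique ((hd.hasSum_inner_dual (fun k => (if k = j then 1 else 0) -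
          (al k)⁻¹ * ⟪waveLp T (lam k), hd.frameInv j⟫_ℝ) n).congr_fun fun k => by ring)
        rw [← h3]; ring) k
    have hal := (hd.pos k).ne'
    have hdk := hd.derivCoeff_ne_zero k
    have h' : ((if k = j then 1 else 0) - (al k)⁻¹ * ⟪waveLp T (lam k), hd.frameInv j⟫_ℝ) *
        hd.derivCoeff k = γ j := by simpa only [zero_mul, sub_zero] using h
    rw [← h']
    split_ifs with hkj
    · rw [← hkj]; field_simp; ring
    · field_simp; ring
  set η := γ none / (al none / hd.derivCoeff none) with hη
  have hq : ∀ j, al j / hd.derivCoeff j ≠ 0 := fun j =>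
    div_ne_zero (hd.pos j).ne' (hd.derivCoeff_ne_zero j)
  have hγη : ∀ j, γ j = η * (al j / hd.derivCoeff j) := by
    intro j
    have h1 := hd.inner_frameInv_comm j none
    rw [hrel, hrel] at h1
    have h2 : γ j * (al none / hd.derivCoeff none) = γ none * (al j / hd.derivCoeff j) := by
      by_cases hj : j = none
      · rw [hj]
      · rw [if_neg hj, if_neg (Ne.symm hj)] at h1; linarith
    rw [hη, div_mul_eq_mul_div, ← h2, mul_div_cancel_right₀ _ (hq none)]
  refine ⟨η, fun h0 => ?_, fun j k => ?_⟩
  · have hz : hd.frameInv none = 0 := hd.eq_zero_of_inner _ fun n => by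
      rw [real_inner_comm, hrel, hγη, h0]; simp
    have h1 := hd.frameOp_frameInv none
    rw [hz, map_zero] at h1
    have h2 := inner_waveLp_self hd.length_pos.le (lam none)
    rw [← h1, inner_zero_left] at h2
    exact hd.length_pos.ne h2
  · rw [hrel, hγη]; ring

/-- The constant of the rank one perturbation in the Gram matrix of the dual frame. -/
def excess (hd : SpectralData T lam al) : ℝ := hd.exists_inner_frameInv.choose

lemma excess_ne_zero (hd : SpectralData T lam al) : hd.excess ≠ 0 :=
  hd.exists_inner_frameInv.choose_spec.1

open Classical in
lemma inner_frameInv (hd : SpectralData T lam al) (j k : Label) :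
    ⟪waveLp T (lam k), hd.frameInv j⟫_ℝ = (if k = j then al j else 0) -
      hd.excess * ((al j / hd.derivCoeff j) * (al k / hd.derivCoeff k)) :=
  hd.exists_inner_frameInv.choose_spec.2 j k

/-- The linear relation `∑_j e(·, λ_j) / Δ'(λ_j) = 0`, read off from the expansion of `S S⁻¹ e` with
`e = e(·, λ_{-0})`. -/
lemma hasSum_inner_div_derivCoeff (hd : SpectralData T lam al) (f : Space T) :
    HasSum (fun j => ⟪waveLp T (lam j), f⟫_ℝ / hd.derivCoeff j) 0 := by
  classical
  have h1 := hd.hasSum_inner_frameOp (hd.frameInv none) f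
  rw [frameOp_frameInv] at h1
  have h2 := ((hasSum_ite_eq (none : Label) ⟪waveLp T (lam none), f⟫_ℝ).sub h1).mul_left
    (hd.excess * (al none / hd.derivCoeff none))⁻¹
  rw [sub_self, mul_zero] at h2
  refine h2.congr_fun fun k => ?_
  have hal := (hd.pos k).ne'
  have hdk := hd.derivCoeff_ne_zero k
  have h3 := hd.excess_ne_zero
  have h4 := (hd.pos none).ne'
  have h5 := hd.derivCoeff_ne_zero none
  rw [inner_frameInv]
  split_ifs with hk
  · subst hk; field_simp; ring
  · field_simp; ring

/-- The linear relation between the `e(·, λ_j)` applied to the generating function, which vanishes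
at all `λ_j` but one. -/
lemma hasSum_sin_div_derivCoeff (hd : SpectralData T lam al) :
    HasSum (fun j => Real.sin (lam j * T) / hd.derivCoeff j) 1 := by
  classical
  have h := (hasSum_ite_eq (none : Label) (1 : ℝ)).sub
    (hd.hasSum_inner_div_derivCoeff hd.generator)
  rw [sub_zero] at h
  refine h.congr_fun fun j => ?_
  have hdj := hd.derivCoeff_ne_zero j
  cases j with
  | none =>
    have h1 := hd.genFun_eq (lam none)
    rw [if_pos rfl, div_eq_iff hdj, sub_mul, div_mul_cancel₀ _ hdj]
    simp only [derivCoeff] at hdj ⊢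
    linarith
  | some n =>
    have h1 := hd.genFun_eq (lam (some n))
    rw [genFun_some] at h1
    rw [if_neg (by simp), zero_sub, ← neg_div]
    congr 1; linarith

/-- The linear relation between the `e(·, λ_j)` applied to `S⁻¹ e(·, λ_{-0})`. -/
lemma hasSum_al_div_derivCoeff_sq (hd : SpectralData T lam al) :
    HasSum (fun j => al j / hd.derivCoeff j ^ 2) hd.excess⁻¹ := by
  classical
  have h := ((hasSum_ite_eq (none : Label) (al none / hd.derivCoeff none)).sub
    (hd.hasSum_inner_div_derivCoeff (hd.frameInv none))).mul_left
      (hd.excess * (al none / hd.derivCoeff none))⁻¹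
  have h3 := hd.excess_ne_zero
  have h4 := (hd.pos none).ne'
  have h5 := hd.derivCoeff_ne_zero none
  rw [sub_zero, mul_inv, mul_assoc, inv_mul_cancel₀ (div_ne_zero h4 h5), mul_one] at h
  refine h.congr_fun fun j => ?_
  have hdj := hd.derivCoeff_ne_zero j
  rw [inner_frameInv]
  split_ifs with hk
  · subst hk; field_simp; ring
  · field_simp; ring

lemma excess_pos (hd : SpectralData T lam al) : 0 < hd.excess := by
  rw [← inv_pos]
  exact (div_pos (hd.pos none) (sq_pos_of_ne_zero (hd.derivCoeff_ne_zero none))).trans_le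
    (le_hasSum hd.hasSum_al_div_derivCoeff_sq none fun j _ =>
      div_nonneg (hd.pos j).le (sq_nonneg _))

/-! ### Values at the right end -/

/-- The Fourier expansion of a quotient of `κ sin λT + ⟨g, e(·, λ)⟩`, evaluated at the right
end. -/
lemma tendsto_alternating_sum (hT : 0 < T) {κ μ : ℝ} {f g : Space T}
    (h : ∀ l, (l - μ) * ⟪waveLp T l, f⟫_ℝ = κ * Real.sin (l * T) + ⟪waveLp T l, g⟫_ℝ) :
    Tendsto (fun N : ℕ => ∑ m ∈ Finset.Icc (-(N : ℤ)) N,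
      T⁻¹ * ((-1) ^ m * ⟪waveLp T (node T m), f⟫_ℝ)) atTop (𝓝 κ) := by
  -- the division point is moved to a point where the sine equals one
  set ν := Real.pi / 2 / T with hν
  have hsν : Real.sin (ν * T) = 1 := by
    rw [hν, div_mul_cancel₀ _ hT.ne', Real.sin_pi_div_two]
  have hνne : ∀ m, ν ≠ node T m := fun m hm => by
    rw [hm, sin_node hT] at hsν; exact zero_ne_one hsν
  have h' : ∀ l, (l - ν) * ⟪waveLp T l, f⟫_ℝ =
      κ * Real.sin (l * T) + ⟪waveLp T l, g + (μ - ν) • f⟫_ℝ := by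
    intro l
    rw [inner_add_right, real_inner_smul_right]
    linear_combination h l
  have hsum := hasSum_inner_node hT (waveLp T ν) (-(g + (μ - ν) • f))
  have hval : ⟪waveLp T ν, -(g + (μ - ν) • f)⟫_ℝ = κ := by
    have := h' ν
    rw [sub_self, zero_mul, hsν] at this
    rw [inner_neg_right]; linarith
  rw [hval] at hsum
  refine (hsum.comp tendsto_Icc_neg).congr fun N => Finset.sum_congr rfl fun m _ => ?_
  have h1 := h' (node T m)
  rw [sin_node hT, mul_zero, zero_add] at h1
  have h2 : ν - node T m ≠ 0 := sub_ne_zero.2 (hνne m)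
  change T⁻¹ * (_ * _) = _
  rw [inner_neg_right, ← h1, real_inner_comm, inner_waveLp_node hT (hνne m), hsν]
  field_simp
  ring

/-- The values at the right end: `b` is a row of the transformation kernel there, `ev` the
corresponding component of the vectors `e(T, λ_j)`. The main equation is tested with the dual
vectors, which leaves a recursion between the labels. -/
lemma endpoint_relation (hd : SpectralData T lam al) (b : Space T) (ev : Label → ℝ) (κ : ℝ)
    (hb : ∀ w, Tendsto (fun N : ℕ => (al none)⁻¹ * (ev none * ⟪waveLp T (lam none), w⟫_ℝ) +
      ∑ n ∈ Finset.Icc (-(N : ℤ)) N, ((al (some n))⁻¹ *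
        (ev (some n) * ⟪waveLp T (lam (some n)), w⟫_ℝ) -
          T⁻¹ * (-(κ * (-1) ^ n) * ⟪waveLp T (node T n), w⟫_ℝ))) atTop
        (𝓝 (-⟪hd.frameOp b, w⟫_ℝ))) (j : Label) :
    (ev j + ⟪waveLp T (lam j), b⟫_ℝ) / al j * hd.derivCoeff j =
      (ev none + ⟪waveLp T (lam none), b⟫_ℝ) / al none * hd.derivCoeff none -
        κ * (lam j - lam none) := by
  refine hd.mul_derivCoeff_of_dual (y := fun j => (ev j + ⟪waveLp T (lam j), b⟫_ℝ) / al j)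
    (κ := κ) (fun n => ?_) j
  have h1 := (hd.hasSum_inner_frameOp b (hd.dual n)).unique
    ((hd.hasSum_inner_dual (fun j => (al j)⁻¹ * ⟪waveLp T (lam j), b⟫_ℝ) n).congr_fun
      fun k => by ring)
  have h2 := tendsto_alternating_sum hd.length_pos (κ := 1) (μ := lam (some n)) (f := hd.dual n)
    (g := hd.generator) fun l => by rw [sub_mul_inner_dual, genFun_eq, one_mul]
  have h3 : Tendsto (fun N : ℕ => (al none)⁻¹ * (ev none * ⟪waveLp T (lam none), hd.dual n⟫_ℝ) +
      ∑ m ∈ Finset.Icc (-(N : ℤ)) N, ((al (some m))⁻¹ *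
        (ev (some m) * ⟪waveLp T (lam (some m)), hd.dual n⟫_ℝ) -
          T⁻¹ * (-(κ * (-1) ^ m) * ⟪waveLp T (node T m), hd.dual n⟫_ℝ))) atTop
      (𝓝 ((al none)⁻¹ * (ev none * ⟪waveLp T (lam none), hd.dual n⟫_ℝ) +
        (al (some n))⁻¹ * (ev (some n) * ⟪waveLp T (lam (some n)), hd.dual n⟫_ℝ) + κ * 1)) := by
    refine ((h2.const_mul κ).const_add _).congr' ?_
    filter_upwards [eventually_ge_atTop n.natAbs] with N hN
    have hsingle : ∑ m ∈ Finset.Icc (-(N : ℤ)) N, (al (some m))⁻¹ *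
        (ev (some m) * ⟪waveLp T (lam (some m)), hd.dual n⟫_ℝ) =
        (al (some n))⁻¹ * (ev (some n) * ⟪waveLp T (lam (some n)), hd.dual n⟫_ℝ) :=
      Finset.sum_eq_single_of_mem n (by rw [Finset.mem_Icc]; omega) fun m _ hm => by
        rw [hd.inner_dual_of_ne hm, mul_zero, mul_zero]
    rw [Finset.sum_sub_distrib, hsingle, Finset.mul_sum, add_assoc, sub_eq_add_neg,
      ← Finset.sum_neg_distrib]
    congr 2
    exact Finset.sum_congr rfl fun m _ => by ring
  have h4 := tendsto_nhds_unique (hb (hd.dual n)) h3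
  rw [h1] at h4
  simp only [div_eq_mul_inv]
  linarith

/-- For the first component the constant is identified by means of the linear relation between the
`e(·, λ_j)`, applied to the row `b`. -/
lemma endpoint_first (hd : SpectralData T lam al) (b : Space T)
    (hb : ∀ w, Tendsto (fun N : ℕ => (al none)⁻¹ *
        (Real.sin (lam none * T) * ⟪waveLp T (lam none), w⟫_ℝ) +
      ∑ n ∈ Finset.Icc (-(N : ℤ)) N, ((al (some n))⁻¹ *
        (Real.sin (lam (some n) * T) * ⟪waveLp T (lam (some n)), w⟫_ℝ) -
          T⁻¹ * (-(0 * (-1) ^ n) * ⟪waveLp T (node T n), w⟫_ℝ))) atTop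
        (𝓝 (-⟪hd.frameOp b, w⟫_ℝ))) (j : Label) :
    (Real.sin (lam j * T) + ⟪waveLp T (lam j), b⟫_ℝ) / al j * hd.derivCoeff j = hd.excess := by
  set C := (Real.sin (lam none * T) + ⟪waveLp T (lam none), b⟫_ℝ) / al none *
    hd.derivCoeff none with hC
  have hrel : ∀ j, (Real.sin (lam j * T) + ⟪waveLp T (lam j), b⟫_ℝ) / al j * hd.derivCoeff j =
      C := fun j => by
    have := hd.endpoint_relation b (fun j => Real.sin (lam j * T)) 0 hb j
    rwa [zero_mul, sub_zero] at this
  rw [hrel]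
  have h1 := hd.hasSum_sin_div_derivCoeff.add (hd.hasSum_inner_div_derivCoeff b)
  rw [add_zero] at h1
  have h2 := hd.hasSum_al_div_derivCoeff_sq.mul_left C
  have h3 := h1.unique (h2.congr_fun fun j => by
    have hdj := hd.derivCoeff_ne_zero j
    have hal := (hd.pos j).ne'
    rw [← hrel j]; field_simp)
  have := hd.excess_ne_zero
  field_simp at h3
  exact h3.symm

end SpectralData

/-! ### Multiplication operators -/

section
variable {T : ℝ}

lemma memLp_bdd_mul {m : ℝ → ℂ} (hm : Measurable m) {C : ℝ}
    (hC : ∀ x ∈ Ioo 0 T, ‖m x‖ ≤ C) (f : Space T) :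
    MemLp (fun x => m x * f x) 2 (volume.restrict (Ioo 0 T)) :=
  (Lp.memLp f).of_le_mul (c := C) (hm.aestronglyMeasurable.mul (Lp.aestronglyMeasurable f)) (by
    filter_upwards [ae_restrict_mem measurableSet_Ioo] with x hx
    rw [norm_mul]
    exact mul_le_mul_of_nonneg_right (hC x hx) (norm_nonneg _))

/-- Multiplication by a bounded measurable function. -/
def mulLp (T : ℝ) (m : ℝ → ℂ) (hm : Measurable m) (C : ℝ)
    (hC : ∀ x ∈ Ioo 0 T, ‖m x‖ ≤ C) : Space T →L[ℝ] Space T :=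
  LinearMap.mkContinuous
    { toFun := fun f => (memLp_bdd_mul hm hC f).toLp _
      map_add' := fun f g => by
        rw [← MemLp.toLp_add, MemLp.toLp_eq_toLp_iff]
        filter_upwards [Lp.coeFn_add f g] with x hx
        rw [hx, Pi.add_apply, Pi.add_apply, mul_add]
      map_smul' := fun c f => by
        rw [RingHom.id_apply, ← MemLp.toLp_const_smul, MemLp.toLp_eq_toLp_iff]
        filter_upwards [Lp.coeFn_smul c f] with x hx
        rw [hx, Pi.smul_apply, Pi.smul_apply, mul_smul_comm] }
    C (fun f => by
      refine Lp.norm_le_mul_norm_of_ae_le_mul ?_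
      filter_upwards [(memLp_bdd_mul hm hC f).coeFn_toLp, ae_restrict_mem measurableSet_Ioo]
        with x hx hx'
      simp only [LinearMap.coe_mk, AddHom.coe_mk]
      rw [hx, norm_mul]
      exact mul_le_mul_of_nonneg_right (hC x hx') (norm_nonneg _))

lemma coeFn_mulLp (m : ℝ → ℂ) (hm : Measurable m) (C : ℝ)
    (hC : ∀ x ∈ Ioo 0 T, ‖m x‖ ≤ C) (f : Space T) :
    mulLp T m hm C hC f =ᵐ[volume.restrict (Ioo 0 T)] fun x => m x * f x :=
  (memLp_bdd_mul hm hC f).coeFn_toLp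

lemma norm_mulLp_le (m : ℝ → ℂ) (hm : Measurable m) {C : ℝ}
    (hC : ∀ x ∈ Ioo 0 T, ‖m x‖ ≤ C) (f : Space T) : ‖mulLp T m hm C hC f‖ ≤ C * ‖f‖ := by
  refine Lp.norm_le_mul_norm_of_ae_le_mul ?_
  filter_upwards [coeFn_mulLp m hm C hC f, ae_restrict_mem measurableSet_Ioo] with x hx hx'
  rw [hx, norm_mul]
  exact mul_le_mul_of_nonneg_right (hC x hx') (norm_nonneg _)

variable (T) in
/-- Multiplication by the indicator function of a set. -/
def restrLp (A : Set ℝ) (hA : MeasurableSet A) : Space T →L[ℝ] Space T :=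
  mulLp T (A.indicator 1) (measurable_one.indicator hA) 1 fun x _ =>
    (norm_indicator_le_norm_self _ _).trans (by simp)

lemma coeFn_restrLp (A : Set ℝ) (hA : MeasurableSet A) (f : Space T) :
    restrLp T A hA f =ᵐ[volume.restrict (Ioo 0 T)] A.indicator f := by
  refine (coeFn_mulLp _ _ _ _ f).trans (ae_of_all _ fun x => ?_)
  by_cases hx : x ∈ A <;> simp [hx]

lemma inner_restrLp (A : Set ℝ) (hA : MeasurableSet A) (f g : Space T) :
    ⟪restrLp T A hA f, g⟫_ℝ = ⟪f, restrLp T A hA g⟫_ℝ := by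
  rw [L2.inner_def, L2.inner_def]
  refine integral_congr_ae ?_
  filter_upwards [coeFn_restrLp A hA f, coeFn_restrLp A hA g] with x h1 h2
  rw [h1, h2]
  by_cases hx : x ∈ A <;> simp [hx]

lemma restrLp_eq_zero_of_disjoint {A B : Set ℝ} (hA : MeasurableSet A) (hB : MeasurableSet B)
    (h : Disjoint A B) (f : Space T) : restrLp T A hA (restrLp T B hB f) = 0 := by
  rw [Lp.eq_zero_iff_ae_eq_zero]
  filter_upwards [coeFn_restrLp A hA (restrLp T B hB f), coeFn_restrLp B hB f] with x h1 h2
  rw [h1]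
  by_cases hx : x ∈ A
  · simp [hx, h2, disjoint_left.1 h hx]
  · simp [hx]

lemma restrLp_restrLp_self (A : Set ℝ) (hA : MeasurableSet A) (f : Space T) :
    restrLp T A hA (restrLp T A hA f) = restrLp T A hA f := by
  refine Lp.ext ?_
  filter_upwards [coeFn_restrLp A hA (restrLp T A hA f), coeFn_restrLp A hA f] with x h1 h2
  rw [h1]
  by_cases hx : x ∈ A
  · rw [indicator_of_mem hx]
  · rw [h2, indicator_of_notMem hx, indicator_of_notMem hx]

/-- The functions vanishing almost everywhere to the right of `s`. -/
def supported (T s : ℝ) : Submodule ℝ (Space T) :=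
  LinearMap.ker (restrLp T (Ioi s) measurableSet_Ioi : Space T →ₗ[ℝ] Space T)

lemma mem_supported {s : ℝ} {f : Space T} :
    f ∈ supported T s ↔ restrLp T (Ioi s) measurableSet_Ioi f = 0 := Iff.rfl

lemma isClosed_supported (s : ℝ) : IsClosed (supported T s : Set (Space T)) :=
  ContinuousLinearMap.isClosed_ker (restrLp T (Ioi s) measurableSet_Ioi)

lemma mem_supported_iff {s : ℝ} {f : Space T} :
    f ∈ supported T s ↔ ∀ᵐ x ∂(volume.restrict (Ioo 0 T)), s < x → f x = 0 := by
  rw [mem_supported, Lp.eq_zero_iff_ae_eq_zero]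
  constructor
  · intro h
    filter_upwards [h, coeFn_restrLp (Ioi s) measurableSet_Ioi f] with x h1 h2 hx
    rwa [h2, indicator_of_mem (show x ∈ Ioi s from hx)] at h1
  · intro h
    filter_upwards [h, coeFn_restrLp (Ioi s) measurableSet_Ioi f] with x h1 h2
    rw [h2]
    by_cases hx : x ∈ Ioi s
    · simp [hx, h1 hx]
    · simp [hx]

lemma supported_mono {s s' : ℝ} (h : s ≤ s') : supported T s ≤ supported T s' := by
  intro f hf
  rw [mem_supported_iff] at hf ⊢
  filter_upwards [hf] with x hx h' using hx (h.trans_lt h')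

lemma restrLp_Ioc_mem_supported (s s' : ℝ) (f : Space T) :
    restrLp T (Ioc s s') measurableSet_Ioc f ∈ supported T s' := by
  rw [mem_supported, restrLp_eq_zero_of_disjoint]
  exact disjoint_left.2 fun x (h1 : s' < x) h2 => not_lt.2 h2.2 h1

lemma restrLp_Iic_mem_supported (s : ℝ) (f : Space T) :
    restrLp T (Iic s) measurableSet_Iic f ∈ supported T s := by
  rw [mem_supported, restrLp_eq_zero_of_disjoint]
  exact disjoint_left.2 fun x (h1 : s < x) (h2 : x ≤ s) => not_lt.2 h2 h1

lemma supported_right : supported T T = ⊤ := by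
  rw [eq_top_iff]
  intro f _
  rw [mem_supported_iff]
  filter_upwards [ae_restrict_mem measurableSet_Ioo] with x hx h
  exact absurd hx.2 (not_lt.2 h.le)

lemma eq_zero_of_mem_supported_zero {f : Space T} (hf : f ∈ supported T 0) : f = 0 := by
  rw [mem_supported_iff] at hf
  rw [Lp.eq_zero_iff_ae_eq_zero]
  filter_upwards [hf, ae_restrict_mem measurableSet_Ioo] with x h hx using h hx.1

/-- A function supported in `(0, s')` is the sum of its restrictions to `(0, s]` and `(s, s']`. -/
lemma eq_restrLp_add {s s' : ℝ} {f : Space T} (hf : f ∈ supported T s') :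
    f = restrLp T (Iic s) measurableSet_Iic f + restrLp T (Ioc s s') measurableSet_Ioc f := by
  rw [mem_supported_iff] at hf
  refine Lp.ext ?_
  filter_upwards [hf, coeFn_restrLp (Iic s) measurableSet_Iic f,
    coeFn_restrLp (Ioc s s') measurableSet_Ioc f,
    Lp.coeFn_add (restrLp T (Iic s) measurableSet_Iic f)
      (restrLp T (Ioc s s') measurableSet_Ioc f)] with x h1 h2 h3 h4
  rw [h4, Pi.add_apply, h2, h3]
  by_cases hx : x ≤ s
  · simp [hx, not_lt.2 hx]
  · by_cases hx' : x ≤ s'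
    · simp [hx, hx', not_le.1 hx]
    · simp [hx, hx', h1 (not_le.1 hx')]

lemma inner_restrLp_Ioc_toLp {s s' : ℝ} (hs : 0 ≤ s) (hss' : s ≤ s') (hs' : s' ≤ T) {f g : ℝ → ℂ}
    (hf : MemLp f 2 (volume.restrict (Ioo 0 T))) (hg : MemLp g 2 (volume.restrict (Ioo 0 T))) :
    ⟪restrLp T (Ioc s s') measurableSet_Ioc (hf.toLp f), hg.toLp g⟫_ℝ =
      ∫ x in s..s', ⟪f x, g x⟫_ℝ := by
  have h1 : Ioc s s' = Ioc 0 T ∩ Ioc s s' := by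
    rw [inter_eq_right.2 (Ioc_subset_Ioc hs hs')]
  have h2 : ∫ x in Ioc s s', ⟪f x, g x⟫_ℝ =
      ∫ x in Ioo 0 T, (Ioc s s').indicator (fun x => ⟪f x, g x⟫_ℝ) x := by
    conv_lhs => rw [h1, ← setIntegral_indicator measurableSet_Ioc, integral_Ioc_eq_integral_Ioo]
  rw [inner_toLp_right, intervalIntegral.integral_of_le hss', h2]
  refine integral_congr_ae ?_
  filter_upwards [coeFn_restrLp (Ioc s s') measurableSet_Ioc (hf.toLp f), hf.coeFn_toLp]
    with x h1 h2
  rw [h1]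
  by_cases hx : x ∈ Ioc s s'
  · simp only [indicator_of_mem hx, h2]
  · simp only [indicator_of_notMem hx, inner_zero_left]

/-! ### First order expansion of `e(·, λ)` in `λ` -/

lemma norm_exp_sub_one_sub_le (θ : ℝ) :
    ‖Complex.exp (Complex.I * θ) - 1 - Complex.I * θ‖ ≤ 2 * θ ^ 2 := by
  rcases le_or_gt |θ| 1 with h | h
  · have h1 := Complex.norm_exp_sub_one_sub_id_le (x := Complex.I * θ) (by simpa using h)
    refine h1.trans ?_
    simp only [norm_mul, Complex.norm_I, one_mul, Complex.norm_real, Real.norm_eq_abs, sq_abs]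
    nlinarith [sq_nonneg θ]
  · have h1 := Real.norm_exp_I_mul_ofReal_sub_one_le (x := θ)
    refine (norm_sub_le _ _).trans ?_
    simp only [norm_mul, Complex.norm_I, one_mul, Complex.norm_real, Real.norm_eq_abs] at h1 ⊢
    rw [← sq_abs]
    nlinarith

/-- Multiplication by `i x`, which differentiates `e(x, λ)` in `λ`. -/
def mulIX : Space T →L[ℝ] Space T :=
  mulLp T (fun x => Complex.I * x) (by fun_prop) T fun x hx => by
    simp [abs_of_pos hx.1, hx.2.le]

lemma norm_mulIX_le (f : Space T) : ‖mulIX f‖ ≤ T * ‖f‖ :=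
  norm_mulLp_le _ _ _ f

lemma norm_waveLp_sub_sub_le (hT : 0 < T) (l m : ℝ) :
    ‖waveLp T l - waveLp T m - (l - m) • mulIX (waveLp T m)‖ ≤
      Real.sqrt T * (2 * T ^ 2) * (l - m) ^ 2 := by
  set r : ℝ → ℂ := fun x => wave l x - wave m x - (l - m) • (Complex.I * x * wave m x) with hr
  have hrm : MemLp r 2 (volume.restrict (Ioo 0 T)) := memLp_of_continuous (by
    have := continuous_wave_right l
    have := continuous_wave_right m
    fun_prop) T
  have heq : waveLp T l - waveLp T m - (l - m) • mulIX (waveLp T m) = hrm.toLp r := by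
    refine Lp.ext ?_
    filter_upwards [hrm.coeFn_toLp, Lp.coeFn_sub (waveLp T l - waveLp T m)
      ((l - m) • mulIX (waveLp T m)), Lp.coeFn_sub (waveLp T l) (waveLp T m),
      Lp.coeFn_smul (l - m) (mulIX (waveLp T m)), (memLp_wave l T).coeFn_toLp,
      (memLp_wave m T).coeFn_toLp, coeFn_mulLp (fun x : ℝ => Complex.I * x) (by fun_prop) T
        (fun x hx => by simp [abs_of_pos hx.1, hx.2.le]) (waveLp T m)] with x h1 h2 h3 h4 h5 h6 h7
    rw [h1, h2, Pi.sub_apply, h3, Pi.sub_apply, h4, Pi.smul_apply, mulIX, h7, hr, waveLp, waveLp,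
      h5, h6]
  rw [heq]
  refine (norm_toLp_le hT.le hrm (C := 2 * T ^ 2 * (l - m) ^ 2) (by positivity)
    fun x hx => ?_).trans (le_of_eq (by ring))
  have h : r x = wave m x * (Complex.exp (Complex.I * ((l - m) * x : ℝ)) - 1 -
      Complex.I * ((l - m) * x : ℝ)) := by
    have h1 : wave l x = wave m x * Complex.exp (Complex.I * ((l - m) * x : ℝ)) := by
      rw [wave_eq, wave_eq, mul_assoc, ← Complex.exp_add]; push_cast; ring_nf
    rw [hr]; simp only
    rw [h1, Complex.real_smul]; push_cast; ring
  rw [h, norm_mul, norm_wave, one_mul]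
  refine (norm_exp_sub_one_sub_le _).trans ?_
  have : x ^ 2 ≤ T ^ 2 := pow_le_pow_left₀ hx.1.le hx.2.le 2
  calc 2 * ((l - m) * x) ^ 2 = 2 * x ^ 2 * (l - m) ^ 2 := by ring
    _ ≤ _ := by gcongr

lemma norm_sum_smul_node (hT : 0 < T) (c : ℤ → ℝ) (F : Finset ℤ) :
    ‖∑ n ∈ F, c n • waveLp T (node T n)‖ = Real.sqrt (T * ∑ n ∈ F, c n ^ 2) := by
  have h1 : ∀ n, waveLp T (node T n) = Real.sqrt T • nodeBasis hT n := fun n => by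
    rw [nodeBasis_apply, smul_smul, mul_inv_cancel₀ (Real.sqrt_pos.2 hT).ne', one_smul]
  rw [eq_comm, Real.sqrt_eq_iff_mul_self_eq (by positivity) (norm_nonneg _),
    ← real_inner_self_eq_norm_mul_norm]
  simp only [h1, smul_smul]
  rw [(nodeBasis hT).orthonormal.inner_sum, Finset.mul_sum]
  refine Finset.sum_congr rfl fun n _ => ?_
  rw [conj_trivial, ← pow_two, mul_pow, Real.sq_sqrt hT.le, mul_comm]

end

/-! ### The rows of the kernel `F₀` -/

lemma abs_trig_le (l s : ℝ) (i : Fin 2) : |trig l s i| ≤ 1 := by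
  fin_cases i <;> simp [trig, Real.abs_sin_le_one, Real.abs_cos_le_one]

lemma abs_trig_sub_le (l m s : ℝ) (i : Fin 2) : |trig l s i - trig m s i| ≤ |l - m| * |s| := by
  rw [← abs_mul, sub_mul]
  fin_cases i
  · simpa [trig] using Real.abs_sin_sub_sin_le (l * s) (m * s)
  · have := Real.abs_cos_sub_cos_le (l * s) (m * s)
    simp only [trig, Fin.mk_one, Matrix.cons_val_one, Matrix.cons_val_fin_one]
    rwa [neg_sub_neg, abs_sub_comm]

lemma continuous_trig (l : ℝ) (i : Fin 2) : Continuous fun s => trig l s i := by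
  fin_cases i
  · simp only [trig, Fin.zero_eta, Matrix.cons_val_zero]; fun_prop
  · simp only [trig, Fin.mk_one, Matrix.cons_val_one, Matrix.cons_val_fin_one]; fun_prop

lemma wave_eq_trig (l s : ℝ) : wave l s = ⟨trig l s 0, trig l s 1⟩ := rfl

namespace SpectralData
variable {T : ℝ} {lam al : Label → ℝ}

/-- The `n`-th term of the series for the `i`-th row of the kernel at `x`. -/
def rowTerm (T : ℝ) (lam al : Label → ℝ) (i : Fin 2) (x : ℝ) (n : ℤ) : Space T :=
  ((al (some n))⁻¹ * trig (lam (some n)) x i) • waveLp T (lam (some n)) -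
    (T⁻¹ * trig (node T n) x i) • waveLp T (node T n)

/-- The symmetric partial sums of the `i`-th row of the kernel at `x`. -/
def rowPartial (T : ℝ) (lam al : Label → ℝ) (i : Fin 2) (N : ℕ) (x : ℝ) : Space T :=
  ((al none)⁻¹ * trig (lam none) x i) • waveLp T (lam none) +
    ∑ n ∈ Finset.Icc (-(N : ℤ)) N, rowTerm T lam al i x n

/-- The square summable sequence controlling the series of the kernel. -/
def defect (T : ℝ) (lam al : Label → ℝ) (n : ℤ) : ℝ :=
  (lam (some n) - node T n) ^ 2 + (al (some n) - T) ^ 2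

lemma defect_nonneg (T : ℝ) (lam al : Label → ℝ) (n : ℤ) : 0 ≤ defect T lam al n := by
  unfold defect; positivity

/-- The terms of the kernel are `p e⁰ + i x (q e⁰) + O(ε²)` with `e⁰` the orthogonal vectors at the
points `nπ/T` and `p`, `q` square summable uniformly in `x`. -/
lemma exists_norm_sum_rowTerm_le (hd : SpectralData T lam al) : ∃ K, 0 ≤ K ∧
    ∀ (F : Finset ℤ) (i : Fin 2), ∀ x ∈ Icc 0 T, ‖∑ n ∈ F, rowTerm T lam al i x n‖ ≤
      K * (Real.sqrt (∑ n ∈ F, defect T lam al n) + ∑ n ∈ F, defect T lam al n) := by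
  have hT := hd.length_pos
  obtain ⟨M, hM0, hM⟩ := hd.exists_inv_al_le
  set K₁ := 2 * (M * T) ^ 2 + 2 * (M * T⁻¹) ^ 2 with hK₁
  refine ⟨Real.sqrt (T * K₁) + T * Real.sqrt (T * M ^ 2) + M * (Real.sqrt T * (2 * T ^ 2)),
    by positivity, fun F i x hx => ?_⟩
  set S := ∑ n ∈ F, defect T lam al n with hS
  have hS0 : 0 ≤ S := Finset.sum_nonneg fun n _ => defect_nonneg _ _ _ n
  set q : ℤ → ℝ := fun n => (al (some n))⁻¹ * trig (lam (some n)) x i with hq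
  set p : ℤ → ℝ := fun n => q n - T⁻¹ * trig (node T n) x i with hp
  set ε : ℤ → ℝ := fun n => lam (some n) - node T n with hε
  set rem : ℤ → Space T := fun n => waveLp T (lam (some n)) - waveLp T (node T n) -
    ε n • mulIX (waveLp T (node T n)) with hrem
  have hterm : ∀ n, rowTerm T lam al i x n = p n • waveLp T (node T n) +
      mulIX ((q n * ε n) • waveLp T (node T n)) + q n • rem n := by
    intro n
    rw [map_smul, rowTerm]
    simp only [hrem, hp, hq]
    module
  have hqM : ∀ n, |q n| ≤ M := by
    intro n
    rw [hq]; simp only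
    rw [abs_mul, abs_of_pos (inv_pos.2 (hd.pos _))]
    exact (mul_le_of_le_one_right (inv_pos.2 (hd.pos _)).le (abs_trig_le _ _ _)).trans (hM _)
  have hε2 : ∀ n, ε n ^ 2 ≤ defect T lam al n := fun n => by
    rw [defect]; exact le_add_of_nonneg_right (sq_nonneg _)
  have hp2 : ∀ n, p n ^ 2 ≤ K₁ * defect T lam al n := by
    intro n
    have ha : 0 < (al (some n))⁻¹ := inv_pos.2 (hd.pos _)
    have hal := (hd.pos (some n)).ne'
    have h1 : p n = (al (some n))⁻¹ * (trig (lam (some n)) x i - trig (node T n) x i) -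
        (al (some n))⁻¹ * T⁻¹ * (al (some n) - T) * trig (node T n) x i := by
      simp only [hp, hq]; field_simp; ring
    have h2 : |(al (some n))⁻¹ * (trig (lam (some n)) x i - trig (node T n) x i)| ≤
        M * T * |ε n| := by
      rw [abs_mul, abs_of_pos ha, mul_assoc]
      refine mul_le_mul (hM _) ((abs_trig_sub_le _ _ _ _).trans ?_) (abs_nonneg _) hM0.le
      rw [mul_comm, abs_of_nonneg hx.1]
      exact mul_le_mul_of_nonneg_right hx.2 (abs_nonneg _)
    have h3 : |(al (some n))⁻¹ * T⁻¹ * (al (some n) - T) * trig (node T n) x i| ≤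
        M * T⁻¹ * |al (some n) - T| := by
      rw [abs_mul, abs_mul, abs_mul, abs_of_pos ha, abs_of_pos (inv_pos.2 hT)]
      refine (mul_le_of_le_one_right (by positivity) (abs_trig_le _ _ _)).trans ?_
      gcongr
      exact hM _
    have h4 : |p n| ≤ M * T * |ε n| + M * T⁻¹ * |al (some n) - T| := by
      rw [h1]; exact (abs_sub _ _).trans (add_le_add h2 h3)
    rw [← sq_abs]
    refine (pow_le_pow_left₀ (abs_nonneg _) h4 2).trans ?_
    have h5 := sq_abs (ε n)
    have h6 := sq_abs (al (some n) - T)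
    have h7 : (M * T * |ε n| + M * T⁻¹ * |al (some n) - T|) ^ 2 ≤
        2 * (M * T) ^ 2 * ε n ^ 2 + 2 * (M * T⁻¹) ^ 2 * (al (some n) - T) ^ 2 := by
      rw [← h5, ← h6]
      nlinarith [sq_nonneg (M * T * |ε n| - M * T⁻¹ * |al (some n) - T|)]
    refine h7.trans ?_
    have h8 : 0 ≤ (M * T) ^ 2 * (al (some n) - T) ^ 2 := by positivity
    have h9 : 0 ≤ (M * T⁻¹) ^ 2 * ε n ^ 2 := by positivity
    simp only [defect, hK₁]
    nlinarith
  have hA : ‖∑ n ∈ F, p n • waveLp T (node T n)‖ ≤ Real.sqrt (T * K₁) * Real.sqrt S := by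
    rw [norm_sum_smul_node hT, ← Real.sqrt_mul (by positivity)]
    refine Real.sqrt_le_sqrt ?_
    rw [mul_assoc, hS, Finset.mul_sum (a := K₁)]
    exact mul_le_mul_of_nonneg_left (Finset.sum_le_sum fun n _ => hp2 n) hT.le
  have hB : ‖mulIX (∑ n ∈ F, (q n * ε n) • waveLp T (node T n))‖ ≤
      T * Real.sqrt (T * M ^ 2) * Real.sqrt S := by
    refine (norm_mulIX_le _).trans ?_
    rw [norm_sum_smul_node hT, mul_assoc, ← Real.sqrt_mul (by positivity)]
    refine mul_le_mul_of_nonneg_left (Real.sqrt_le_sqrt ?_) hT.le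
    rw [mul_assoc, hS, Finset.mul_sum (a := M ^ 2)]
    refine mul_le_mul_of_nonneg_left (Finset.sum_le_sum fun n _ => ?_) hT.le
    rw [mul_pow]
    refine mul_le_mul ?_ (hε2 n) (sq_nonneg _) (sq_nonneg _)
    rw [← sq_abs]; exact pow_le_pow_left₀ (abs_nonneg _) (hqM n) 2
  have hC : ‖∑ n ∈ F, q n • rem n‖ ≤ M * (Real.sqrt T * (2 * T ^ 2)) * S := by
    refine (norm_sum_le _ _).trans ?_
    rw [hS, Finset.mul_sum]
    refine Finset.sum_le_sum fun n _ => ?_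
    rw [norm_smul, mul_assoc]
    refine mul_le_mul (hqM n) ((norm_waveLp_sub_sub_le hT _ _).trans ?_) (norm_nonneg _) hM0.le
    exact mul_le_mul_of_nonneg_left (hε2 n) (by positivity)
  have hsum : ∑ n ∈ F, rowTerm T lam al i x n = ∑ n ∈ F, p n • waveLp T (node T n) +
      mulIX (∑ n ∈ F, (q n * ε n) • waveLp T (node T n)) + ∑ n ∈ F, q n • rem n := by
    rw [map_sum, ← Finset.sum_add_distrib, ← Finset.sum_add_distrib]
    exact Finset.sum_congr rfl fun n _ => hterm n
  rw [hsum]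
  refine (norm_add₃_le).trans ((add_le_add (add_le_add hA hB) hC).trans ?_)
  have h1 : 0 ≤ Real.sqrt S := Real.sqrt_nonneg _
  have h2 : 0 ≤ Real.sqrt (T * K₁) * S := by positivity
  have h3 : 0 ≤ T * Real.sqrt (T * M ^ 2) * S := by positivity
  have h4 : 0 ≤ M * (Real.sqrt T * (2 * T ^ 2)) * Real.sqrt S := by positivity
  linarith

/-- `G i x` is the sum of the series for the `i`-th row of the kernel at each `x ∈ [0, T]`. -/
def IsRow (T : ℝ) (lam al : Label → ℝ) (G : Fin 2 → ℝ → Space T) : Prop :=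
  ∀ x ∈ Icc 0 T, ∀ i, Tendsto (fun N => rowPartial T lam al i N x) atTop (𝓝 (G i x))

variable {G : Fin 2 → ℝ → Space T}

/-- Pointwise convergence of the series for the rows is automatically uniform. -/
lemma tendstoUniformlyOn_row (hd : SpectralData T lam al) (hG : IsRow T lam al G) (i : Fin 2) :
    TendstoUniformlyOn (fun N x => rowPartial T lam al i N x) (G i) atTop (Icc 0 T) := by
  obtain ⟨K, hK0, hK⟩ := hd.exists_norm_sum_rowTerm_le
  rw [Metric.tendstoUniformlyOn_iff]
  intro η hη
  have hσ : Summable (defect T lam al) := hd.lam_asymp.add hd.al_asymp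
  obtain ⟨δ, hδ0, hδ⟩ : ∃ δ > 0, K * (Real.sqrt δ + δ) < η := by
    have h : Tendsto (fun δ => K * (Real.sqrt δ + δ)) (𝓝[>] 0) (𝓝 (K * (Real.sqrt 0 + 0))) :=
      (Continuous.tendsto (by fun_prop) 0).mono_left nhdsWithin_le_nhds
    rw [Real.sqrt_zero, add_zero, mul_zero] at h
    obtain ⟨δ, h1, h2⟩ := ((h.eventually (gt_mem_nhds hη)).and self_mem_nhdsWithin).exists
    exact ⟨δ, h2, h1⟩
  obtain ⟨N₀, hN₀⟩ := exists_sum_lt_of_disjoint_Icc hσ hδ0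
  filter_upwards [eventually_ge_atTop N₀] with N hN x hx
  refine lt_of_le_of_lt ?_ hδ
  rw [dist_eq_norm]
  refine le_of_tendsto ((hG x hx i).sub_const _).norm ?_
  filter_upwards [eventually_ge_atTop N] with N' hN'
  have hsub : Finset.Icc (-(N : ℤ)) N ⊆ Finset.Icc (-(N' : ℤ)) N' :=
    Finset.Icc_subset_Icc (by simpa using hN') (by simpa using hN')
  rw [rowPartial, rowPartial, add_sub_add_left_eq_sub, ← Finset.sum_sdiff hsub,
    add_sub_cancel_right]
  refine (hK _ i x hx).trans (mul_le_mul_of_nonneg_left ?_ hK0)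
  have := (hN₀ N hN _ Finset.sdiff_disjoint :
    ∑ n ∈ Finset.Icc (-(N' : ℤ)) N' \ Finset.Icc (-(N : ℤ)) N, defect T lam al n < δ).le
  exact add_le_add (Real.sqrt_le_sqrt this) this

lemma continuous_rowPartial (i : Fin 2) (N : ℕ) :
    Continuous fun x => rowPartial T lam al i N x := by
  have h := fun l => continuous_trig l i
  simp only [rowPartial, rowTerm]
  refine ((continuous_const.mul (h _)).smul continuous_const).add
    (continuous_finsetSum _ fun n _ => ?_)
  exact ((continuous_const.mul (h _)).smul continuous_const).sub
    ((continuous_const.mul (h _)).smul continuous_const)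

lemma continuousOn_row (hd : SpectralData T lam al) (hG : IsRow T lam al G) (i : Fin 2) :
    ContinuousOn (G i) (Icc 0 T) :=
  (hd.tendstoUniformlyOn_row hG i).continuousOn
    (Frequently.of_forall fun N => (continuous_rowPartial i N).continuousOn)

lemma exists_norm_row_le (hd : SpectralData T lam al) (hG : IsRow T lam al G) :
    ∃ C, 0 ≤ C ∧ ∀ x ∈ Icc 0 T, ∀ i, ‖G i x‖ ≤ C := by
  obtain ⟨C₀, h0⟩ := isCompact_Icc.exists_bound_of_continuousOn (hd.continuousOn_row hG 0)
  obtain ⟨C₁, h1⟩ := isCompact_Icc.exists_bound_of_continuousOn (hd.continuousOn_row hG 1)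
  refine ⟨max 0 (max C₀ C₁), le_max_left _ _, fun x hx i => ?_⟩
  fin_cases i
  · exact (h0 x hx).trans ((le_max_left _ _).trans (le_max_right _ _))
  · exact (h1 x hx).trans ((le_max_right _ _).trans (le_max_right _ _))

/-- The function `x ↦ ∫ F₀(x, t) f(t) dt` in complex notation. -/
def kernelFun (G : Fin 2 → ℝ → Space T) (f : Space T) (x : ℝ) : ℂ :=
  ⟨⟪G 0 x, f⟫_ℝ, ⟪G 1 x, f⟫_ℝ⟩

lemma kernelFun_eq (G : Fin 2 → ℝ → Space T) (f : Space T) (x : ℝ) :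
    kernelFun G f x = (⟪G 0 x, f⟫_ℝ : ℂ) + (⟪G 1 x, f⟫_ℝ : ℂ) * Complex.I :=
  Complex.mk_eq_add_mul_I _ _

lemma norm_mk_le (a b : ℝ) : ‖(⟨a, b⟩ : ℂ)‖ ≤ |a| + |b| := Complex.norm_le_abs_re_add_abs_im _

lemma norm_kernelFun_le {C x : ℝ} (hC : ∀ i, ‖G i x‖ ≤ C) (f : Space T) :
    ‖kernelFun G f x‖ ≤ 2 * C * ‖f‖ := by
  refine (norm_mk_le _ _).trans ?_
  have h : ∀ i, |⟪G i x, f⟫_ℝ| ≤ C * ‖f‖ := fun i =>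
    (abs_real_inner_le_norm _ _).trans (mul_le_mul_of_nonneg_right (hC i) (norm_nonneg _))
  linarith [h 0, h 1]

lemma continuousOn_kernelFun (hd : SpectralData T lam al) (hG : IsRow T lam al G) (f : Space T) :
    ContinuousOn (kernelFun G f) (Icc 0 T) := by
  have h0 := (hd.continuousOn_row hG 0).inner (𝕜 := ℝ) (continuousOn_const (c := f))
  have h1 := (hd.continuousOn_row hG 1).inner (𝕜 := ℝ) (continuousOn_const (c := f))
  have : kernelFun G f = fun x => (⟪G 0 x, f⟫_ℝ : ℂ) + (⟪G 1 x, f⟫_ℝ : ℂ) * Complex.I :=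
    funext (kernelFun_eq G f)
  rw [this]
  exact (Complex.continuous_ofReal.comp_continuousOn h0).add
    ((Complex.continuous_ofReal.comp_continuousOn h1).mul continuousOn_const)

lemma memLp_of_continuousOn {r : ℝ → ℂ} (hr : ContinuousOn r (Icc 0 T)) :
    MemLp r 2 (volume.restrict (Ioo 0 T)) := by
  obtain ⟨C, hC⟩ := isCompact_Icc.exists_bound_of_continuousOn hr
  exact memLp_of_norm_le ((hr.mono Ioo_subset_Icc_self).aestronglyMeasurable measurableSet_Ioo) C
    fun x hx => hC x (Ioo_subset_Icc_self hx)

lemma memLp_kernelFun (hd : SpectralData T lam al) (hG : IsRow T lam al G) (f : Space T) :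
    MemLp (kernelFun G f) 2 (volume.restrict (Ioo 0 T)) :=
  memLp_of_continuousOn (hd.continuousOn_kernelFun hG f)

/-- The integral operator with kernel `F₀`. -/
def kernelOp (hd : SpectralData T lam al) (hG : IsRow T lam al G) (f : Space T) : Space T :=
  (hd.memLp_kernelFun hG f).toLp _

lemma tendsto_insertNone_Icc :
    Tendsto (fun N : ℕ => Finset.insertNone (Finset.Icc (-(N : ℤ)) N)) atTop atTop := by
  refine tendsto_atTop_finset_of_monotone (fun a b hab => ?_) fun j => ?_
  · exact Finset.insertNone.monotone
      (Finset.Icc_subset_Icc (by simpa using hab) (by simpa using hab))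
  · cases j with
    | none => exact ⟨0, by simp⟩
    | some m => exact ⟨m.natAbs, by rw [Finset.some_mem_insertNone, Finset.mem_Icc]; omega⟩

/-- The frame operator is the identity plus the integral operator with kernel `F₀`. -/
lemma frameOp_eq_add_kernelOp (hd : SpectralData T lam al) (hG : IsRow T lam al G) (f : Space T) :
    hd.frameOp f = f + hd.kernelOp hG f := by
  refine ext_inner_right ℝ fun w => ?_
  rw [inner_add_left]
  -- partial sums of the kernel, as vectors
  set Y : ℕ → Space T := fun N => ((al none)⁻¹ * ⟪waveLp T (lam none), f⟫_ℝ) • waveLp T (lam none) +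
    ∑ n ∈ Finset.Icc (-(N : ℤ)) N, (((al (some n))⁻¹ * ⟪waveLp T (lam (some n)), f⟫_ℝ) •
      waveLp T (lam (some n)) - (T⁻¹ * ⟪waveLp T (node T n), f⟫_ℝ) • waveLp T (node T n)) with hY
  have h1 : Tendsto (fun N => ⟪Y N, w⟫_ℝ) atTop (𝓝 (⟪hd.frameOp f, w⟫_ℝ - ⟪f, w⟫_ℝ)) := by
    have ha := (hd.hasSum_inner_frameOp f w).comp tendsto_insertNone_Icc
    have hb := (hasSum_inner_node hd.length_pos f w).comp tendsto_Icc_neg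
    refine (ha.sub hb).congr fun N => ?_
    simp only [Function.comp_apply, hY, Finset.sum_insertNone, inner_add_left, sum_inner,
      inner_sub_left, real_inner_smul_left]
    rw [Finset.sum_sub_distrib, add_sub_assoc]
    congr 1
    · ring
    · congr 1 <;> exact Finset.sum_congr rfl fun n _ => by ring
  have hYfun : ∀ N, Y N =ᵐ[volume.restrict (Ioo 0 T)]
      kernelFun (fun i x => rowPartial T lam al i N x) f := by
    intro N
    have hsum : ∀ (F : Finset ℤ) (g : ℤ → Space T) (r : ℤ → ℝ → ℂ),
        (∀ n, g n =ᵐ[volume.restrict (Ioo 0 T)] r n) →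
        (∑ n ∈ F, g n : Space T) =ᵐ[volume.restrict (Ioo 0 T)] fun x => ∑ n ∈ F, r n x := by
      intro F g r h
      filter_upwards [Lp.coeFn_finsetSum F g, ae_all_iff.2 h] with x h1 h2
      rw [h1, Finset.sum_apply]
      exact Finset.sum_congr rfl fun n _ => h2 n
    have hterm := hsum (Finset.Icc (-(N : ℤ)) N)
      (fun n => ((al (some n))⁻¹ * ⟪waveLp T (lam (some n)), f⟫_ℝ) • waveLp T (lam (some n)) -
        (T⁻¹ * ⟪waveLp T (node T n), f⟫_ℝ) • waveLp T (node T n))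
      (fun n x => ((al (some n))⁻¹ * ⟪waveLp T (lam (some n)), f⟫_ℝ) • wave (lam (some n)) x -
        (T⁻¹ * ⟪waveLp T (node T n), f⟫_ℝ) • wave (node T n) x) fun n => by
      filter_upwards [Lp.coeFn_sub
        (((al (some n))⁻¹ * ⟪waveLp T (lam (some n)), f⟫_ℝ) • waveLp T (lam (some n)))
        ((T⁻¹ * ⟪waveLp T (node T n), f⟫_ℝ) • waveLp T (node T n)), coeFn_smul_waveLp _ _,
        coeFn_smul_waveLp _ _] with x h1 h2 h3
      rw [h1, Pi.sub_apply, h2, h3]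
    filter_upwards [Lp.coeFn_add (((al none)⁻¹ * ⟪waveLp T (lam none), f⟫_ℝ) • waveLp T (lam none))
      (∑ n ∈ Finset.Icc (-(N : ℤ)) N, (((al (some n))⁻¹ * ⟪waveLp T (lam (some n)), f⟫_ℝ) •
        waveLp T (lam (some n)) - (T⁻¹ * ⟪waveLp T (node T n), f⟫_ℝ) • waveLp T (node T n))),
      hterm, coeFn_smul_waveLp _ _] with x h1 h2 h3
    simp only [hY]
    rw [h1, Pi.add_apply, h2, h3]
    apply Complex.ext
    all_goals
      simp only [kernelFun, rowPartial, rowTerm, inner_add_left, sum_inner, inner_sub_left,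
        real_inner_smul_left, wave_eq_trig, Complex.add_re, Complex.add_im, Complex.re_sum,
        Complex.im_sum, Complex.sub_re, Complex.sub_im, Complex.smul_re, Complex.smul_im,
        smul_eq_mul]
      congr 1
      · ring
      · exact Finset.sum_congr rfl fun n _ => by ring
  have h2 : Tendsto Y atTop (𝓝 (hd.kernelOp hG f)) := by
    have hη : ∀ η > 0, ∀ᶠ N in atTop, ‖Y N - hd.kernelOp hG f‖ ≤
        Real.sqrt T * ((η + η) * ‖f‖) := by
      intro η hη
      have hu := fun i => (Metric.tendstoUniformlyOn_iff.1 (hd.tendstoUniformlyOn_row hG i)) η hη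
      filter_upwards [hu 0, hu 1] with N h0 h1
      have hmem : MemLp (kernelFun (fun i x => rowPartial T lam al i N x) f) 2
          (volume.restrict (Ioo 0 T)) := (memLp_congr_ae (hYfun N)).1 (Lp.memLp _)
      have hYN : Y N = hmem.toLp _ :=
        Lp.ext ((hYfun N).trans hmem.coeFn_toLp.symm)
      rw [hYN, kernelOp, ← MemLp.toLp_sub]
      refine norm_toLp_le hd.length_pos.le _ (by positivity) fun x hx => ?_
      have hb : ∀ i, dist (G i x) (rowPartial T lam al i N x) < η →
          |⟪rowPartial T lam al i N x, f⟫_ℝ - ⟪G i x, f⟫_ℝ| ≤ η * ‖f‖ := by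
        intro i hi
        rw [← inner_sub_left]
        refine (abs_real_inner_le_norm _ _).trans (mul_le_mul_of_nonneg_right ?_ (norm_nonneg _))
        rw [← dist_eq_norm, dist_comm]; exact hi.le
      have h0' := hb 0 (h0 x (Ioo_subset_Icc_self hx))
      have h1' := hb 1 (h1 x (Ioo_subset_Icc_self hx))
      rw [add_mul]
      exact (norm_mk_le _ _).trans (add_le_add h0' h1')
    rw [tendsto_iff_norm_sub_tendsto_zero]
    rw [Metric.tendsto_atTop]
    intro δ hδ
    obtain ⟨η, hη0, hηδ⟩ : ∃ η > 0, Real.sqrt T * ((η + η) * ‖f‖) < δ := by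
      have h : Tendsto (fun η => Real.sqrt T * ((η + η) * ‖f‖)) (𝓝[>] 0)
          (𝓝 (Real.sqrt T * ((0 + 0) * ‖f‖))) :=
        (Continuous.tendsto (by fun_prop) 0).mono_left nhdsWithin_le_nhds
      rw [add_zero, zero_mul, mul_zero] at h
      obtain ⟨η, h1, h2⟩ := ((h.eventually (gt_mem_nhds hδ)).and self_mem_nhdsWithin).exists
      exact ⟨η, h2, h1⟩
    obtain ⟨N₀, hN₀⟩ := eventually_atTop.1 (hη η hη0)
    refine ⟨N₀, fun N hN => ?_⟩
    rw [dist_zero_right, norm_norm]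
    exact (hN₀ N hN).trans_lt hηδ
  have h3 := tendsto_nhds_unique h1 (h2.inner tendsto_const_nhds)
  linarith

end SpectralData

/-! ### The solutions `φ(s, λ_j)` and their Gram matrix -/

lemma hasDerivWithinAt_zero_of_norm_le {E : ℝ → ℝ} {s t C : ℝ} (hst : s < t) (h0 : E s = 0)
    (h : ∀ x ∈ Ioc s t, |E x| ≤ C * ((x - s) * Real.sqrt (x - s))) :
    HasDerivWithinAt E 0 (Ioi s) s := by
  rw [hasDerivWithinAt_iff_isLittleO]
  simp only [h0, sub_zero, smul_zero]
  have h1 : E =O[𝓝[>] s] fun x => (x - s) * Real.sqrt (x - s) := by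
    refine Asymptotics.IsBigO.of_bound C ?_
    filter_upwards [Ioc_mem_nhdsGT hst] with x hx
    have : 0 ≤ x - s := sub_nonneg.2 hx.1.le
    rw [Real.norm_eq_abs, Real.norm_eq_abs,
      abs_of_nonneg (mul_nonneg this (Real.sqrt_nonneg (x - s)))]
    exact h x hx
  refine h1.trans_isLittleO ?_
  have h2 : Tendsto (fun x => Real.sqrt (x - s)) (𝓝[>] s) (𝓝 0) := by
    have : Tendsto (fun x => Real.sqrt (x - s)) (𝓝 s) (𝓝 (Real.sqrt (s - s))) :=
      Continuous.tendsto (by fun_prop) s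
    rw [sub_self, Real.sqrt_zero] at this
    exact this.mono_left nhdsWithin_le_nhds
  have h3 := (Asymptotics.isBigO_refl (fun x => x - s) (𝓝[>] s)).mul_isLittleO
    ((Asymptotics.isLittleO_one_iff ℝ).2 h2)
  simpa using h3

namespace SpectralData
variable {T : ℝ} {lam al : Label → ℝ} {G : Fin 2 → ℝ → Space T}

lemma exists_truncInv (hd : SpectralData T lam al) (s : ℝ) (j : Label) :
    ∃ u ∈ supported T s, ∀ w ∈ supported T s,
      ⟪hd.frameOp u, w⟫_ℝ = ⟪waveLp T (lam j), w⟫_ℝ := by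
  obtain ⟨c, hc, h⟩ := hd.exists_coercive
  exact exists_solution_of_coercive hd.frameOp hc h _ (isClosed_supported s) _

/-- The preimage of `e(·, λ_j)` under the compression of the frame operator to `(0, s)`. -/
def truncInv (hd : SpectralData T lam al) (s : ℝ) (j : Label) : Space T :=
  (hd.exists_truncInv s j).choose

lemma truncInv_mem (hd : SpectralData T lam al) (s : ℝ) (j : Label) :
    hd.truncInv s j ∈ supported T s := (hd.exists_truncInv s j).choose_spec.1

lemma inner_frameOp_truncInv (hd : SpectralData T lam al) {s : ℝ} (j : Label) {w : Space T}
    (hw : w ∈ supported T s) :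
    ⟪hd.frameOp (hd.truncInv s j), w⟫_ℝ = ⟪waveLp T (lam j), w⟫_ℝ :=
  (hd.exists_truncInv s j).choose_spec.2 w hw

/-- A bound, uniform in the subspace, for the solution of a compressed equation. -/
lemma norm_le_of_inner_frameOp (hd : SpectralData T lam al) : ∃ C, 0 < C ∧
    ∀ u v : Space T, ⟪hd.frameOp u, u⟫_ℝ = ⟪v, u⟫_ℝ → ‖u‖ ≤ C * ‖v‖ := by
  obtain ⟨c, hc, h⟩ := hd.exists_coercive
  refine ⟨c⁻¹, inv_pos.2 hc, fun u v huv => ?_⟩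
  rcases eq_or_ne u 0 with rfl | hu
  · rw [norm_zero]; positivity
  have h1 := (h u).trans (huv.le.trans (real_inner_le_norm v u))
  rw [pow_two, ← mul_assoc] at h1
  rw [le_inv_mul_iff₀ hc]
  exact le_of_mul_le_mul_right h1 (norm_pos_iff.2 hu)

/-- The function `e(x, λ_j) - ∫ F₀(x, t) u(t) dt`, where `u` is the compressed inverse at `s`. -/
def residual (hd : SpectralData T lam al) (G : Fin 2 → ℝ → Space T) (s : ℝ) (j : Label)
    (x : ℝ) : ℂ :=
  wave (lam j) x - kernelFun G (hd.truncInv s j) x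

/-- The solution `φ(s, λ_j)` in complex notation, expressed through the compressed inverse. -/
def sol (hd : SpectralData T lam al) (G : Fin 2 → ℝ → Space T) (j : Label) (s : ℝ) : ℂ :=
  hd.residual G s j s

lemma continuousOn_residual (hd : SpectralData T lam al) (hG : IsRow T lam al G) (s : ℝ)
    (j : Label) : ContinuousOn (hd.residual G s j) (Icc 0 T) :=
  (continuous_wave_right _).continuousOn.sub (hd.continuousOn_kernelFun hG _)

lemma memLp_residual (hd : SpectralData T lam al) (hG : IsRow T lam al G) (s : ℝ)
    (j : Label) : MemLp (hd.residual G s j) 2 (volume.restrict (Ioo 0 T)) :=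
  memLp_of_continuousOn (hd.continuousOn_residual hG s j)

lemma exists_norm_residual_le (hd : SpectralData T lam al) (hG : IsRow T lam al G) :
    ∃ C, 0 ≤ C ∧ ∀ s j, ∀ x ∈ Icc 0 T, ‖hd.residual G s j x‖ ≤ C := by
  obtain ⟨B, hB0, hB⟩ := hd.exists_norm_row_le hG
  obtain ⟨c, hc, h⟩ := hd.norm_le_of_inner_frameOp
  refine ⟨1 + 2 * B * (c * Real.sqrt T), by positivity, fun s j x hx => ?_⟩
  refine (norm_sub_le _ _).trans (add_le_add (norm_wave _ _).le ?_)
  refine (norm_kernelFun_le (hB x hx) _).trans (mul_le_mul_of_nonneg_left ?_ (by positivity))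
  refine (h _ _ (hd.inner_frameOp_truncInv j (hd.truncInv_mem s j))).trans ?_
  exact mul_le_mul_of_nonneg_left (norm_waveLp_le hd.length_pos.le _) hc.le

/-- The residual restricted to `(s, s']`, as a vector. -/
def resBand (hd : SpectralData T lam al) (hG : IsRow T lam al G) (s s' : ℝ) (j : Label) :
    Space T :=
  restrLp T (Ioc s s') measurableSet_Ioc ((hd.memLp_residual hG s j).toLp _)

lemma toLp_residual (hd : SpectralData T lam al) (hG : IsRow T lam al G) (s : ℝ) (j : Label) :
    (hd.memLp_residual hG s j).toLp _ =
      waveLp T (lam j) - hd.kernelOp hG (hd.truncInv s j) := by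
  rw [waveLp, kernelOp, ← MemLp.toLp_sub]; rfl

lemma inner_resBand_kernelOp_le (hd : SpectralData T lam al) (hG : IsRow T lam al G) :
    ∃ C, 0 ≤ C ∧ ∀ s s', 0 ≤ s → s ≤ s' → s' ≤ T → ∀ j v,
      |⟪hd.resBand hG s s' j, hd.kernelOp hG v⟫_ℝ| ≤ C * (s' - s) * ‖v‖ := by
  obtain ⟨B, hB0, hB⟩ := hd.exists_norm_row_le hG
  obtain ⟨C, hC0, hC⟩ := hd.exists_norm_residual_le hG
  refine ⟨C * (2 * B), by positivity, fun s s' h0 hss' hs' j v => ?_⟩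
  rw [resBand, kernelOp, inner_restrLp_Ioc_toLp h0 hss' hs', ← Real.norm_eq_abs]
  refine (intervalIntegral.norm_integral_le_of_norm_le_const (C := C * (2 * B * ‖v‖))
    fun x hx => ?_).trans (le_of_eq ?_)
  · rw [uIoc_of_le hss'] at hx
    have hx' : x ∈ Icc 0 T := ⟨h0.trans hx.1.le, hx.2.trans hs'⟩
    refine (norm_inner_le_norm _ _).trans ?_
    exact mul_le_mul (hC s j x hx') (norm_kernelFun_le (hB x hx') v) (norm_nonneg _) hC0
  · rw [abs_of_nonneg (sub_nonneg.2 hss')]; ring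

lemma norm_resBand_le (hd : SpectralData T lam al) (hG : IsRow T lam al G) :
    ∃ C, 0 ≤ C ∧ ∀ s s', 0 ≤ s → s ≤ s' → s' ≤ T → ∀ j,
      ‖hd.resBand hG s s' j‖ ≤ C * Real.sqrt (s' - s) := by
  obtain ⟨C, hC0, hC⟩ := hd.exists_norm_residual_le hG
  refine ⟨C, hC0, fun s s' h0 hss' hs' j => ?_⟩
  have h1 : ‖hd.resBand hG s s' j‖ ^ 2 =
      ⟪hd.resBand hG s s' j, (hd.memLp_residual hG s j).toLp _⟫_ℝ := by
    rw [← real_inner_self_eq_norm_sq]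
    rw [resBand, ← inner_restrLp, restrLp_restrLp_self]
  have h2 : ‖hd.resBand hG s s' j‖ ^ 2 ≤ C * C * (s' - s) := by
    rw [h1, resBand, inner_restrLp_Ioc_toLp h0 hss' hs']
    refine (le_abs_self _).trans ?_
    rw [← Real.norm_eq_abs]
    refine (intervalIntegral.norm_integral_le_of_norm_le_const (C := C * C)
      fun x hx => ?_).trans (le_of_eq ?_)
    · rw [uIoc_of_le hss'] at hx
      have hx' : x ∈ Icc 0 T := ⟨h0.trans hx.1.le, hx.2.trans hs'⟩
      exact (norm_inner_le_norm _ _).trans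
        (mul_le_mul (hC s j x hx') (hC s j x hx') (norm_nonneg _) hC0)
    · rw [abs_of_nonneg (sub_nonneg.2 hss')]
  refine le_of_sq_le_sq ?_ (by positivity)
  rw [mul_pow, Real.sq_sqrt (sub_nonneg.2 hss')]
  linarith

/-- The increment of the compressed inverse solves the equation with the restricted residual as
right-hand side. -/
lemma inner_frameOp_increment (hd : SpectralData T lam al) (hG : IsRow T lam al G) {s s' : ℝ}
    (j : Label) {w : Space T} (hw : w ∈ supported T s') :
    ⟪hd.frameOp (hd.truncInv s' j - hd.truncInv s j), w⟫_ℝ = ⟪hd.resBand hG s s' j, w⟫_ℝ := by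
  set w₁ := restrLp T (Iic s) measurableSet_Iic w with hw₁
  set w₂ := restrLp T (Ioc s s') measurableSet_Ioc w with hw₂
  have hw12 : w = w₁ + w₂ := eq_restrLp_add hw
  have h1 : ⟪hd.frameOp (hd.truncInv s j), w₁⟫_ℝ = ⟪waveLp T (lam j), w₁⟫_ℝ :=
    hd.inner_frameOp_truncInv j (restrLp_Iic_mem_supported s w)
  -- the compressed inverse at `s` is orthogonal to functions living on `(s, s']`
  have h2 : ⟪hd.truncInv s j, w₂⟫_ℝ = 0 := by
    rw [hw₂, ← inner_restrLp]
    have : restrLp T (Ioc s s') measurableSet_Ioc (hd.truncInv s j) = 0 := by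
      rw [Lp.eq_zero_iff_ae_eq_zero]
      filter_upwards [mem_supported_iff.1 (hd.truncInv_mem s j),
        coeFn_restrLp (Ioc s s') measurableSet_Ioc (hd.truncInv s j)] with x h1 h2
      rw [h2]
      by_cases hx : x ∈ Ioc s s'
      · rw [indicator_of_mem hx, h1 hx.1]; rfl
      · rw [indicator_of_notMem hx]; rfl
    rw [this, inner_zero_left]
  have h3 : ⟪hd.resBand hG s s' j, w⟫_ℝ =
      ⟪waveLp T (lam j) - hd.kernelOp hG (hd.truncInv s j), w₂⟫_ℝ := by
    rw [resBand, inner_restrLp, toLp_residual]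
  have h4 := hd.frameOp_eq_add_kernelOp hG (hd.truncInv s j)
  rw [map_sub, inner_sub_left, hd.inner_frameOp_truncInv j hw, h3]
  have h5 : ⟪hd.frameOp (hd.truncInv s j), w⟫_ℝ = ⟪waveLp T (lam j), w₁⟫_ℝ +
      ⟪hd.kernelOp hG (hd.truncInv s j), w₂⟫_ℝ := by
    conv_lhs => rw [hw12]
    rw [inner_add_right, h1, h4, inner_add_left, h2, zero_add]
  rw [h5, inner_sub_left]
  conv_lhs => rw [hw12]
  rw [inner_add_right]; ring

lemma norm_truncInv_sub_le (hd : SpectralData T lam al) (hG : IsRow T lam al G) :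
    ∃ C, 0 ≤ C ∧ ∀ s s', 0 ≤ s → s ≤ s' → s' ≤ T → ∀ j,
      ‖hd.truncInv s' j - hd.truncInv s j‖ ≤ C * Real.sqrt (s' - s) := by
  obtain ⟨c, hc, h⟩ := hd.norm_le_of_inner_frameOp
  obtain ⟨C, hC0, hC⟩ := hd.norm_resBand_le hG
  refine ⟨c * C, by positivity, fun s s' h0 hss' hs' j => ?_⟩
  have hmem : hd.truncInv s' j - hd.truncInv s j ∈ supported T s' :=
    Submodule.sub_mem _ (hd.truncInv_mem s' j) (supported_mono hss' (hd.truncInv_mem s j))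
  rw [mul_assoc]
  exact (h _ _ (hd.inner_frameOp_increment hG j hmem)).trans
    (mul_le_mul_of_nonneg_left (hC s s' h0 hss' hs' j) hc.le)

lemma continuousOn_truncInv (hd : SpectralData T lam al) (hG : IsRow T lam al G) (j : Label) :
    ContinuousOn (fun s => hd.truncInv s j) (Icc 0 T) := by
  obtain ⟨C, hC0, hC⟩ := hd.norm_truncInv_sub_le hG
  have hle : ∀ s ∈ Icc 0 T, ∀ s' ∈ Icc 0 T,
      ‖hd.truncInv s' j - hd.truncInv s j‖ ≤ C * Real.sqrt |s' - s| := by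
    intro s hs s' hs'
    rcases le_total s s' with h | h
    · rw [abs_of_nonneg (sub_nonneg.2 h)]; exact hC s s' hs.1 h hs'.2 j
    · rw [abs_sub_comm, abs_of_nonneg (sub_nonneg.2 h), norm_sub_rev]
      exact hC s' s hs'.1 h hs.2 j
  intro s hs
  rw [ContinuousWithinAt, tendsto_iff_norm_sub_tendsto_zero]
  have h0 : Tendsto (fun s' => C * Real.sqrt |s' - s|) (𝓝[Icc 0 T] s) (𝓝 0) := by
    have : Tendsto (fun s' => C * Real.sqrt |s' - s|) (𝓝 s) (𝓝 (C * Real.sqrt |s - s|)) :=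
      Continuous.tendsto (by fun_prop) s
    rw [sub_self, abs_zero, Real.sqrt_zero, mul_zero] at this
    exact this.mono_left nhdsWithin_le_nhds
  refine squeeze_zero' (Eventually.of_forall fun _ => norm_nonneg _) ?_ h0
  filter_upwards [self_mem_nhdsWithin] with s' hs' using hle s hs s' hs'

lemma continuousOn_sol (hd : SpectralData T lam al) (hG : IsRow T lam al G) (j : Label) :
    ContinuousOn (hd.sol G j) (Icc 0 T) := by
  have h0 := (hd.continuousOn_row hG 0).inner (𝕜 := ℝ) (hd.continuousOn_truncInv hG j)
  have h1 := (hd.continuousOn_row hG 1).inner (𝕜 := ℝ) (hd.continuousOn_truncInv hG j)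
  refine (continuous_wave_right _).continuousOn.sub ?_
  simp only [kernelFun_eq]
  exact (Complex.continuous_ofReal.comp_continuousOn h0).add
    ((Complex.continuous_ofReal.comp_continuousOn h1).mul continuousOn_const)

/-- Increments of `⟨u_s, e(·, λ_k)⟩` for the compressed inverses `u_s`. -/
lemma inner_truncInv_sub (hd : SpectralData T lam al) (hG : IsRow T lam al G) {s s' : ℝ}
    (h0 : 0 ≤ s) (hss' : s ≤ s') (hs' : s' ≤ T) (j k : Label) :
    ⟪hd.truncInv s' j, waveLp T (lam k)⟫_ℝ - ⟪hd.truncInv s j, waveLp T (lam k)⟫_ℝ =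
      (∫ x in s..s', ⟪hd.residual G s j x, hd.residual G s k x⟫_ℝ) -
        ⟪hd.resBand hG s s' j, hd.kernelOp hG (hd.truncInv s' k - hd.truncInv s k)⟫_ℝ := by
  set vj := hd.truncInv s' j - hd.truncInv s j with hvj
  set vk := hd.truncInv s' k - hd.truncInv s k with hvk
  have hmono := supported_mono (T := T) hss'
  have hvjm : vj ∈ supported T s' :=
    Submodule.sub_mem _ (hd.truncInv_mem s' j) (hmono (hd.truncInv_mem s j))
  have hRj : hd.resBand hG s s' j ∈ supported T s' := restrLp_Ioc_mem_supported _ _ _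
  have hS := fun {w : Space T} (hw : w ∈ supported T s') =>
    hd.inner_frameOp_increment hG (s := s) k hw
  -- `⟨vⱼ, e_k⟩ = ⟨vⱼ, S u_{s'}^k⟩ = ⟨S vⱼ, u_s^k + v_k⟩`
  have h1 : ⟪vj, waveLp T (lam k)⟫_ℝ = ⟪hd.resBand hG s s' j, vk⟫_ℝ := by
    rw [real_inner_comm, ← hd.inner_frameOp_truncInv k hvjm,
      hd.inner_frameOp_comm, real_inner_comm, hd.inner_frameOp_increment hG j
        (hd.truncInv_mem s' k)]
    have h2 : hd.truncInv s' k = hd.truncInv s k + vk := by rw [hvk]; abel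
    rw [h2, inner_add_right]
    have h3 : ⟪hd.resBand hG s s' j, hd.truncInv s k⟫_ℝ = 0 := by
      rw [← hd.inner_frameOp_increment hG j (hmono (hd.truncInv_mem s k)), map_sub,
        inner_sub_left, hd.inner_frameOp_truncInv j (hmono (hd.truncInv_mem s k)),
        hd.inner_frameOp_truncInv j (hd.truncInv_mem s k), sub_self]
    rw [h3, zero_add]
  have h4 : ⟪hd.resBand hG s s' j, hd.resBand hG s s' k⟫_ℝ =
      ⟪hd.resBand hG s s' j, vk⟫_ℝ + ⟪hd.resBand hG s s' j, hd.kernelOp hG vk⟫_ℝ := by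
    rw [real_inner_comm, ← hS hRj, ← inner_add_right, ← hd.frameOp_eq_add_kernelOp hG vk,
      real_inner_comm]
  have h5 : ⟪hd.resBand hG s s' j, hd.resBand hG s s' k⟫_ℝ =
      ∫ x in s..s', ⟪hd.residual G s j x, hd.residual G s k x⟫_ℝ := by
    rw [resBand, resBand, ← inner_restrLp, restrLp_restrLp_self,
      inner_restrLp_Ioc_toLp h0 hss' hs']
  rw [← inner_sub_left, ← hvj, h1, ← h5, h4]; ring

/-- The increments of the compressed inverse are of order `√(s' - s)`, so the second term in their
formula is of order `(s' - s) √(s' - s)` and does not contribute to the derivative. -/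
lemma hasDerivWithinAt_inner_truncInv (hd : SpectralData T lam al) (hG : IsRow T lam al G)
    (j k : Label) {s : ℝ} (hs : s ∈ Ioo 0 T) :
    HasDerivWithinAt (fun s => ⟪hd.truncInv s j, waveLp T (lam k)⟫_ℝ)
      ⟪hd.sol G j s, hd.sol G k s⟫_ℝ (Ioi s) s := by
  obtain ⟨C, hC0, hC⟩ := hd.inner_resBand_kernelOp_le hG
  obtain ⟨D, hD0, hD⟩ := hd.norm_truncInv_sub_le hG
  have hcont : ContinuousOn (fun x => ⟪hd.residual G s j x, hd.residual G s k x⟫_ℝ) (Icc 0 T) :=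
    (hd.continuousOn_residual hG s j).inner (hd.continuousOn_residual hG s k)
  have hnhds : Icc 0 T ∈ 𝓝 s := Icc_mem_nhds hs.1 hs.2
  have h1 : HasDerivWithinAt (fun s' => ∫ x in s..s', ⟪hd.residual G s j x, hd.residual G s k x⟫_ℝ)
      ⟪hd.sol G j s, hd.sol G k s⟫_ℝ (Ioi s) s :=
    (intervalIntegral.integral_hasDerivAt_right (by simp)
      (hcont.stronglyMeasurableAtFilter_nhdsWithin measurableSet_Icc s |>.filter_mono
        (by rw [nhdsWithin_eq_nhds.2 hnhds]))
      (hcont.continuousAt hnhds)).hasDerivWithinAt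
  set E : ℝ → ℝ := fun s' =>
    if s < s' then ⟪hd.resBand hG s s' j, hd.kernelOp hG (hd.truncInv s' k - hd.truncInv s k)⟫_ℝ
    else 0 with hE
  have h2 : HasDerivWithinAt E 0 (Ioi s) s := by
    refine hasDerivWithinAt_zero_of_norm_le hs.2 (C := C * D) (by simp [hE]) fun x hx => ?_
    simp only [hE, if_pos hx.1]
    refine (hC s x hs.1.le hx.1.le hx.2 j _).trans ?_
    have h3 := hD s x hs.1.le hx.1.le hx.2 k
    have h4 : 0 ≤ C * (x - s) := mul_nonneg hC0 (sub_nonneg.2 hx.1.le)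
    calc _ ≤ C * (x - s) * (D * Real.sqrt (x - s)) := mul_le_mul_of_nonneg_left h3 h4
      _ = _ := by ring
  have h3 := (h1.sub h2).const_add ⟪hd.truncInv s j, waveLp T (lam k)⟫_ℝ
  rw [sub_zero] at h3
  refine h3.congr_of_eventuallyEq ?_ ?_
  · filter_upwards [Ioc_mem_nhdsGT hs.2] with x hx
    have := hd.inner_truncInv_sub hG hs.1.le hx.1.le hx.2 j k
    simp only [Pi.sub_apply, hE, if_pos hx.1]
    rw [← this]; ring
  · simp [hE]

lemma inner_truncInv_right (hd : SpectralData T lam al) (j k : Label) :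
    ⟪hd.truncInv T j, waveLp T (lam k)⟫_ℝ = ⟪waveLp T (lam k), hd.frameInv j⟫_ℝ := by
  have h : hd.frameOp (hd.truncInv T j) = waveLp T (lam j) :=
    ext_inner_right ℝ fun w => hd.inner_frameOp_truncInv j (by rw [supported_right]; trivial)
  rw [← hd.frameOp_frameInv k, ← hd.inner_frameOp_comm, h, hd.frameOp_frameInv,
    hd.inner_frameInv_comm]

/-- The Gram matrix of the solutions `φ(s, λ_j)`: the kernel of the inverse of the compressed frame
operator is differentiated with respect to the length of the interval. -/
lemma integral_inner_sol (hd : SpectralData T lam al) (hG : IsRow T lam al G) (j k : Label) :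
    ∫ s in (0 : ℝ)..T, ⟪hd.sol G j s, hd.sol G k s⟫_ℝ = ⟪waveLp T (lam k), hd.frameInv j⟫_ℝ := by
  have hT := hd.length_pos.le
  have hcont : ContinuousOn (fun s => ⟪hd.sol G j s, hd.sol G k s⟫_ℝ) (Icc 0 T) :=
    (hd.continuousOn_sol hG j).inner (hd.continuousOn_sol hG k)
  rw [intervalIntegral.integral_eq_sub_of_hasDeriv_right_of_le hT
    (f := fun s => ⟪hd.truncInv s j, waveLp T (lam k)⟫_ℝ)
    ((hd.continuousOn_truncInv hG j).inner continuousOn_const)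
    (fun s hs => hd.hasDerivWithinAt_inner_truncInv hG j k hs)
    (hcont.intervalIntegrable_of_Icc hT), inner_truncInv_right,
    eq_zero_of_mem_supported_zero (hd.truncInv_mem 0 j), inner_zero_left, sub_zero]

/-- If `b₀`, `b₁` are the rows of the transformation kernel at `s`, then `e(s, λ) + ∫ b e(·, λ)`
is the solution `φ(s, λ)`. -/
lemma inner_row_eq (hd : SpectralData T lam al) {s : ℝ} {b g : Space T} (hb : b ∈ supported T s)
    (h : ∀ w ∈ supported T s, ⟪hd.frameOp b, w⟫_ℝ = -⟪g, w⟫_ℝ) (j : Label) :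
    ⟪waveLp T (lam j), b⟫_ℝ = -⟪g, hd.truncInv s j⟫_ℝ := by
  rw [← hd.inner_frameOp_truncInv j hb, hd.inner_frameOp_comm, real_inner_comm,
    h _ (hd.truncInv_mem s j)]

end SpectralData

/-! ### The characteristic function -/

lemma lam0_eq_node (a α : ℝ) (n : ℤ) : lam0 a α n = node (mu a α Real.pi) n := rfl

lemma IsData.spectralData {a α : ℝ} {lam al : Label → ℝ} (h : IsData a α lam al)
    (hT : 0 < mu a α Real.pi) : SpectralData (mu a α Real.pi) lam al where
  length_pos := hT
  injective := h.injective
  pos := h.pos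
  lam_asymp := h.lam_asymp
  al_asymp := h.al_asymp

lemma charDelta_lam (a α : ℝ) (lam : Label → ℝ) (j : Label) : charDelta a α lam (lam j) = 0 := by
  have htprod : ∀ n : ℤ, (∃ k : ℕ, n = k + 1 ∨ n = -(k + 1)) →
      charDelta a α lam (lam (some n)) = 0 := by
    rintro n ⟨k, hk⟩
    rw [charDelta, tprod_of_exists_eq_zero, mul_zero]
    refine ⟨k, ?_⟩
    rcases hk with rfl | rfl <;> simp
  rcases j with _ | n
  · simp [charDelta]
  · rcases lt_trichotomy n 0 with h | rfl | h
    · exact htprod n ⟨(-n - 1).toNat, by omega⟩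
    · simp [charDelta]
    · exact htprod n ⟨(n - 1).toNat, by omega⟩

lemma eventually_sin_mul_ne_zero {T : ℝ} (hT : T ≠ 0) (x : ℝ) :
    ∀ᶠ l in 𝓝[≠] x, Real.sin (l * T) ≠ 0 := by
  by_cases h : Real.sin (x * T) = 0
  · have hd : HasDerivAt (fun l => Real.sin (l * T)) (Real.cos (x * T) * T) x := by
      simpa using ((hasDerivAt_id x).mul_const T).sin
    refine hd.eventually_ne (mul_ne_zero (fun hc => ?_) hT)
    have := Real.sin_sq_add_cos_sq (x * T)
    rw [h, hc] at this; norm_num at this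
  · exact ((by fun_prop : Continuous fun l => Real.sin (l * T)).continuousAt.eventually_ne
      h).filter_mono nhdsWithin_le_nhds

namespace SpectralData
variable {a α : ℝ} {lam al : Label → ℝ}

/-- `Δ(λ) = (λ - λ_{-0}) Φ(λ)` with the generating function `Φ`. The points `nπ/μ(π)` are excluded
because the product formula for `Φ` is not available there. -/
lemma charDelta_eq (hd : SpectralData (mu a α Real.pi) lam al) {l : ℝ}
    (hl : Real.sin (l * mu a α Real.pi) ≠ 0) :
    charDelta a α lam l = (l - lam none) * hd.genFun l := by
  by_cases h : ∃ n : ℤ, l = lam (some n)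
  · obtain ⟨n, rfl⟩ := h
    rw [charDelta_lam, genFun_some, mul_zero]
  · push Not at h
    have h1 := generating_eq_tprod (lam := fun n => lam (some n)) hd.length_pos hd.lam_asymp h
      (fun n hn => hl (by rw [hn, sin_node hd.length_pos])) (hd.tendsto_genFun h)
    rw [← h1, charDelta]
    simp only [lam0_eq_node]
    ring

lemma hasDerivAt_charDelta (hd : SpectralData (mu a α Real.pi) lam al) (j : Label) :
    HasDerivAt (charDelta a α lam) (hd.derivCoeff j) (lam j) := by
  refine (hd.hasDerivAt_genFun j).congr_of_eventuallyEq ?_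
  have h0 : (lam j - lam none) * hd.genFun (lam j) = 0 := by
    rcases j with _ | n
    · rw [sub_self, zero_mul]
    · rw [genFun_some, mul_zero]
  have h := eventually_nhdsWithin_iff.1 (eventually_sin_mul_ne_zero hd.length_pos.ne' (lam j))
  filter_upwards [h] with l hl
  rcases eq_or_ne l (lam j) with rfl | hne
  · rw [charDelta_lam, h0]
  · exact hd.charDelta_eq (hl hne)

lemma beta_eq (hd : SpectralData (mu a α Real.pi) lam al) (j : Label) :
    beta a α lam al j = hd.derivCoeff j / al j := by
  rw [beta, (hd.hasDerivAt_charDelta j).deriv]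

end SpectralData

/-! ### The change of variables `s = μ(x)` -/

section
variable {a α : ℝ}

/-- The inverse function of `μ`. -/
def muInv (a α τ : ℝ) : ℝ := if τ ≤ a then τ else (τ - a) / α + a

lemma mu_of_le {x : ℝ} (h : x ≤ a) : mu a α x = x := if_pos h

lemma mu_of_gt {x : ℝ} (h : a ≤ x) : mu a α x = a + α * (x - a) := by
  rcases h.eq_or_lt with rfl | h
  · rw [mu_of_le le_rfl]; ring
  · rw [mu, if_neg (not_le.2 h)]; ring

lemma strictMono_mu (hα : 0 < α) : StrictMono (mu a α) := by
  intro x y h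
  rcases le_or_gt y a with hy | hy
  · rwa [mu_of_le hy, mu_of_le (h.le.trans hy)]
  · rw [mu_of_gt hy.le]
    rcases le_or_gt x a with hx | hx
    · rw [mu_of_le hx]
      have := mul_pos hα (sub_pos.2 hy)
      linarith
    · rw [mu_of_gt hx.le]
      have := mul_lt_mul_of_pos_left (sub_lt_sub_right h a) hα
      linarith

lemma mu_muInv (hα : 0 < α) (τ : ℝ) : mu a α (muInv a α τ) = τ := by
  by_cases h : τ ≤ a
  · rw [muInv, if_pos h, mu_of_le h]
  · rw [muInv, if_neg h, mu_of_gt]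
    · field_simp; ring
    · have := div_pos (sub_pos.2 (not_le.1 h)) hα
      linarith

lemma muInv_mu (hα : 0 < α) (x : ℝ) : muInv a α (mu a α x) = x :=
  (strictMono_mu hα).injective (mu_muInv hα _)

lemma measurable_muInv : Measurable (muInv a α) :=
  Measurable.ite measurableSet_Iic measurable_id (by fun_prop)

lemma measurable_mu : Measurable (mu a α) :=
  Measurable.ite measurableSet_Iic measurable_id (by fun_prop)

/-- The change of variables `s = μ(x)`. -/
def muEquiv (hα : 0 < α) : ℝ ≃ᵐ ℝ where
  toFun := mu a α
  invFun := muInv a α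
  left_inv := muInv_mu hα
  right_inv := mu_muInv hα
  measurable_toFun := measurable_mu
  measurable_invFun := measurable_muInv

lemma mu_zero (ha : 0 < a) : mu a α 0 = 0 := mu_of_le ha.le

lemma muInv_mem_Ioo (ha : 0 < a) (hα : 0 < α) {x τ : ℝ} :
    muInv a α τ ∈ Ioo 0 x ↔ τ ∈ Ioo 0 (mu a α x) := by
  have h := fun {x y : ℝ} => (strictMono_mu hα (a := a)).lt_iff_lt (a := x) (b := y)
  rw [mem_Ioo, mem_Ioo, ← h (x := 0), ← h (y := x), mu_muInv hα, mu_zero ha]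

lemma measurable_rho : Measurable (rho a α) :=
  Measurable.ite measurableSet_Iic measurable_const measurable_const

lemma rho_pos (hα : 0 < α) (x : ℝ) : 0 < rho a α x := by
  unfold rho; split_ifs <;> simp [hα]

lemma rho_le (x : ℝ) : rho a α x ≤ max 1 α := by
  unfold rho; split_ifs <;> simp

lemma hasDerivAt_mu {x : ℝ} (hx : x ≠ a) : HasDerivAt (mu a α) (rho a α x) x := by
  rcases hx.lt_or_gt with h | h
  · rw [rho, if_pos h.le]
    refine (hasDerivAt_id x).congr_of_eventuallyEq ?_
    filter_upwards [Iio_mem_nhds h] with y hy using mu_of_le (le_of_lt hy)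
  · rw [rho, if_neg (not_le.2 h)]
    have h1 : HasDerivAt (fun y => a + α * (y - a)) α x := by
      simpa using (((hasDerivAt_id x).sub_const a).const_mul α).const_add a
    refine h1.congr_of_eventuallyEq ?_
    filter_upwards [Ioi_mem_nhds h] with y hy using mu_of_gt (le_of_lt hy)

/-- The measure `ρ(x) dx` is carried by `μ` to Lebesgue measure. -/
lemma map_muInv (ha : 0 < a) (hα : 0 < α) (L : ℝ) :
    Measure.map (muInv a α) (volume.restrict (Ioo 0 (mu a α L))) =
      (volume.restrict (Ioo 0 L)).withDensity fun x => ENNReal.ofReal (rho a α x) := by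
  refine Measure.ext fun E hE => ?_
  rw [Measure.map_apply measurable_muInv hE, Measure.restrict_apply (measurable_muInv hE),
    withDensity_apply _ hE, Measure.restrict_restrict hE]
  have hM : MeasurableSet ((E ∩ Ioo 0 L) \ {a}) :=
    (hE.inter measurableSet_Ioo).diff (measurableSet_singleton a)
  have himage : (muInv a α ⁻¹' E ∩ Ioo 0 (mu a α L)) \ {a} = mu a α '' ((E ∩ Ioo 0 L) \ {a}) := by
    ext τ
    constructor
    · rintro ⟨⟨h1, h2⟩, h3⟩
      refine ⟨muInv a α τ, ⟨⟨h1, (muInv_mem_Ioo ha hα).2 h2⟩, fun h => h3 ?_⟩, mu_muInv hα τ⟩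
      rw [← mu_muInv (a := a) hα τ, mem_singleton_iff.1 h, mu_of_le le_rfl]; rfl
    · rintro ⟨x, ⟨⟨h1, h2⟩, h3⟩, rfl⟩
      refine ⟨⟨?_, ?_⟩, fun h => h3 ?_⟩
      · rwa [mem_preimage, muInv_mu hα]
      · rwa [← muInv_mem_Ioo ha hα, muInv_mu hα]
      · refine (strictMono_mu (a := a) hα).injective ?_
        rw [mem_singleton_iff.1 h, mu_of_le le_rfl]
  have h1 := lintegral_image_eq_lintegral_abs_deriv_mul hM
    (fun x hx => (hasDerivAt_mu (α := α) hx.2).hasDerivWithinAt)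
    (strictMono_mu hα).injective.injOn 1
  rw [← himage] at h1
  simp only [Pi.one_apply, lintegral_const, one_mul, mul_one, Measure.restrict_apply_univ,
    abs_of_pos (rho_pos hα _)] at h1
  rw [measure_sdiff_null Real.volume_singleton] at h1
  rw [h1]
  exact setLIntegral_congr (sdiff_null_ae_eq_self Real.volume_singleton)

lemma map_muInv_le (ha : 0 < a) (hα : 0 < α) (L : ℝ) :
    Measure.map (muInv a α) (volume.restrict (Ioo 0 (mu a α L))) ≤
      ENNReal.ofReal (max 1 α) • volume.restrict (Ioo 0 L) := by
  rw [map_muInv ha hα, ← withDensity_const]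
  exact withDensity_mono (ae_of_all _ fun x => ENNReal.ofReal_le_ofReal (rho_le x))

lemma quasiMeasurePreserving_muInv (ha : 0 < a) (hα : 0 < α) (L : ℝ) :
    Measure.QuasiMeasurePreserving (muInv a α) (volume.restrict (Ioo 0 (mu a α L)))
      (volume.restrict (Ioo 0 L)) :=
  ⟨measurable_muInv, (Measure.absolutelyContinuous_of_le (map_muInv_le ha hα L)).trans
    Measure.smul_absolutelyContinuous⟩

lemma memLp_comp_muInv (ha : 0 < a) (hα : 0 < α) {L : ℝ} {f : ℝ → ℝ}
    (hf : MemLp f 2 (volume.restrict (Ioo 0 L))) :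
    MemLp (fun τ => f (muInv a α τ)) 2 (volume.restrict (Ioo 0 (mu a α L))) :=
  (hf.of_measure_le_smul ENNReal.ofReal_ne_top (map_muInv_le ha hα L)).comp_of_map
    measurable_muInv.aemeasurable

lemma tendsto_eLpNorm_comp_muInv (ha : 0 < a) (hα : 0 < α) {L : ℝ} {f : ℕ → ℝ → ℝ}
    (hf : ∀ N, AEStronglyMeasurable (f N) (volume.restrict (Ioo 0 L)))
    (h : Tendsto (fun N => eLpNorm (f N) 2 (volume.restrict (Ioo 0 L))) atTop (𝓝 0)) :
    Tendsto (fun N => eLpNorm (fun τ => f N (muInv a α τ)) 2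
      (volume.restrict (Ioo 0 (mu a α L)))) atTop (𝓝 0) := by
  set c := ENNReal.ofReal (max 1 α) ^ (1 / (2 : ENNReal)).toReal with hc
  have hct : c ≠ ⊤ := ENNReal.rpow_ne_top_of_nonneg ENNReal.toReal_nonneg ENNReal.ofReal_ne_top
  have h1 := ENNReal.Tendsto.const_mul (a := c) h (Or.inr hct)
  rw [mul_zero] at h1
  refine tendsto_of_tendsto_of_tendsto_of_le_of_le tendsto_const_nhds h1 (fun _ => zero_le)
    fun N => ?_
  have h2 := eLpNorm_map_measure (p := 2)
    ((hf N).mono_ac (quasiMeasurePreserving_muInv ha hα L).absolutelyContinuous)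
    (measurable_muInv (a := a) (α := α)).aemeasurable
  rw [Function.comp_def] at h2
  rw [← h2]
  refine (eLpNorm_mono_measure _ (map_muInv_le ha hα L)).trans ?_
  rw [eLpNorm_smul_measure_of_ne_top ENNReal.ofNat_ne_top, smul_eq_mul]

lemma integrable_comp_mu_mul_rho (ha : 0 < a) (hα : 0 < α) {L : ℝ} {f : ℝ → ℝ}
    (hf : Integrable f (volume.restrict (Ioo 0 (mu a α L)))) :
    Integrable (fun x => f (mu a α x) * rho a α x) (volume.restrict (Ioo 0 L)) ∧
      ∫ x in Ioo 0 L, f (mu a α x) * rho a α x = ∫ s in Ioo 0 (mu a α L), f s := by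
  have he : MeasurableEmbedding (muInv a α) := (muEquiv hα).symm.measurableEmbedding
  have h1 : Integrable (fun x => f (mu a α x))
      (Measure.map (muInv a α) (volume.restrict (Ioo 0 (mu a α L)))) := by
    rw [he.integrable_map_iff, Function.comp_def]
    simpa only [mu_muInv hα] using hf
  have h2 : ∫ x, f (mu a α x) ∂(Measure.map (muInv a α) (volume.restrict (Ioo 0 (mu a α L)))) =
      ∫ s in Ioo 0 (mu a α L), f s := by
    rw [he.integral_map]
    simp only [mu_muInv hα]
  have hm : Measurable fun x => ENNReal.ofReal (rho a α x) := measurable_rho.ennreal_ofReal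
  have htop : ∀ᵐ x ∂(volume.restrict (Ioo 0 L)), ENNReal.ofReal (rho a α x) < ⊤ :=
    ae_of_all _ fun _ => ENNReal.ofReal_lt_top
  rw [map_muInv ha hα] at h1 h2
  rw [integrable_withDensity_iff_integrable_smul' hm htop] at h1
  rw [integral_withDensity_eq_integral_toReal_smul hm htop] at h2
  simp only [ENNReal.toReal_ofReal (rho_pos hα _).le, smul_eq_mul, mul_comm (rho a α _)] at h1 h2
  exact ⟨h1, h2⟩

end

/-! ### The main equation as an equation for the frame operator -/

/-- The components of a vector written as a complex number. -/
def coord (z : ℂ) : Fin 2 → ℝ := ![z.re, z.im]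

/-- The vector with given components, as a complex number. -/
def ofCoord (v : Fin 2 → ℝ) : ℂ := ⟨v 0, v 1⟩

lemma coord_ofCoord (v : Fin 2 → ℝ) : coord (ofCoord v) = v := by
  ext i; fin_cases i <;> rfl

lemma inner_eq_sum_coord (z w : ℂ) : ⟪z, w⟫_ℝ = ∑ k, coord z k * coord w k := by
  rw [Complex.inner, Fin.sum_univ_two]
  simp [coord, mul_comm]

lemma sum_coord_sq (z : ℂ) : ∑ k, coord z k ^ 2 = ‖z‖ ^ 2 := by
  rw [← real_inner_self_eq_norm_sq, inner_eq_sum_coord]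
  simp only [pow_two]

lemma ofCoord_eq (v : Fin 2 → ℝ) : ofCoord v = (v 0 : ℂ) + (v 1 : ℂ) * Complex.I :=
  Complex.mk_eq_add_mul_I _ _

section
variable {X : Type*} [MeasurableSpace X] {ν : Measure X}

lemma memLp_ofCoord {v : X → Fin 2 → ℝ} (h : ∀ k, MemLp (fun x => v x k) 2 ν) :
    MemLp (fun x => ofCoord (v x)) 2 ν := by
  simp only [ofCoord_eq]
  exact (MemLp.ofReal (K := ℂ) (h 0)).add ((MemLp.ofReal (K := ℂ) (h 1)).mul_const Complex.I)

lemma memLp_coord {f : X → ℂ} (h : MemLp f 2 ν) (k : Fin 2) :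
    MemLp (fun x => coord (f x) k) 2 ν := by
  fin_cases k
  · exact h.re
  · exact h.im

lemma tendsto_Lp_of_coord {f : ℕ → Lp ℂ 2 ν} {g : Lp ℂ 2 ν} {u : ℕ → X → Fin 2 → ℝ}
    {v : X → Fin 2 → ℝ} (hf : ∀ N, f N =ᵐ[ν] fun x => ofCoord (u N x))
    (hg : g =ᵐ[ν] fun x => ofCoord (v x))
    (hm : ∀ N k, AEStronglyMeasurable (fun x => u N x k - v x k) ν)
    (h : ∀ k, Tendsto (fun N => eLpNorm (fun x => u N x k - v x k) 2 ν) atTop (𝓝 0)) :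
    Tendsto f atTop (𝓝 g) := by
  rw [Lp.tendsto_Lp_iff_tendsto_eLpNorm']
  have h2 := (h 0).add (h 1)
  rw [add_zero] at h2
  refine tendsto_of_tendsto_of_tendsto_of_le_of_le tendsto_const_nhds h2 (fun _ => zero_le)
    fun N => ?_
  have h4 : (f N - g : X → ℂ) =ᵐ[ν] (fun x => ((u N x 0 - v x 0 : ℝ) : ℂ)) +
      fun x => ((u N x 1 - v x 1 : ℝ) : ℂ) * Complex.I := by
    filter_upwards [hf N, hg] with x h5 h6
    rw [Pi.sub_apply, h5, h6, ofCoord_eq, ofCoord_eq, Pi.add_apply]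
    push_cast; ring
  rw [eLpNorm_congr_ae h4]
  have h5 : ∀ k, AEStronglyMeasurable (fun x => ((u N x k - v x k : ℝ) : ℂ)) ν := fun k =>
    Complex.continuous_ofReal.comp_aestronglyMeasurable (hm N k)
  refine (eLpNorm_add_le (h5 0) ((h5 1).mul_const Complex.I) one_le_two).trans
    (add_le_add (le_of_eq ?_) (le_of_eq ?_))
  · exact eLpNorm_congr_norm_ae (ae_of_all _ fun x => Complex.norm_real _)
  · exact eLpNorm_congr_norm_ae (ae_of_all _ fun x => by
      rw [norm_mul, Complex.norm_I, mul_one, Complex.norm_real])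

variable {Y : Type*} [MeasurableSpace Y] {κ : Measure Y}

/-- A kernel whose sections are uniformly square integrable, multiplied by `b(ξ) w(τ)`, is
integrable. -/
lemma integrable_mul_kernel_mul [SFinite ν] [SFinite κ] {P : X → Y → ℝ} {b : X → ℝ} {w : Y → ℝ}
    {C : ℝ}
    (hP : AEStronglyMeasurable (fun p : X × Y => P p.1 p.2) (ν.prod κ))
    (hP2 : ∀ᵐ ξ ∂ν, MemLp (P ξ) 2 κ) (hC : ∀ᵐ ξ ∂ν, ∫ τ, P ξ τ ^ 2 ∂κ ≤ C)
    (hb : Integrable b ν) (hw : MemLp w 2 κ) :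
    Integrable (fun p : X × Y => b p.1 * P p.1 p.2 * w p.2) (ν.prod κ) := by
  have hm : AEStronglyMeasurable (fun p : X × Y => b p.1 * P p.1 p.2 * w p.2) (ν.prod κ) :=
    (hb.aestronglyMeasurable.comp_fst.mul hP).mul hw.aestronglyMeasurable.comp_snd
  have hint : ∀ᵐ ξ ∂ν, Integrable (fun τ => P ξ τ * w τ) κ := by
    filter_upwards [hP2] with ξ h using h.integrable_mul hw
  refine (integrable_prod_iff hm).2 ⟨?_, ?_⟩
  · filter_upwards [hint] with ξ h
    simpa only [mul_assoc] using h.const_mul (b ξ)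
  · refine (hb.norm.mul_const (C + ∫ τ, w τ ^ 2 ∂κ)).mono' hm.norm.integral_prod_right' ?_
    filter_upwards [hint, hP2, hC] with ξ h h2 h3
    simp only [mul_assoc, norm_mul (b ξ)]
    rw [integral_const_mul, norm_mul, norm_norm]
    refine mul_le_mul_of_nonneg_left ?_ (norm_nonneg _)
    rw [Real.norm_of_nonneg (integral_nonneg fun _ => norm_nonneg _)]
    have h4 : ∫ τ, ‖P ξ τ * w τ‖ ∂κ ≤ ∫ τ, (P ξ τ ^ 2 + w τ ^ 2) ∂κ := by
      refine integral_mono h.norm (h2.integrable_sq.add hw.integrable_sq) fun τ => ?_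
      simp only [Real.norm_eq_abs, abs_mul]
      nlinarith [sq_nonneg (|P ξ τ| - |w τ|), sq_abs (P ξ τ), sq_abs (w τ), abs_nonneg (P ξ τ),
        abs_nonneg (w τ)]
    rw [integral_add h2.integrable_sq hw.integrable_sq] at h4
    linarith
end

namespace SpectralData
variable {T : ℝ} {lam al : Label → ℝ} {G : Fin 2 → ℝ → Space T}

/-- The main equation of the inverse problem at `s` says that the row `b` of the transformation
kernel solves `S b = -F₀(s, ·)` for the compression of the frame operator `S` to `(0, s)`. -/
lemma inner_frameOp_row (hd : SpectralData T lam al) (hG : IsRow T lam al G)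
    {P : ℝ → ℝ → Fin 2 → Fin 2 → ℝ}
    (hPm : ∀ i k, AEStronglyMeasurable (fun p : ℝ × ℝ => P p.1 p.2 i k)
      ((volume.restrict (Ioo 0 T)).prod (volume.restrict (Ioo 0 T))))
    (hP : ∀ ξ ∈ Icc 0 T, ∀ i, G i ξ =ᵐ[volume.restrict (Ioo 0 T)] fun τ => ofCoord (P ξ τ i))
    {s : ℝ} (hs : s ∈ Icc 0 T) {b : Space T} {i : Fin 2}
    (heq : ∀ᵐ τ ∂(volume.restrict (Ioo 0 T)), τ < s → ∀ k,
      coord (b τ) k + P s τ i k +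
        ∫ ξ in Ioo 0 T, ∑ j, coord (b ξ) j * P ξ τ j k = 0) {w : Space T}
    (hw : w ∈ supported T s) : ⟪hd.frameOp b, w⟫_ℝ = -⟪G i s, w⟫_ℝ := by
  set ν := volume.restrict (Ioo 0 T) with hν
  obtain ⟨C, hC0, hC⟩ := hd.exists_norm_row_le hG
  have hIoo : ∀ᵐ ξ ∂ν, ξ ∈ Icc 0 T := by
    filter_upwards [ae_restrict_mem measurableSet_Ioo] with ξ hξ using Ioo_subset_Icc_self hξ
  have hcoord : ∀ ξ ∈ Icc 0 T, ∀ j k, (fun τ => coord (G j ξ τ) k) =ᵐ[ν] fun τ => P ξ τ j k := by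
    intro ξ hξ j k
    filter_upwards [hP ξ hξ j] with τ h
    rw [h, coord_ofCoord]
  have hP2 : ∀ j k, ∀ᵐ ξ ∂ν, MemLp (fun τ => P ξ τ j k) 2 ν := fun j k => by
    filter_upwards [hIoo] with ξ hξ
    exact (memLp_congr_ae (hcoord ξ hξ j k)).1 (memLp_coord (Lp.memLp (G j ξ)) k)
  have hPC : ∀ j k, ∀ᵐ ξ ∂ν, ∫ τ, P ξ τ j k ^ 2 ∂ν ≤ C ^ 2 := fun j k => by
    filter_upwards [hIoo] with ξ hξ
    have h1 : ∫ τ, P ξ τ j k ^ 2 ∂ν = ∫ τ, coord (G j ξ τ) k ^ 2 ∂ν := by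
      refine integral_congr_ae ?_
      filter_upwards [hcoord ξ hξ j k] with τ h
      rw [← h]
    have h2 : ∫ τ, ‖G j ξ τ‖ ^ 2 ∂ν = ‖G j ξ‖ ^ 2 := by
      rw [← real_inner_self_eq_norm_sq, L2.inner_def]
      simp only [real_inner_self_eq_norm_sq]; rfl
    rw [h1]
    refine (integral_mono (memLp_coord (Lp.memLp (G j ξ)) k).integrable_sq
      ((Lp.memLp (G j ξ)).integrable_norm_pow two_ne_zero) fun τ => ?_).trans
      (h2.le.trans (pow_le_pow_left₀ (norm_nonneg _) (hC ξ hξ j) 2))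
    simp only
    rw [← sum_coord_sq]
    exact Finset.single_le_sum (f := fun k => coord (G j ξ τ) k ^ 2)
      (fun _ _ => sq_nonneg _) (Finset.mem_univ k)
  have hb : ∀ j, Integrable (fun ξ => coord (b ξ) j) ν := fun j =>
    (memLp_coord (Lp.memLp b) j).integrable one_le_two
  have hint : ∀ j k, Integrable (fun p : ℝ × ℝ => coord (b p.1) j * P p.1 p.2 j k *
      coord (w p.2) k) (ν.prod ν) := fun j k =>
    integrable_mul_kernel_mul (hPm j k) (hP2 j k) (hPC j k) (hb j) (memLp_coord (Lp.memLp w) k)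
  have hint' : ∀ j k, ∀ᵐ τ ∂ν, Integrable (fun ξ => coord (b ξ) j * P ξ τ j k) ν := fun j k => by
    have h := integrable_mul_kernel_mul (hPm j k) (hP2 j k) (hPC j k) (hb j)
      (memLp_const (μ := ν) (p := 2) (1 : ℝ))
    simpa only [mul_one] using h.prod_left_ae
  -- the kernel operator applied to `w`, paired with `b`
  have h1 : ⟪b, hd.kernelOp hG w⟫_ℝ =
      ∫ ξ, ∫ τ, ∑ j, ∑ k, coord (b ξ) j * P ξ τ j k * coord (w τ) k ∂ν ∂ν := by
    rw [kernelOp, inner_toLp_right]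
    refine integral_congr_ae ?_
    filter_upwards [hIoo, ae_all_iff.2 fun j => ae_all_iff.2 fun k => (hint j k).prod_right_ae]
      with ξ hξ hξ'
    rw [integral_finsetSum _ fun j _ => integrable_finsetSum _ fun k _ => hξ' j k,
      inner_eq_sum_coord]
    refine Finset.sum_congr rfl fun j _ => ?_
    have h2 : coord (kernelFun G w ξ) j = ⟪G j ξ, w⟫_ℝ := by fin_cases j <;> rfl
    rw [h2, L2.inner_def, ← integral_const_mul]
    refine integral_congr_ae ?_
    filter_upwards [hP ξ hξ j] with τ hτ
    rw [hτ, inner_eq_sum_coord, coord_ofCoord, Finset.mul_sum]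
    exact Finset.sum_congr rfl fun k _ => (mul_assoc _ _ _).symm
  have h2 : ∫ ξ, ∫ τ, ∑ j, ∑ k, coord (b ξ) j * P ξ τ j k * coord (w τ) k ∂ν ∂ν =
      ∫ τ, ∑ k, (∫ ξ, ∑ j, coord (b ξ) j * P ξ τ j k ∂ν) * coord (w τ) k ∂ν := by
    rw [integral_integral_swap
      (integrable_finsetSum _ fun j _ => integrable_finsetSum _ fun k _ => hint j k)]
    refine integral_congr_ae ?_
    filter_upwards [ae_all_iff.2 fun j => ae_all_iff.2 fun k => hint' j k] with τ hτ
    have h3 : ∀ ξ, ∑ j, ∑ k, coord (b ξ) j * P ξ τ j k * coord (w τ) k =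
        ∑ k, (∑ j, coord (b ξ) j * P ξ τ j k) * coord (w τ) k := fun ξ => by
      rw [Finset.sum_comm]
      exact Finset.sum_congr rfl fun k _ => (Finset.sum_mul _ _ _).symm
    simp only [h3]
    rw [integral_finsetSum _ fun k _ =>
      (integrable_finsetSum _ fun j _ => hτ j k).mul_const (coord (w τ) k)]
    exact Finset.sum_congr rfl fun k _ => integral_mul_const _ _
  have h3 : ⟪b, hd.kernelOp hG w⟫_ℝ = -⟪b, w⟫_ℝ - ⟪G i s, w⟫_ℝ := by
    have h4 : ∫ τ, (-⟪b τ, w τ⟫_ℝ - ⟪G i s τ, w τ⟫_ℝ) ∂ν = -⟪b, w⟫_ℝ - ⟪G i s, w⟫_ℝ := by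
      rw [L2.inner_def, L2.inner_def, ← integral_neg]
      exact integral_sub (L2.integrable_inner (𝕜 := ℝ) b w).neg
        (L2.integrable_inner (𝕜 := ℝ) (G i s) w)
    rw [h1, h2, ← h4]
    refine integral_congr_ae ?_
    have hne : ∀ᵐ τ ∂ν, τ ≠ s := ae_restrict_of_ae (volume.ae_ne s)
    filter_upwards [hP s hs i, heq, mem_supported_iff.1 hw, hne] with τ hτ h4 h5 h6
    rcases h6.lt_or_gt with h | h
    · rw [hτ, inner_eq_sum_coord, inner_eq_sum_coord, coord_ofCoord, ← Finset.sum_neg_distrib,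
        ← Finset.sum_sub_distrib]
      refine Finset.sum_congr rfl fun k _ => ?_
      have := h4 h k
      rw [eq_neg_of_add_eq_zero_right this]; ring
    · simp [h5 h, coord]
  rw [inner_frameOp_comm, frameOp_eq_add_kernelOp hd hG, inner_add_right, h3]
  ring

end SpectralData

/-! ### The kernels `F₀` and `A` in the variable `s = μ(x)` -/

section
variable {a α : ℝ} {lam al : Label → ℝ} {F0 A : ℝ → ℝ → Matrix (Fin 2) (Fin 2) ℝ}

lemma memLp_row (ha : 0 < a) (hα : 0 < α) (hF0 : IsKernel a α lam al F0) {ξ : ℝ}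
    (hξ : ξ ∈ Icc 0 (mu a α Real.pi)) (i : Fin 2) :
    MemLp (fun τ => ofCoord fun k => F0 ξ (muInv a α τ) i k) 2
      (volume.restrict (Ioo 0 (mu a α Real.pi))) :=
  memLp_ofCoord fun k => memLp_comp_muInv ha hα (hF0.memLp ξ hξ i k)

open Classical in
/-- The `i`-th row of `F₀(ξ, ·)` as a vector, in the variable `τ = μ(t)`; it is `0` by convention
for `ξ` outside of `[0, μ(π)]`, where `F₀(ξ, ·)` need not be square integrable. -/
def kernelRow (a α : ℝ) (F0 : ℝ → ℝ → Matrix (Fin 2) (Fin 2) ℝ) (i : Fin 2) (ξ : ℝ) :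
    Space (mu a α Real.pi) :=
  if h : MemLp (fun τ => ofCoord fun k => F0 ξ (muInv a α τ) i k) 2
      (volume.restrict (Ioo 0 (mu a α Real.pi))) then h.toLp _ else 0

lemma coeFn_kernelRow (ha : 0 < a) (hα : 0 < α) (hF0 : IsKernel a α lam al F0) {ξ : ℝ}
    (hξ : ξ ∈ Icc 0 (mu a α Real.pi)) (i : Fin 2) :
    kernelRow a α F0 i ξ =ᵐ[volume.restrict (Ioo 0 (mu a α Real.pi))]
      fun τ => ofCoord fun k => F0 ξ (muInv a α τ) i k := by
  have h := memLp_row ha hα hF0 hξ i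
  rw [kernelRow, dif_pos h]
  exact h.coeFn_toLp

lemma kernelPartial_apply (N : ℕ) (x t : ℝ) (i k : Fin 2) :
    kernelPartial a α lam al N x t i k =
      (al none)⁻¹ * trig (lam none) x i * trig (lam none) (mu a α t) k +
      ∑ n ∈ Finset.Icc (-(N : ℤ)) N,
        ((al (some n))⁻¹ * trig (lam (some n)) x i * trig (lam (some n)) (mu a α t) k -
          (mu a α Real.pi)⁻¹ * trig (lam0 a α n) x i * trig (lam0 a α n) (mu a α t) k) := by
  simp only [kernelPartial, Matrix.add_apply, Matrix.sum_apply, Matrix.sub_apply, Matrix.smul_apply,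
    Matrix.vecMulVec_apply, phi0, smul_eq_mul, mul_assoc]

lemma wave_eq_ofCoord (l s : ℝ) : wave l s = ofCoord (trig l s) := rfl

lemma coeFn_rowPartial (hα : 0 < α) (N : ℕ) (x : ℝ) (i : Fin 2) :
    SpectralData.rowPartial (mu a α Real.pi) lam al i N x
      =ᵐ[volume.restrict (Ioo 0 (mu a α Real.pi))]
        fun τ => ofCoord fun k => kernelPartial a α lam al N x (muInv a α τ) i k := by
  have hterm : ∀ n : ℤ, SpectralData.rowTerm (mu a α Real.pi) lam al i x n
      =ᵐ[volume.restrict (Ioo 0 (mu a α Real.pi))] fun τ =>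
        ((al (some n))⁻¹ * trig (lam (some n)) x i) • wave (lam (some n)) τ -
          ((mu a α Real.pi)⁻¹ * trig (lam0 a α n) x i) • wave (lam0 a α n) τ := fun n => by
    filter_upwards [coeFn_smul_waveLp ((al (some n))⁻¹ * trig (lam (some n)) x i) (lam (some n)),
      coeFn_smul_waveLp ((mu a α Real.pi)⁻¹ * trig (lam0 a α n) x i) (lam0 a α n),
      Lp.coeFn_sub (((al (some n))⁻¹ * trig (lam (some n)) x i) •
          waveLp (mu a α Real.pi) (lam (some n)))
        (((mu a α Real.pi)⁻¹ * trig (lam0 a α n) x i) • waveLp (mu a α Real.pi) (lam0 a α n))]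
      with τ h1 h2 h3
    rw [SpectralData.rowTerm, ← lam0_eq_node, h3, Pi.sub_apply, h1, h2]
  rw [SpectralData.rowPartial]
  filter_upwards [Lp.coeFn_add
      (((al none)⁻¹ * trig (lam none) x i) • waveLp (mu a α Real.pi) (lam none))
      (∑ n ∈ Finset.Icc (-(N : ℤ)) N, SpectralData.rowTerm (mu a α Real.pi) lam al i x n),
    coeFn_smul_waveLp ((al none)⁻¹ * trig (lam none) x i) (lam none),
    Lp.coeFn_finsetSum (Finset.Icc (-(N : ℤ)) N)
      (fun n => SpectralData.rowTerm (mu a α Real.pi) lam al i x n),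
    ae_all_iff.2 hterm] with τ h1 h2 h3 h4
  rw [h1, Pi.add_apply, h2, h3, Finset.sum_apply, Finset.sum_congr rfl fun n _ => h4 n]
  apply Complex.ext
  all_goals
    simp only [ofCoord, kernelPartial_apply, mu_muInv hα, wave_eq_ofCoord, Complex.add_re,
      Complex.add_im, Complex.re_sum, Complex.im_sum, Complex.sub_re, Complex.sub_im,
      Complex.smul_re, Complex.smul_im, smul_eq_mul]

lemma isRow_kernelRow (ha : 0 < a) (hα : 0 < α) (hF0 : IsKernel a α lam al F0) :
    SpectralData.IsRow (mu a α Real.pi) lam al (kernelRow a α F0) := by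
  intro x hx i
  have hcont : ∀ N k, Continuous fun τ => kernelPartial a α lam al N x (muInv a α τ) i k := by
    intro N k
    simp only [kernelPartial_apply, mu_muInv hα]
    have h := fun l => continuous_trig l k
    exact (continuous_const.mul (h _)).add (continuous_finsetSum _ fun n _ =>
      (continuous_const.mul (h _)).sub (continuous_const.mul (h _)))
  have hmeas : ∀ N k, AEStronglyMeasurable (fun t => kernelPartial a α lam al N x t i k)
      (volume.restrict (Ioo 0 Real.pi)) := by
    intro N k
    refine Measurable.aestronglyMeasurable ?_
    have h := (hcont N k).measurable.comp (measurable_mu (a := a) (α := α))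
    simpa only [Function.comp_def, muInv_mu hα] using h
  refine tendsto_Lp_of_coord (fun N => coeFn_rowPartial hα N x i) (coeFn_kernelRow ha hα hF0 hx i)
    (fun N k => (hcont N k).aestronglyMeasurable.sub
      (memLp_comp_muInv ha hα (hF0.memLp x hx i k)).aestronglyMeasurable) fun k => ?_
  exact tendsto_eLpNorm_comp_muInv ha hα
    (f := fun N t => kernelPartial a α lam al N x t i k - F0 x t i k)
    (fun N => (hmeas N k).sub (hF0.memLp x hx i k).aestronglyMeasurable) (hF0.tendsto x hx i k)

lemma aestronglyMeasurable_kernel (ha : 0 < a) (hα : 0 < α) (hF0 : IsKernel a α lam al F0)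
    (i k : Fin 2) : AEStronglyMeasurable (fun p : ℝ × ℝ => F0 p.1 (muInv a α p.2) i k)
      ((volume.restrict (Ioo 0 (mu a α Real.pi))).prod
        (volume.restrict (Ioo 0 (mu a α Real.pi)))) := by
  have h := hF0.aestronglyMeasurable i k
  rw [Measure.volume_eq_prod, ← Measure.prod_restrict] at h
  exact h.comp_quasiMeasurePreserving
    (MeasureTheory.QuasiMeasurePreserving.prodMap (Measure.QuasiMeasurePreserving.id _)
      (quasiMeasurePreserving_muInv ha hα Real.pi))

lemma mu_mem_Icc (ha : 0 < a) (hα : 0 < α) {x : ℝ} (hx : x ∈ Icc 0 Real.pi) :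
    mu a α x ∈ Icc 0 (mu a α Real.pi) := by
  have h := (strictMono_mu (a := a) hα).monotone
  exact ⟨(mu_zero (α := α) ha).symm.le.trans (h hx.1), h hx.2⟩

lemma memLp_solutionRow (ha : 0 < a) (hα : 0 < α) (hA : SolvesMainEquation a α F0 A) {x : ℝ}
    (hx : x ∈ Ioc 0 Real.pi) (i : Fin 2) :
    MemLp ((Ioo 0 (mu a α x)).indicator fun τ => ofCoord fun k => A x τ i k) 2
      (volume.restrict (Ioo 0 (mu a α Real.pi))) := by
  rw [memLp_indicator_iff_restrict measurableSet_Ioo, Measure.restrict_restrict measurableSet_Ioo,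
    inter_eq_left.2 (Ioo_subset_Ioo_right (mu_mem_Icc ha hα ⟨hx.1.le, hx.2⟩).2)]
  exact memLp_ofCoord fun k => (hA x hx).1 i k

/-- The `i`-th row of `A(x, ·)`, extended by zero to `(0, μ(π))`. -/
def solutionRow (ha : 0 < a) (hα : 0 < α) (hA : SolvesMainEquation a α F0 A) {x : ℝ}
    (hx : x ∈ Ioc 0 Real.pi) (i : Fin 2) : Space (mu a α Real.pi) :=
  (memLp_solutionRow ha hα hA hx i).toLp _

lemma coeFn_solutionRow (ha : 0 < a) (hα : 0 < α) (hA : SolvesMainEquation a α F0 A) {x : ℝ}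
    (hx : x ∈ Ioc 0 Real.pi) (i : Fin 2) :
    solutionRow ha hα hA hx i =ᵐ[volume.restrict (Ioo 0 (mu a α Real.pi))]
      (Ioo 0 (mu a α x)).indicator fun τ => ofCoord fun k => A x τ i k :=
  (memLp_solutionRow ha hα hA hx i).coeFn_toLp

lemma solutionRow_mem_supported (ha : 0 < a) (hα : 0 < α) (hA : SolvesMainEquation a α F0 A)
    {x : ℝ} (hx : x ∈ Ioc 0 Real.pi) (i : Fin 2) :
    solutionRow ha hα hA hx i ∈ supported (mu a α Real.pi) (mu a α x) := by
  rw [mem_supported_iff]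
  filter_upwards [coeFn_solutionRow ha hα hA hx i] with τ h hτ
  rw [h, indicator_of_notMem fun h' => not_lt.2 h'.2.le hτ]

lemma setIntegral_indicator_Ioo {s T : ℝ} (hs : s ∈ Icc 0 T) (f : ℝ → ℝ) :
    ∫ τ in Ioo 0 T, (Ioo 0 s).indicator f τ = ∫ τ in (0 : ℝ)..s, f τ := by
  rw [setIntegral_indicator measurableSet_Ioo, inter_eq_right.2 (Ioo_subset_Ioo_right hs.2),
    intervalIntegral.integral_of_le hs.1, integral_Ioc_eq_integral_Ioo]

lemma coord_indicator (S : Set ℝ) (v : ℝ → Fin 2 → ℝ) (τ : ℝ) (j : Fin 2) :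
    coord (S.indicator (fun τ => ofCoord (v τ)) τ) j = S.indicator (fun τ => v τ j) τ := by
  by_cases h : τ ∈ S
  · rw [indicator_of_mem h, indicator_of_mem h, coord_ofCoord]
  · rw [indicator_of_notMem h, indicator_of_notMem h]; fin_cases j <;> rfl

lemma phi_eq_add_inner (ha : 0 < a) (hα : 0 < α) (hA : SolvesMainEquation a α F0 A)
    {x : ℝ} (hx : x ∈ Ioc 0 Real.pi) (l : ℝ) (i : Fin 2) :
    phi a α A x l i = trig l (mu a α x) i +
      ⟪waveLp (mu a α Real.pi) l, solutionRow ha hα hA hx i⟫_ℝ := by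
  rw [phi, phi0]
  congr 1
  rw [← setIntegral_indicator_Ioo (mu_mem_Icc ha hα ⟨hx.1.le, hx.2⟩), solutionRow,
    inner_toLp_right]
  refine integral_congr_ae ?_
  filter_upwards [(memLp_wave l (mu a α Real.pi)).coeFn_toLp] with τ h
  rw [waveLp, h, wave_eq_ofCoord, inner_eq_sum_coord]
  simp only [coord_indicator, coord_ofCoord]
  by_cases hτ : τ ∈ Ioo 0 (mu a α x)
  · simp only [indicator_of_mem hτ, Matrix.mulVec, dotProduct, mul_comm]
  · simp only [indicator_of_notMem hτ, mul_zero, Finset.sum_const_zero]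

lemma inner_frameOp_solutionRow (ha : 0 < a) (hα : 0 < α)
    (hd : SpectralData (mu a α Real.pi) lam al) (hF0 : IsKernel a α lam al F0)
    (hA : SolvesMainEquation a α F0 A) {x : ℝ} (hx : x ∈ Ioc 0 Real.pi) (i : Fin 2)
    {w : Space (mu a α Real.pi)} (hw : w ∈ supported (mu a α Real.pi) (mu a α x)) :
    ⟪hd.frameOp (solutionRow ha hα hA hx i), w⟫_ℝ = -⟪kernelRow a α F0 i (mu a α x), w⟫_ℝ := by
  have hs := mu_mem_Icc ha hα ⟨hx.1.le, hx.2⟩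
  refine hd.inner_frameOp_row (isRow_kernelRow ha hα hF0)
    (P := fun ξ τ i k => F0 ξ (muInv a α τ) i k) (aestronglyMeasurable_kernel ha hα hF0)
    (fun ξ hξ i => coeFn_kernelRow ha hα hF0 hξ i) hs ?_ hw
  have h1 := (quasiMeasurePreserving_muInv ha hα x).ae (hA x hx).2
  have hint : ∀ τ k, ∫ ξ in Ioo 0 (mu a α Real.pi), ∑ j,
      coord (solutionRow ha hα hA hx i ξ) j * F0 ξ τ j k =
        ∫ ξ in (0 : ℝ)..(mu a α x), (A x ξ * F0 ξ τ) i k := by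
    intro τ k
    rw [← setIntegral_indicator_Ioo hs]
    refine integral_congr_ae ?_
    filter_upwards [coeFn_solutionRow ha hα hA hx i] with ξ h
    simp only [h, coord_indicator]
    by_cases hξ : ξ ∈ Ioo 0 (mu a α x)
    · simp only [indicator_of_mem hξ, Matrix.mul_apply]
    · simp only [indicator_of_notMem hξ, zero_mul, Finset.sum_const_zero]
  rw [ae_restrict_iff' measurableSet_Ioo] at h1
  filter_upwards [ae_restrict_of_ae h1, ae_restrict_mem measurableSet_Ioo,
    coeFn_solutionRow ha hα hA hx i] with τ h2 h3 h4 hτ k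
  have hmem : τ ∈ Ioo 0 (mu a α x) := ⟨h3.1, hτ⟩
  rw [hint, h4, coord_indicator, indicator_of_mem hmem]
  have := h2 hmem i k
  rwa [bigF, mu_muInv hα] at this

/-- The function `φ(x, λ_j)` of the inverse problem is the solution `φ(s, λ_j)` at `s = μ(x)`. -/
lemma phi_eq_coord_sol (ha : 0 < a) (hα : 0 < α)
    (hd : SpectralData (mu a α Real.pi) lam al) (hF0 : IsKernel a α lam al F0)
    (hA : SolvesMainEquation a α F0 A) {x : ℝ} (hx : x ∈ Ioc 0 Real.pi) (j : Label) :
    phi a α A x (lam j) = coord (hd.sol (kernelRow a α F0) j (mu a α x)) := by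
  ext i
  rw [phi_eq_add_inner ha hα hA hx, hd.inner_row_eq (solutionRow_mem_supported ha hα hA hx i)
    (fun w hw => inner_frameOp_solutionRow ha hα hd hF0 hA hx i hw) j]
  fin_cases i <;>
    simp [SpectralData.sol, SpectralData.residual, coord, SpectralData.kernelFun, wave, trig,
      sub_eq_add_neg]

lemma gramIntegrand_eq (ha : 0 < a) (hα : 0 < α)
    (hd : SpectralData (mu a α Real.pi) lam al) (hF0 : IsKernel a α lam al F0)
    (hA : SolvesMainEquation a α F0 A) {x : ℝ} (hx : x ∈ Ioc 0 Real.pi) (j k : Label) :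
    gramIntegrand a α A (lam j) (lam k) x =
      ⟪hd.sol (kernelRow a α F0) j (mu a α x), hd.sol (kernelRow a α F0) k (mu a α x)⟫_ℝ *
        rho a α x := by
  rw [gramIntegrand, phi_eq_coord_sol ha hα hd hF0 hA hx, phi_eq_coord_sol ha hα hd hF0 hA hx,
    inner_eq_sum_coord, dotProduct]

/-- The Gram matrix of the `φ(·, λ_j)` with weight `ρ` is that of the dual frame. -/
lemma integral_gramIntegrand (ha : 0 < a) (hα : 0 < α)
    (hd : SpectralData (mu a α Real.pi) lam al) (hF0 : IsKernel a α lam al F0)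
    (hA : SolvesMainEquation a α F0 A) (j k : Label) :
    IntervalIntegrable (gramIntegrand a α A (lam j) (lam k)) volume 0 Real.pi ∧
      ∫ x in (0 : ℝ)..Real.pi, gramIntegrand a α A (lam j) (lam k) x =
        ⟪waveLp (mu a α Real.pi) (lam k), hd.frameInv j⟫_ℝ := by
  have hG := isRow_kernelRow ha hα hF0
  have hcont : ContinuousOn (fun s => ⟪hd.sol (kernelRow a α F0) j s,
      hd.sol (kernelRow a α F0) k s⟫_ℝ) (Icc 0 (mu a α Real.pi)) :=
    (hd.continuousOn_sol hG j).inner (hd.continuousOn_sol hG k)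
  obtain ⟨h1, h2⟩ := integrable_comp_mu_mul_rho ha hα
    (f := fun s => ⟪hd.sol (kernelRow a α F0) j s, hd.sol (kernelRow a α F0) k s⟫_ℝ)
    (L := Real.pi) (hcont.integrableOn_Icc.mono_set Ioo_subset_Icc_self)
  have hcongr : (fun x => ⟪hd.sol (kernelRow a α F0) j (mu a α x),
      hd.sol (kernelRow a α F0) k (mu a α x)⟫_ℝ * rho a α x)
        =ᵐ[volume.restrict (Ioo 0 Real.pi)] gramIntegrand a α A (lam j) (lam k) := by
    filter_upwards [ae_restrict_mem measurableSet_Ioo] with x hx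
    exact (gramIntegrand_eq ha hα hd hF0 hA ⟨hx.1, hx.2.le⟩ j k).symm
  refine ⟨?_, ?_⟩
  · rw [intervalIntegrable_iff_integrableOn_Ioo_of_le Real.pi_pos.le]
    exact h1.congr hcongr
  · rw [intervalIntegral.integral_of_le Real.pi_pos.le, integral_Ioc_eq_integral_Ioo,
      ← integral_congr_ae hcongr, h2, ← hd.integral_inner_sol hG j k,
      intervalIntegral.integral_of_le hd.length_pos.le, integral_Ioc_eq_integral_Ioo]

end

namespace SpectralData
variable {T : ℝ} {lam al : Label → ℝ} {G : Fin 2 → ℝ → Space T}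

/-- The series for the kernel at the right end, where the components of the vectors `e(T, nπ/T)`
are `0` and `-(-1)ⁿ`. -/
lemma tendsto_row_right (hd : SpectralData T lam al) (hG : IsRow T lam al G) {i : Fin 2} {κ : ℝ}
    (hκ : ∀ n : ℤ, trig (node T n) T i = -(κ * (-1) ^ n)) {b : Space T}
    (hb : ∀ w, ⟪hd.frameOp b, w⟫_ℝ = -⟪G i T, w⟫_ℝ) (w : Space T) :
    Tendsto (fun N : ℕ => (al none)⁻¹ * (trig (lam none) T i * ⟪waveLp T (lam none), w⟫_ℝ) +
      ∑ n ∈ Finset.Icc (-(N : ℤ)) N, ((al (some n))⁻¹ *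
        (trig (lam (some n)) T i * ⟪waveLp T (lam (some n)), w⟫_ℝ) -
          T⁻¹ * (-(κ * (-1) ^ n) * ⟪waveLp T (node T n), w⟫_ℝ))) atTop
        (𝓝 (-⟪hd.frameOp b, w⟫_ℝ)) := by
  rw [hb, neg_neg]
  refine ((hG T ⟨hd.length_pos.le, le_rfl⟩ i).inner tendsto_const_nhds).congr fun N => ?_
  simp only [rowPartial, rowTerm, inner_add_left, sum_inner, inner_sub_left, real_inner_smul_left,
    hκ, mul_assoc]

end SpectralData

end DiracInverse

end

theorem mainTheorem7 (a α : ℝ) (ha : 0 < a) (haπ : a < Real.pi) (hα : 0 < α) (hα1 : α ≠ 1)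
    (lam al : Label → ℝ) (hdata : IsData a α lam al)
    (F0 A : ℝ → ℝ → Matrix (Fin 2) (Fin 2) ℝ)
    (hF0 : IsKernel a α lam al F0) (hA : SolvesMainEquation a α F0 A) :
    (∀ j, beta a α lam al j ≠ 0) ∧
    (∀ j k, IntervalIntegrable (gramIntegrand a α A (lam j) (lam k)) volume 0 Real.pi) ∧
    ∃ h₁ h₂ H : ℝ,
      -- the boundary condition
      (∀ j, (lam j + h₁) * phi a α A Real.pi (lam j) 0
        + h₂ * phi a α A Real.pi (lam j) 1 = 0) ∧
      0 < h₂ ∧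
      -- how the constants are determined from the data
      (∀ j, beta a α lam al j * phi a α A Real.pi (lam j) 0 = h₂) ∧
      (∀ j, beta a α lam al j * phi a α A Real.pi (lam j) 1 = -(lam j + h₁)) ∧
      -- the constant `H`, and its value
      (∀ j, ∫ x in (0 : ℝ)..Real.pi, gramIntegrand a α A (lam j) (lam j) x
        = al j - H / beta a α lam al j ^ 2) ∧
      (∀ j k, j ≠ k → ∫ x in (0 : ℝ)..Real.pi, gramIntegrand a α A (lam j) (lam k) x
        = -(H / (beta a α lam al j * beta a α lam al k))) ∧
      h₂ = H := by
  have hT : 0 < mu a α Real.pi := by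
    rw [← mu_zero (α := α) ha]; exact strictMono_mu hα Real.pi_pos
  have hd := hdata.spectralData hT
  have hβ : ∀ j, beta a α lam al j ≠ 0 := fun j => by
    rw [hd.beta_eq]; exact div_ne_zero (hd.derivCoeff_ne_zero j) (hd.pos j).ne'
  have hG := isRow_kernelRow ha hα hF0
  have hπ : Real.pi ∈ Ioc 0 Real.pi := ⟨Real.pi_pos, le_rfl⟩
  have hgram := integral_gramIntegrand ha hα hd hF0 hA
  set b := solutionRow ha hα hA hπ with hb
  have hrow : ∀ i w, ⟪hd.frameOp (b i), w⟫_ℝ = -⟪kernelRow a α F0 i (mu a α Real.pi), w⟫_ℝ :=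
    fun i w => inner_frameOp_solutionRow ha hα hd hF0 hA hπ i (by rw [supported_right]; trivial)
  have h0 : ∀ j, beta a α lam al j * phi a α A Real.pi (lam j) 0 = hd.excess := fun j => by
    have h := hd.endpoint_first (b 0) (hd.tendsto_row_right hG (i := 0) (κ := 0)
      (fun n => by simp [trig, sin_node hT]) (hrow 0)) j
    rw [phi_eq_add_inner ha hα hA hπ, hd.beta_eq, ← h]
    simp only [trig, Matrix.cons_val_zero]
    ring
  -- `h₁` is read off from the label `-0`, the relation between the labels gives it for the others
  set y := phi a α A Real.pi (lam none) 1 / al none * hd.derivCoeff none with hy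
  have h1 : ∀ j, beta a α lam al j * phi a α A Real.pi (lam j) 1 = -(lam j + (-y - lam none)) :=
    fun j => by
    have h := hd.endpoint_relation (b 1) (fun j => trig (lam j) (mu a α Real.pi) 1) 1
      (hd.tendsto_row_right hG (i := 1) (κ := 1) (fun n => by simp [trig, cos_node hT]) (hrow 1)) j
    rw [← phi_eq_add_inner ha hα hA hπ, ← phi_eq_add_inner ha hα hA hπ, ← hy] at h
    rw [hd.beta_eq]
    linear_combination h
  refine ⟨hβ, fun j k => (hgram j k).1, -y - lam none, hd.excess, hd.excess, fun j => ?_,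
    hd.excess_pos, h0, h1, fun j => ?_, fun j k hjk => ?_, rfl⟩
  · refine (mul_right_inj' (hβ j)).1 ?_
    linear_combination (lam j + (-y - lam none)) * h0 j + hd.excess * h1 j
  · rw [(hgram j j).2, hd.inner_frameInv, if_pos rfl, hd.beta_eq]
    have := hd.derivCoeff_ne_zero j
    have := (hd.pos j).ne'
    field_simp
  · rw [(hgram j k).2, hd.inner_frameInv, if_neg hjk.symm, hd.beta_eq, hd.beta_eq]
    have := hd.derivCoeff_ne_zero j
    have := hd.derivCoeff_ne_zero k
    have := (hd.pos j).ne'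
    have := (hd.pos k).ne'
    field_simp
    ring
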